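/- Let $A$ be an associative unital ring and let $S\subset A[t]$ be a multiplicative subset (containing $1$) that consists of monic polynomials lying in the center of $A[t]$ and that contains $t$. For $p\in S$ of degree $d$ put $\tilde p(t)=t^dp(1/t)$, let $T=\{\tilde p \mid p\in S\}$, and let $A[t]_S$, $A[t]_T$ be the localizations. Write $A[t^{-1}]_T$ for $A[t]_T$ with its variable renamed $t^{-1}$; there is a canonical ring homomorphism $\lambda\colon A[t^{-1}]_T\to A[t]_S$, $t^{-1}\mapsto 1/t$. For a Waldhausen category $\mathcal C$ whose weak equivalences are the isomorphisms, let $K(\mathcal C)=\Omega|iS_\bullet\mathcal C|$ be its $K$-theory space. Let $K(A)=K(P(A))$, with $P(A)$ the category of finitely generated projective right $A$-modules and short exact sequences as cofibration sequences. Let $\mathrm{End}_A^S$ be the category of pairs $(P,f)$ with $P$ in $P(A)$ and $f\colon P\to P$ such that $p(f)=0$ for some $p\in S$, and let $\mathrm{Aut}_B$ be the category of pairs $(P,g)$ with $P$ in $P(B)$ and $g$ an automorphism of $P$; in both, a sequence is a cofibration sequence if its sequence of underlying modules is one. The coassembly map $c\colon K(\mathrm{Aut}_B)\to LK(B)$ to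 the free loop space is the adjoint of the self-homotopy of the forgetful map $K(\mathrm{Aut}_B)\to K(B)$ that is given by the tautological natural automorphism $g$ of $(P,g)\mapsto P$. Define $$\tau(t)\colon K(\mathrm{End}_A^S)\to LK(A[t]_S),\qquad \zeta(t)\colon K(\mathrm{End}_A^S)\to LK(A[t]_T)$$ as the compositions of $c$ with the maps induced by $(P,f)\mapsto (P\otimes_A A[t]_S,\ t-f)$ and $(P,f)\mapsto (P\otimes_A A[t]_T,\ (1-ft)^{-1})$ respectively. Let $\widetilde K(\mathrm{End}_A^S)$ be the homotopy fiber of the forgetful map $K(\mathrm{End}_A^S)\to K(A)$, $(P,f)\mapsto P$. As $\tau(t)$ and $\zeta(t)$ lie over the extension of scalars maps $K(A)\to K(A[t]_S)$ and $K(A)\to K(A[t]_T)$ (with respect to evaluation of free loops at the base point of the circle), passing to homotopy fibers gives based maps $$\tilde\tau(t)\colon \widetilde K(\mathrm{End}_A^S)\to \Omega K(A[t]_S),\qquad \tilde\zeta(t)\colon \widetilde K(\mathrm{End}_A^S)\to \Omega K(A[t]_T):$$ a point $x$ of $K(\mathrm{End}_A^S)$ with a path in $K(A)$ from the base point to the image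 of $x$ is sent to the loop $\tau(t)(x)$, respectively $\zeta(t)(x)$, conjugated by the image of that path. Regard $\tilde\zeta(t)$ as a map to $\Omega K(A[t^{-1}]_T)$, and let $\tilde\zeta(t^{-1})\colon \widetilde K(\mathrm{End}_A^S)\to \Omega K(A[t]_S)$ be its composition with $\Omega K(\lambda)$. Then $\tilde\tau(t)$ and $\tilde\zeta(t^{-1})$ are additive inverses in the homotopy category: the loop products $\tilde\tau(t)\ast\tilde\zeta(t^{-1})$ and $\tilde\zeta(t^{-1})\ast\tilde\tau(t)$ are both homotopic, relative to the base point of $\widetilde K(\mathrm{End}_A^S)$, to the constant map to the constant loop. Hence $\tilde\tau(t)$ factors canonically, up to homotopy relative to the base point, through $\Omega K(A[t^{-1}]_T)$: it is homotopic to the composition $$\widetilde K(\mathrm{End}_A^S)\xrightarrow{\ -\tilde\zeta(t)\ }\Omega K(A[t^{-1}]_T)\xrightarrow{\ \Omega K(\lambda)\ }\Omega K(A[t]_S),$$ where $-\tilde\zeta(t)$ is $\tilde\zeta(t)$ followed by the reversal of loops. -/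

import Mathlib

open CategoryTheory Polynomial TensorProduct MulOpposite

universe u

noncomputable section
namespace KTau

/-! ### Extension of scalars along a ring homomorphism (not necessarily commutative) -/

section BaseChange

variable {R S : Type u} [Ring R] [Ring S] (φ : R →+* S)

/-- The relations `s φ(r) ⊗ m = s ⊗ r m` imposed on `S ⊗_ℤ M`. -/
def bcRel (M : Type u) [AddCommGroup M] [Module R M] : Submodule S (S ⊗[ℤ] M) :=
  Submodule.span S {x | ∃ (s : S) (r : R) (m : M), x = (s * φ r) ⊗ₜ[ℤ] m - s ⊗ₜ[ℤ] (r • m)}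

/-- `S ⊗_R M` for a left `R`-module `M` and a homomorphism `φ : R → S` of rings. -/
def BC (M : Type u) [AddCommGroup M] [Module R M] : Type u := (S ⊗[ℤ] M) ⧸ bcRel φ M

variable (M : Type u) [AddCommGroup M] [Module R M]
variable {N : Type u} [AddCommGroup N] [Module R N]
variable {Q : Type u} [AddCommGroup Q] [Module R Q]

instance : AddCommGroup (BC φ M) := inferInstanceAs (AddCommGroup ((S ⊗[ℤ] M) ⧸ bcRel φ M))
instance : Module S (BC φ M) := inferInstanceAs (Module S ((S ⊗[ℤ] M) ⧸ bcRel φ M))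

variable {M}

/-- The class `s ⊗ m`. -/
def bcMk (s : S) (m : M) : BC φ M := (bcRel φ M).mkQ (s ⊗ₜ[ℤ] m)

lemma smul_bcMk (s s' : S) (m : M) : s • bcMk φ s' m = bcMk φ (s * s') m := rfl

lemma bcMk_rel (s : S) (r : R) (m : M) : bcMk φ (s * φ r) m = bcMk φ s (r • m) :=
  (Submodule.Quotient.eq _).2 (Submodule.subset_span ⟨s, r, m, rfl⟩)

lemma bcMk_add_right (s : S) (m m' : M) : bcMk φ s (m + m') = bcMk φ s m + bcMk φ s m' := by
  simp only [bcMk, tmul_add, map_add]; rfl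

lemma bcMk_zero_right (s : S) : bcMk φ s (0 : M) = 0 := by
  simp only [bcMk, tmul_zero, map_zero]; rfl

lemma bcMk_sum_right (s : S) {ι : Type*} (t : Finset ι) (m : ι → M) :
    bcMk φ s (∑ i ∈ t, m i) = ∑ i ∈ t, bcMk φ s (m i) := by
  classical
  induction t using Finset.induction_on with
  | empty => simp [bcMk_zero_right]
  | insert a t ha ih => simp [Finset.sum_insert ha, bcMk_add_right, ih]

lemma bc_induction {p : BC φ M → Prop} (x : BC φ M) (h0 : p 0) (hmk : ∀ s m, p (bcMk φ s m))
    (hadd : ∀ x y, p x → p y → p (x + y)) : p x := by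
  obtain ⟨y, rfl⟩ := (bcRel φ M).mkQ_surjective x
  induction y using TensorProduct.induction_on with
  | zero => rw [map_zero]; exact h0
  | tmul s m => exact hmk s m
  | add a b ha hb => rw [map_add]; exact hadd _ _ ha hb

lemma bc_ext {V : Type*} [AddCommGroup V] [Module S V] {f g : BC φ M →ₗ[S] V}
    (h : ∀ m, f (bcMk φ 1 m) = g (bcMk φ 1 m)) : f = g := by
  ext x
  induction x using bc_induction with
  | h0 => simp
  | hmk s m =>
    have : bcMk φ s m = s • bcMk φ 1 m := by rw [smul_bcMk, mul_one]
    rw [this, map_smul, map_smul, h]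
  | hadd x y hx hy => rw [map_add, map_add, hx, hy]

/-- The universal property of `S ⊗_R M`. -/
def bcLift {V : Type u} [AddCommGroup V] [Module S V] (f : M →+ V)
    (hf : ∀ (r : R) m, f (r • m) = φ r • f m) : BC φ M →ₗ[S] V :=
  (bcRel φ M).liftQ
    (AlgebraTensorModule.lift
      (LinearMap.toSpanSingleton S (M →ₗ[ℤ] V) f.toIntLinearMap)) (by
    rw [bcRel, Submodule.span_le]
    rintro _ ⟨s, r, m, rfl⟩
    simp [hf, mul_smul])

lemma bcLift_mk {V : Type u} [AddCommGroup V] [Module S V] (f : M →+ V)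
    (hf : ∀ (r : R) m, f (r • m) = φ r • f m) (s : S) (m : M) :
    bcLift φ f hf (bcMk φ s m) = s • f m := by
  simp only [bcLift, bcMk]
  erw [Submodule.liftQ_apply]
  simp

/-- Functoriality of `S ⊗_R M`. -/
def bcMap (f : M →ₗ[R] N) : BC φ M →ₗ[S] BC φ N :=
  bcLift φ
    { toFun := fun m => bcMk φ 1 (f m)
      map_zero' := by rw [map_zero, bcMk_zero_right]
      map_add' := fun x y => by rw [map_add, bcMk_add_right] }
    (fun r m => by
      change bcMk φ 1 (f (r • m)) = φ r • bcMk φ 1 (f m)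
      rw [map_smul, smul_bcMk, ← bcMk_rel, one_mul, mul_one])

lemma bcMap_mk (f : M →ₗ[R] N) (s : S) (m : M) : bcMap φ f (bcMk φ s m) = bcMk φ s (f m) := by
  rw [bcMap, bcLift_mk]
  change s • bcMk φ 1 (f m) = _
  rw [smul_bcMk, mul_one]

lemma bcMap_id : bcMap φ (LinearMap.id : M →ₗ[R] M) = LinearMap.id :=
  bc_ext φ fun m => by rw [bcMap_mk]; rfl

lemma bcMap_comp (g : N →ₗ[R] Q) (f : M →ₗ[R] N) :
    bcMap φ (g ∘ₗ f) = bcMap φ g ∘ₗ bcMap φ f :=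
  bc_ext φ fun m => by simp [bcMap_mk]

lemma bcMap_add (f g : M →ₗ[R] N) : bcMap φ (f + g) = bcMap φ f + bcMap φ g :=
  bc_ext φ fun m => by simp [bcMap_mk, bcMk_add_right]

lemma bcMap_zero : bcMap φ (0 : M →ₗ[R] N) = 0 :=
  bc_ext φ fun m => by simp [bcMap_mk, bcMk_zero_right]

variable (M) in
lemma bc_finite [Module.Finite R M] : Module.Finite S (BC φ M) := by
  classical
  obtain ⟨s, hs⟩ := (Module.Finite.fg_top : (⊤ : Submodule R M).FG)
  refine ⟨⟨s.image (bcMk φ 1), ?_⟩⟩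
  rw [eq_top_iff]
  have key : ∀ m : M, bcMk φ 1 m ∈ Submodule.span S ((s.image (bcMk φ 1) : Finset (BC φ M)) :
      Set (BC φ M)) := by
    intro m
    have hm : m ∈ Submodule.span R (s : Set M) := by rw [hs]; trivial
    induction hm using Submodule.span_induction with
    | mem x hx => exact Submodule.subset_span (by simpa using ⟨x, hx, rfl⟩)
    | zero => rw [bcMk_zero_right]; exact zero_mem _
    | add x y _ _ hx hy => rw [bcMk_add_right]; exact add_mem hx hy
    | smul r x _ hx =>
      rw [← bcMk_rel, one_mul, ← mul_one (φ r), ← smul_bcMk]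
      exact Submodule.smul_mem _ _ hx
  rintro x -
  induction x using bc_induction with
  | h0 => exact zero_mem _
  | hmk a m =>
    rw [← mul_one a, ← smul_bcMk]
    exact Submodule.smul_mem _ _ (key m)
  | hadd x y hx hy => exact add_mem hx hy

variable (M) in
lemma bc_projective [Module.Projective R M] : Module.Projective S (BC φ M) := by
  refine Module.Projective.of_lifting_property'' (R := S) (P := BC φ M) fun f hf => ?_
  let V := BC φ M →₀ S
  let _ : Module R V := Module.compHom V φ
  let _ : Module R (BC φ M) := Module.compHom (BC φ M) φ
  let f' : V →ₗ[R] BC φ M :=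
    { toFun := f, map_add' := map_add f, map_smul' := fun r x => map_smul f (φ r) x }
  let g' : M →ₗ[R] BC φ M :=
    { toFun := bcMk φ 1
      map_add' := bcMk_add_right φ 1
      map_smul' := fun r x => by
        change bcMk φ 1 (r • x) = φ r • bcMk φ 1 x
        rw [← bcMk_rel, smul_bcMk, one_mul, mul_one] }
  obtain ⟨h, hh⟩ := Module.projective_lifting_property f' g' hf
  refine ⟨bcLift φ h.toAddMonoidHom (fun r m => h.map_smul r m), bc_ext φ fun m => ?_⟩
  refine (congrArg f ((bcLift_mk (V := BC φ M →₀ S) φ h.toAddMonoidHom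
    (fun r m => h.map_smul r m) 1 m).trans (one_smul _ _))).trans ?_
  exact LinearMap.congr_fun hh m

end BaseChange

/-- In a ring, let `x, y` commute, and let the `a i` commute with `x - y`.
If `∑ a i y ^ i = 0` and `∑ a i x ^ i` is a unit, then `x - y` is a unit. -/
lemma isUnit_sub_of_sum {E : Type*} [Ring E] {x y : E} (hxy : Commute x y) (a : ℕ → E)
    (ha : ∀ i, Commute (a i) (x - y)) (t : Finset ℕ) (h0 : ∑ i ∈ t, a i * y ^ i = 0)
    (hu : IsUnit (∑ i ∈ t, a i * x ^ i)) : IsUnit (x - y) := by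
  set c := ∑ i ∈ t, a i * ∑ j ∈ Finset.range i, x ^ j * y ^ (i - 1 - j) with hc
  set U := ∑ i ∈ t, a i * x ^ i with hU
  have hU' : U = ∑ i ∈ t, a i * (x ^ i - y ^ i) := by
    simp only [mul_sub, Finset.sum_sub_distrib, h0, sub_zero, hU]
  have h1 : c * (x - y) = U := by
    rw [hc, hU', Finset.sum_mul]
    exact Finset.sum_congr rfl fun i _ => by rw [mul_assoc, hxy.geom_sum₂_mul]
  have h2 : (x - y) * c = U := by
    rw [hc, hU', Finset.mul_sum]
    exact Finset.sum_congr rfl fun i _ => by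
      rw [← mul_assoc, ← (ha i).eq, mul_assoc, hxy.mul_geom_sum₂]
  obtain ⟨v, hv⟩ := hu
  have hl : (↑v⁻¹ * c) * (x - y) = 1 := by rw [mul_assoc, h1, ← hv]; simp
  have hr : (x - y) * (c * ↑v⁻¹) = 1 := by rw [← mul_assoc, h2, ← hv]; simp
  have heq : (↑v⁻¹ * c) = c * ↑v⁻¹ := by
    calc (↑v⁻¹ * c) = (↑v⁻¹ * c) * ((x - y) * (c * ↑v⁻¹)) := by rw [hr, mul_one]
      _ = c * ↑v⁻¹ := by rw [← mul_assoc, hl, one_mul]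
  exact ⟨⟨x - y, c * ↑v⁻¹, hr, by rw [← heq, hl]⟩, rfl⟩


/-! ### Categories with a zero object and cofibration sequences -/

/-- A category with a chosen zero object `pt` and a class of sequences `X ⟶ Y ⟶ Z`, the
cofibration sequences `X ↣ Y ↠ Y/X`.  This is the data of a Waldhausen category that enters
the `S.` construction when the weak equivalences are the isomorphisms. -/
class CofCat (C : Type*) [Category C] where
  /-- the chosen zero object -/
  pt : C
  /-- it is a zero object -/
  isZero_pt : Limits.IsZero pt
  /-- `X ⟶ Y ⟶ Z` is a cofibration followed by (a choice of) its quotient -/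
  IsCofSeq : ∀ {X Y Z : C}, (X ⟶ Y) → (Y ⟶ Z) → Prop
  /-- `0 ⟶ 0 ⟶ 0` is a cofibration sequence -/
  cofSeq_pt : IsCofSeq (𝟙 pt) (𝟙 pt)

/-- Exact functors: they preserve the zero object and cofibration sequences. -/
structure IsExactFunctor {C D : Type*} [Category C] [Category D] [CofCat C] [CofCat D]
    (F : C ⥤ D) : Prop where
  map_pt : F.obj CofCat.pt = CofCat.pt
  map_cofSeq : ∀ {X Y Z : C} (f : X ⟶ Y) (g : Y ⟶ Z),
    CofCat.IsCofSeq f g → CofCat.IsCofSeq (F.map f) (F.map g)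

lemma IsExactFunctor.comp {C D E : Type*} [Category C] [Category D] [Category E]
    [CofCat C] [CofCat D] [CofCat E] {F : C ⥤ D} {G : D ⥤ E}
    (hF : IsExactFunctor F) (hG : IsExactFunctor G) : IsExactFunctor (F ⋙ G) where
  map_pt := by rw [Functor.comp_obj, hF.map_pt, hG.map_pt]
  map_cofSeq f g h := hG.map_cofSeq _ _ (hF.map_cofSeq f g h)

/-- The property of being a finitely generated projective module. -/
def isFGProj (R : Type u) [Ring R] : ObjectProperty (ModuleCat.{u} R) :=
  fun M => Module.Finite R M ∧ Module.Projective R M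

/-- `P(A)`: the category of finitely generated projective right `A`-modules.  Right `A`-modules
are modules over the opposite ring. -/
abbrev PMod (A : Type u) [Ring A] : Type (u + 1) := (isFGProj Aᵐᵒᵖ).FullSubcategory

variable {A B : Type u} [Ring A] [Ring B]

/-- The underlying linear map of a morphism of `P(A)`. -/
abbrev lin {P Q : PMod A} (f : P ⟶ Q) : P.obj →ₗ[Aᵐᵒᵖ] Q.obj := f.hom.hom

/-- The morphism of `P(A)` given by a linear map. -/
abbrev ofLin {P Q : PMod A} (f : P.obj →ₗ[Aᵐᵒᵖ] Q.obj) : P ⟶ Q :=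
  ObjectProperty.homMk (ModuleCat.ofHom f)

lemma lin_ext {P Q : PMod A} {f g : P ⟶ Q} (h : lin f = lin g) : f = g :=
  ObjectProperty.hom_ext _ (ModuleCat.hom_ext h)

/-- The zero module as an object of `P(A)`. -/
def zeroMod (A : Type u) [Ring A] : PMod A :=
  ⟨ModuleCat.of Aᵐᵒᵖ PUnit.{u + 1}, inferInstanceAs (Module.Finite Aᵐᵒᵖ PUnit.{u + 1}),
    inferInstanceAs (Module.Projective Aᵐᵒᵖ PUnit.{u + 1})⟩

instance : Subsingleton (zeroMod A).obj := inferInstanceAs (Subsingleton PUnit)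

lemma isZero_of_subsingleton (P : PMod A) [Subsingleton P.obj] : Limits.IsZero P where
  unique_to Q := ⟨⟨⟨ofLin 0⟩, fun f => lin_ext (by
    ext x; rw [Subsingleton.elim x 0, map_zero, map_zero])⟩⟩
  unique_from Q := ⟨⟨⟨ofLin 0⟩, fun f => lin_ext (by
    ext x; exact Subsingleton.elim _ _)⟩⟩

/-- In `P(A)` a cofibration is a monomorphism with projective cokernel.  As the third term of a
short exact sequence in `P(A)` is projective, cofibration sequences are the short exact ones. -/
instance : CofCat (PMod A) where
  pt := zeroMod A
  isZero_pt := isZero_of_subsingleton _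
  IsCofSeq f g := Function.Injective (lin f) ∧ Function.Exact (lin f) (lin g) ∧
    Function.Surjective (lin g)
  cofSeq_pt := ⟨Function.injective_of_subsingleton (α := (zeroMod A).obj) _,
    fun y => ⟨fun _ => ⟨y, rfl⟩, fun _ => Subsingleton.elim (α := (zeroMod A).obj) _ _⟩,
    fun y => ⟨y, rfl⟩⟩

/-! ### Endomorphism categories -/

section EndCat

variable (C : Type*) [Category C]

/-- Objects of `End(C)`: pairs `(P, f)` with `f : P ⟶ P`. -/
structure EndCat where
  /-- the underlying object -/
  obj : C
  /-- the endomorphism -/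
  φ : obj ⟶ obj

variable {C}

/-- Morphisms of `End(C)`: morphisms commuting with the endomorphisms. -/
@[ext]
structure EndCat.Hom (X Y : EndCat C) where
  /-- the underlying morphism -/
  hom : X.obj ⟶ Y.obj
  comm : X.φ ≫ hom = hom ≫ Y.φ

instance : Category (EndCat C) where
  Hom X Y := EndCat.Hom X Y
  id X := ⟨𝟙 _, by simp⟩
  comp f g := ⟨f.hom ≫ g.hom, by rw [← Category.assoc, f.comm, Category.assoc, g.comm,
    Category.assoc]⟩

@[ext]
lemma EndCat.hom_ext {X Y : EndCat C} {f g : X ⟶ Y} (h : f.hom = g.hom) : f = g :=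
  EndCat.Hom.ext h

@[simp] lemma EndCat.id_hom (X : EndCat C) : (𝟙 X : X ⟶ X).hom = 𝟙 X.obj := rfl
@[simp] lemma EndCat.comp_hom {X Y Z : EndCat C} (f : X ⟶ Y) (g : Y ⟶ Z) :
    (f ≫ g).hom = f.hom ≫ g.hom := rfl

lemma EndCat.obj_ext {X Y : EndCat C} (h : X.obj = Y.obj) (hZ : Limits.IsZero Y.obj) : X = Y := by
  obtain ⟨x, f⟩ := X
  obtain ⟨y, g⟩ := Y
  obtain rfl : x = y := h
  congr 1
  exact hZ.eq_of_src _ _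

variable (C) in
/-- The forgetful functor `(P, f) ↦ P`. -/
@[simps]
def EndCat.forget : EndCat C ⥤ C where
  obj X := X.obj
  map f := f.hom

variable [CofCat C]

/-- The zero object `(0, 0)` of `End(C)`. -/
def EndCat.zero : EndCat C := ⟨CofCat.pt, 𝟙 _⟩

lemma EndCat.isZero_zero : Limits.IsZero (EndCat.zero : EndCat C) where
  unique_to _ := ⟨⟨⟨⟨CofCat.isZero_pt.to_ _, CofCat.isZero_pt.eq_of_src _ _⟩⟩, fun _ =>
    EndCat.hom_ext (CofCat.isZero_pt.eq_of_src _ _)⟩⟩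
  unique_from _ := ⟨⟨⟨⟨CofCat.isZero_pt.from_ _, CofCat.isZero_pt.eq_of_tgt _ _⟩⟩, fun _ =>
    EndCat.hom_ext (CofCat.isZero_pt.eq_of_tgt _ _)⟩⟩

/-- The structure on a full subcategory of `End(C)` containing `(0, 0)`: a sequence is a
cofibration sequence if and only if it is one in `C`. -/
@[reducible]
def endSubCofCat (W : ObjectProperty (EndCat C)) (h : W EndCat.zero) :
    CofCat W.FullSubcategory where
  pt := ⟨EndCat.zero, h⟩
  isZero_pt :=
    { unique_to := fun _ => ⟨⟨⟨ObjectProperty.homMk (EndCat.isZero_zero.to_ _)⟩, fun _ =>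
        ObjectProperty.hom_ext _ (EndCat.isZero_zero.eq_of_src _ _)⟩⟩
      unique_from := fun _ => ⟨⟨⟨ObjectProperty.homMk (EndCat.isZero_zero.from_ _)⟩, fun _ =>
        ObjectProperty.hom_ext _ (EndCat.isZero_zero.eq_of_tgt _ _)⟩⟩ }
  IsCofSeq f g := CofCat.IsCofSeq f.hom.hom g.hom.hom
  cofSeq_pt := CofCat.cofSeq_pt (C := C)

variable (C) in
/-- The property of `(P, f)` that `f` is an automorphism. -/
def isAut : ObjectProperty (EndCat C) := fun X => IsIso X.φ

variable (C) in
/-- `Aut(C)`: the full subcategory of `End(C)` of the `(P, f)` with `f` an automorphism. -/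
abbrev AutCat := (isAut C).FullSubcategory

instance : CofCat (AutCat C) := endSubCofCat _ (inferInstanceAs (IsIso (𝟙 (CofCat.pt : C))))

variable (C) in
/-- The forgetful functor `Aut(C) ⥤ C`. -/
abbrev AutCat.forget : AutCat C ⥤ C := (isAut C).ι ⋙ EndCat.forget C

lemma AutCat.forget_exact : IsExactFunctor (AutCat.forget C) := ⟨rfl, fun _ _ h => h⟩

end EndCat

/-! ### Torsion endomorphisms -/

/-- `p(f) x`, where `p(f) = ∑ f ^ i · aᵢ` for `p = ∑ aᵢ t ^ i` and `f` an endomorphism of a right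
`A`-module. -/
def polyAct {P : PMod A} (p : A[X]) (f : P ⟶ P) (x : P.obj) : P.obj :=
  p.sum fun i a => op a • ((lin f) ^ i) x

/-- The property of `(P, f)` that `p(f) = 0` for some `p ∈ S`. -/
def isTorsion (S : Submonoid A[X]) : ObjectProperty (EndCat (PMod A)) :=
  fun X => ∃ p ∈ S, ∀ x, polyAct p X.φ x = 0

/-- `End_A^S`: the endomorphisms of finitely generated projective modules that are `S`-torsion. -/
abbrev EndS (S : Submonoid A[X]) : Type (u + 1) := (isTorsion S).FullSubcategory

instance (S : Submonoid A[X]) : CofCat (EndS S) :=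
  endSubCofCat _ ⟨1, S.one_mem, fun _ => Subsingleton.elim (α := (zeroMod A).obj) _ _⟩

/-- The forgetful functor `End_A^S ⥤ P(A)`, `(P, f) ↦ P`. -/
abbrev EndS.forget (S : Submonoid A[X]) : EndS S ⥤ PMod A :=
  (isTorsion S).ι ⋙ EndCat.forget (PMod A)

lemma EndS.forget_exact (S : Submonoid A[X]) : IsExactFunctor (EndS.forget S) :=
  ⟨rfl, fun _ _ h => h⟩

/-! ### Extension of scalars on `P(A)` -/

/-- `P ⊗_A B` as an object of `P(B)`. -/
def bcObj (φ : A →+* B) (P : PMod A) : PMod B :=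
  ⟨ModuleCat.of Bᵐᵒᵖ (BC (RingHom.op φ) P.obj),
    have := P.property.1; bc_finite (RingHom.op φ) P.obj,
    have := P.property.2; bc_projective (RingHom.op φ) P.obj⟩

/-- `g ⊗ B : P ⊗_A B ⟶ Q ⊗_A B`. -/
def bcHom (φ : A →+* B) {P Q : PMod A} (g : P ⟶ Q) : bcObj φ P ⟶ bcObj φ Q :=
  ofLin (P := bcObj φ P) (Q := bcObj φ Q) (bcMap (RingHom.op φ) (lin g))

/-- The functor `P ↦ P ⊗_A B`. -/
def bcFunctor (φ : A →+* B) : PMod A ⥤ PMod B where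
  obj P := bcObj φ P
  map g := bcHom φ g
  map_id _ := lin_ext (bcMap_id _)
  map_comp _ _ := lin_ext (bcMap_comp _ _ _)

open Classical in
/-- `P ⊗_A B`, where the model of `0 ⊗_A B` is taken to be the chosen zero module. -/
def extObj (φ : A →+* B) (P : PMod A) : PMod B :=
  if P = zeroMod A then zeroMod B else bcObj φ P

instance (φ : A →+* B) : Subsingleton (bcObj φ (zeroMod A)).obj := by
  refine subsingleton_of_forall_eq 0 fun x => ?_
  refine bc_induction (RingHom.op φ) (M := (zeroMod A).obj) (p := fun x => x = 0) x rfl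
    (fun s m => ?_) (fun x y hx hy => ?_)
  · rw [Subsingleton.elim m 0]; exact bcMk_zero_right _ s
  · rw [hx, hy, add_zero]

open Classical in
/-- The canonical isomorphism between the two models of `P ⊗_A B`. -/
def extIso (φ : A →+* B) (P : PMod A) : bcObj φ P ≅ extObj φ P :=
  if h : P = zeroMod A then
    (Limits.IsZero.iso (by subst h; exact isZero_of_subsingleton _)
      (isZero_of_subsingleton (zeroMod B))).trans
      (eqToIso (by rw [extObj, if_pos h]))
  else eqToIso (by rw [extObj, if_neg h])

/-- Extension of scalars `- ⊗_A B : P(A) ⥤ P(B)`, normalized to preserve the chosen zero modules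
strictly. -/
def extend (φ : A →+* B) : PMod A ⥤ PMod B :=
  (bcFunctor φ).copyObj (extObj φ) (extIso φ)

/-- The natural isomorphism between the two models of extension of scalars. -/
def extendIso (φ : A →+* B) : bcFunctor φ ≅ extend φ := (bcFunctor φ).isoCopyObj _ _

lemma bcFunctor_map_add (φ : A →+* B) {P Q : PMod A} (f g : P ⟶ Q) :
    (bcFunctor φ).map (f + g) = (bcFunctor φ).map f + (bcFunctor φ).map g :=
  lin_ext (bcMap_add _ _ _)

instance (φ : A →+* B) : (bcFunctor φ).Additive where
  map_add := bcFunctor_map_add φ _ _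

/-- A sequence in `P(A)` is short exact iff it is split. -/
lemma isCofSeq_iff {X Y Z : PMod A} (f : X ⟶ Y) (g : Y ⟶ Z) :
    CofCat.IsCofSeq f g ↔ ∃ (r : Y ⟶ X) (s : Z ⟶ Y), f ≫ g = 0 ∧ f ≫ r = 𝟙 X ∧ s ≫ g = 𝟙 Z ∧
      r ≫ f + g ≫ s = 𝟙 Y := by
  constructor
  · rintro ⟨hi, hex, hs⟩
    have := Z.property.2
    obtain ⟨s, hs'⟩ := Module.projective_lifting_property (lin g) LinearMap.id hs
    have hgs : ∀ z, lin g (s z) = z := fun z => LinearMap.congr_fun hs' z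
    have hgf : ∀ x, lin g (lin f x) = 0 := fun x => (hex _).2 ⟨x, rfl⟩
    have hr : ∀ y, ∃ x, lin f x = y - s (lin g y) := fun y => (hex _).1 (by
      rw [map_sub, hgs, sub_self])
    choose r hr using hr
    let r' : Y.obj →ₗ[Aᵐᵒᵖ] X.obj :=
      { toFun := r
        map_add' := fun a b => hi (by rw [map_add, hr, hr, hr, map_add, map_add]; abel)
        map_smul' := fun c a => hi (by
          rw [map_smul, hr, hr, map_smul, map_smul, smul_sub]; rfl) }
    refine ⟨ofLin r', ofLin s, lin_ext ?_, lin_ext ?_, lin_ext ?_, lin_ext ?_⟩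
    · ext x; exact hgf x
    · ext x
      apply hi
      refine (hr _).trans ?_
      exact (congrArg (fun z => lin f x - s z) (hgf x)).trans (by rw [map_zero, sub_zero]; rfl)
    · ext z; exact hgs z
    · ext y
      change lin f (r y) + s (lin g y) = y
      rw [hr]; abel
  · rintro ⟨r, s, h1, h2, h3, h4⟩
    have e1 : ∀ x, lin g (lin f x) = 0 := fun x => LinearMap.congr_fun (congrArg lin h1) x
    have e2 : ∀ x, lin r (lin f x) = x := fun x => LinearMap.congr_fun (congrArg lin h2) x
    have e3 : ∀ x, lin g (lin s x) = x := fun x => LinearMap.congr_fun (congrArg lin h3) x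
    have e4 : ∀ x, lin f (lin r x) + lin s (lin g x) = x :=
      fun x => LinearMap.congr_fun (congrArg lin h4) x
    refine ⟨Function.LeftInverse.injective e2, fun y => ⟨fun hy => ⟨lin r y, ?_⟩, ?_⟩,
      Function.RightInverse.surjective e3⟩
    · conv_rhs => rw [← e4 y, hy, map_zero, add_zero]
    · rintro ⟨x, rfl⟩; exact e1 x

instance (φ : A →+* B) : (extend φ).Additive :=
  Functor.additive_of_iso (extendIso φ)

lemma extend_exact (φ : A →+* B) : IsExactFunctor (extend φ) where
  map_pt := by
    change extObj φ (zeroMod A) = zeroMod B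
    rw [extObj, if_pos rfl]
  map_cofSeq f g h := by
    obtain ⟨r, s, h1, h2, h3, h4⟩ := (isCofSeq_iff f g).1 h
    refine (isCofSeq_iff _ _).2 ⟨(extend φ).map r, (extend φ).map s, ?_, ?_, ?_, ?_⟩
    · rw [← Functor.map_comp, h1, Functor.map_zero]
    · rw [← Functor.map_comp, h2, CategoryTheory.Functor.map_id]
    · rw [← Functor.map_comp, h3, CategoryTheory.Functor.map_id]
    · rw [← Functor.map_comp, ← Functor.map_comp, ← Functor.map_add, h4, CategoryTheory.Functor.map_id]

/-- Multiplication by a central element of `B`, as an endomorphism of a right `B`-module. -/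
def scalEnd (b : B) (hb : b ∈ Set.center B) (P : PMod B) : Module.End Bᵐᵒᵖ P.obj where
  toFun x := op b • x
  map_add' x y := smul_add _ x y
  map_smul' c x := by
    obtain ⟨c, rfl⟩ := op_surjective c
    change op b • op c • x = op c • op b • x
    rw [smul_smul, smul_smul, ← op_mul, ← op_mul, (hb.comm c).eq]

/-- Multiplication by a central element of `B`, as a morphism of `P(B)`. -/
def scal (b : B) (hb : b ∈ Set.center B) (P : PMod B) : P ⟶ P := ofLin (scalEnd b hb P)

lemma scal_naturality (b : B) (hb : b ∈ Set.center B) {P Q : PMod B} (f : P ⟶ Q) :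
    scal b hb P ≫ f = f ≫ scal b hb Q :=
  lin_ext (by ext x; exact map_smul (lin f) (op b) x)

/-! ### The localizations `A[t]_S` and `A[t]_T` -/

/-- A submonoid of the center of a ring. -/
class IsCentralSubmonoid {R : Type*} [Ring R] (U : Submonoid R) : Prop where
  mem_center : ∀ s ∈ U, s ∈ Set.center R

/-- One can form left fractions with central denominators. -/
instance {R : Type*} [Ring R] (U : Submonoid R) [IsCentralSubmonoid U] :
    OreLocalization.OreSet U where
  ore_right_cancel r₁ r₂ s h := ⟨s, by
    rw [((IsCentralSubmonoid.mem_center s.1 s.2).comm r₁).eq,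
      ((IsCentralSubmonoid.mem_center s.1 s.2).comm r₂).eq, h]⟩
  oreNum r _ := r
  oreDenom _ s := s
  ore_eq r s := ((IsCentralSubmonoid.mem_center s.1 s.2).comm r).eq

/-- The ring of left fractions `U⁻¹R`. -/
abbrev Loc {R : Type u} [Ring R] (U : Submonoid R) [IsCentralSubmonoid U] : Type u :=
  OreLocalization U R

/-- The homomorphism `R → U⁻¹R`. -/
abbrev Loc.num {R : Type u} [Ring R] (U : Submonoid R) [IsCentralSubmonoid U] : R →+* Loc U :=
  OreLocalization.numeratorRingHom

lemma Loc.num_mem_center {R : Type u} [Ring R] (U : Submonoid R) [IsCentralSubmonoid U] {r : R}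
    (hr : r ∈ Set.center R) : Loc.num U r ∈ Set.center (Loc U) := by
  rw [Semigroup.mem_center_iff]
  intro x
  induction x using OreLocalization.ind with | _ r' s
  change (r' /ₒ s) * (r /ₒ (1 : U)) = (r /ₒ (1 : U)) * (r' /ₒ s)
  rw [OreLocalization.mul_div_one,
    OreLocalization.oreDiv_mul_char r r' 1 s r s (((hr.comm (s : R)).eq).symm), mul_one,
    (hr.comm r').eq]

lemma coeff_mem_center {p : A[X]} (hp : p ∈ Set.center A[X]) (i : ℕ) :
    p.coeff i ∈ Set.center A := by
  rw [Semigroup.mem_center_iff]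
  intro a
  rw [← coeff_C_mul, ← coeff_mul_C, (hp.comm (C a)).eq]

lemma mem_center_of_coeff {p : A[X]} (hp : ∀ i, p.coeff i ∈ Set.center A) :
    p ∈ Set.center A[X] := by
  rw [Semigroup.mem_center_iff]
  intro q
  ext k
  rw [coeff_mul, coeff_mul, ← Finset.Nat.sum_antidiagonal_swap]
  exact Finset.sum_congr rfl fun x _ => ((hp _).comm _).eq.symm

/-- `S ⊂ A[t]` is a multiplicative subset of monic centric polynomials that contains `t`. -/
class MonicCentric (S : Submonoid A[X]) : Prop where
  monic : ∀ p ∈ S, p.Monic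
  centric : ∀ p ∈ S, p ∈ Set.center A[X]
  X_mem : X ∈ S

instance (S : Submonoid A[X]) [h : MonicCentric S] : IsCentralSubmonoid S := ⟨h.centric⟩

/-- `T = {p̃ | p ∈ S}`, where `p̃(t) = tⁿ p(1/t)` for `p` of degree `n`. -/
def revSub (S : Submonoid A[X]) [h : MonicCentric S] : Submonoid A[X] where
  carrier := {q | ∃ p ∈ S, q = p.reverse}
  one_mem' := ⟨1, S.one_mem, by rw [← C_1, reverse_C]⟩
  mul_mem' := by
    rintro _ _ ⟨p, hp, rfl⟩ ⟨q, hq, rfl⟩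
    refine ⟨p * q, S.mul_mem hp hq, ?_⟩
    nontriviality A
    refine (reverse_mul ?_).symm
    rw [(h.monic p hp).leadingCoeff, (h.monic q hq).leadingCoeff, one_mul]
    exact one_ne_zero

instance (S : Submonoid A[X]) [h : MonicCentric S] : IsCentralSubmonoid (revSub S) where
  mem_center := by
    rintro _ ⟨p, hp, rfl⟩
    refine mem_center_of_coeff fun i => ?_
    rw [coeff_reverse]
    exact coeff_mem_center (h.centric p hp) _

lemma X_mem_center : (X : A[X]) ∈ Set.center A[X] :=
  Semigroup.mem_center_iff.2 fun p => (commute_X p).eq.symm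

lemma C_mem_center {a : A} (ha : a ∈ Set.center A) : (C a : A[X]) ∈ Set.center A[X] :=
  mem_center_of_coeff fun i => by
    rw [coeff_C]
    split
    · exact ha
    · exact Set.zero_mem_center

lemma reverse_eq_sum (p : A[X]) : p.reverse = ∑ i ∈ Finset.range (p.natDegree + 1),
    C (p.coeff i) * X ^ (p.natDegree - i) := by
  conv_lhs => rw [p.reverse.as_sum_range' (p.natDegree + 1)
    (Nat.lt_succ_of_le p.reverse_natDegree_le)]
  rw [← Finset.sum_range_reflect]
  refine Finset.sum_congr rfl fun i hi => ?_
  have hi' : i ≤ p.natDegree := Nat.lt_succ_iff.1 (Finset.mem_range.1 hi)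
  rw [coeff_reverse, show p.natDegree + 1 - 1 - i = p.natDegree - i by omega,
    revAt_le (by omega), show p.natDegree - (p.natDegree - i) = i by omega,
    C_mul_X_pow_eq_monomial]

section LocPoly

variable (U : Submonoid A[X]) [IsCentralSubmonoid U]

/-- The homomorphism `A → U⁻¹A[t]`. -/
abbrev Loc.const : A →+* Loc U := (Loc.num U).comp C

/-- The element `t` of `U⁻¹A[t]`. -/
abbrev Loc.t : Loc U := Loc.num U X

lemma Loc.t_mem_center : Loc.t U ∈ Set.center (Loc U) := Loc.num_mem_center U X_mem_center

lemma Loc.const_mem_center {a : A} (ha : a ∈ Set.center A) :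
    Loc.const U a ∈ Set.center (Loc U) := Loc.num_mem_center U (C_mem_center ha)

lemma Loc.num_eq (p : A[X]) : Loc.num U p =
    ∑ i ∈ Finset.range (p.natDegree + 1), Loc.const U (p.coeff i) * Loc.t U ^ i := by
  conv_lhs => rw [p.as_sum_range_C_mul_X_pow, map_sum]
  simp only [map_mul, map_pow, RingHom.comp_apply]

lemma Loc.num_reverse_eq (p : A[X]) : Loc.num U p.reverse =
    ∑ i ∈ Finset.range (p.natDegree + 1),
      Loc.const U (p.coeff i) * Loc.t U ^ (p.natDegree - i) := by
  rw [reverse_eq_sum, map_sum]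
  simp only [map_mul, map_pow, RingHom.comp_apply]

end LocPoly

section Substitution

variable (S : Submonoid A[X]) [h : MonicCentric S]

/-- The element `1/t` of `A[t]_S`. -/
def tInv : Loc S := (1 : A[X]) /ₒ (⟨X, h.X_mem⟩ : S)

lemma t_mul_tInv : Loc.t S * tInv S = 1 :=
  OreLocalization.mul_inv (⟨X, h.X_mem⟩ : S) 1

lemma tInv_mul_t : tInv S * Loc.t S = 1 :=
  OreLocalization.mul_inv 1 (⟨X, h.X_mem⟩ : S)

/-- The homomorphism `A[t⁻¹] → A[t]_S`, `t⁻¹ ↦ 1/t`, on the polynomial ring `A[t⁻¹]`, whose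
variable is denoted `X`. -/
def substInv : A[X] →+* Loc S :=
  eval₂RingHom' (Loc.const S) (tInv S) fun a => by
    have h1 : Commute (Loc.const S a) (Loc.t S) := ((Loc.t_mem_center S).comm _).symm
    change _ * _ = _ * _
    calc Loc.const S a * tInv S = (tInv S * Loc.t S) * (Loc.const S a * tInv S) := by
          rw [tInv_mul_t, one_mul]
      _ = tInv S * (Loc.const S a * Loc.t S) * tInv S := by rw [h1.eq]; simp only [mul_assoc]
      _ = tInv S * Loc.const S a := by rw [mul_assoc, mul_assoc, t_mul_tInv, mul_one]

lemma substInv_reverse (p : A[X]) :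
    Loc.t S ^ p.natDegree * substInv S p.reverse = Loc.num S p := by
  have hinv : Commute (tInv S) (Loc.t S) := by
    change _ * _ = _ * _; rw [tInv_mul_t, t_mul_tInv]
  have hpow : ∀ i ≤ p.natDegree, Loc.t S ^ p.natDegree * tInv S ^ (p.natDegree - i) =
      Loc.t S ^ i := fun i hi => by
    conv_lhs => rw [show p.natDegree = i + (p.natDegree - i) by omega, pow_add,
      show i + (p.natDegree - i) - i = p.natDegree - i by omega, mul_assoc,
      ← hinv.symm.mul_pow, t_mul_tInv, one_pow, mul_one]
  have hC : ∀ a, substInv S (C a) = Loc.const S a := fun a => eval₂_C _ _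
  have hX : substInv S X = tInv S := eval₂_X _ _
  rw [reverse_eq_sum, map_sum, Loc.num_eq, Finset.mul_sum]
  refine Finset.sum_congr rfl fun i hi => ?_
  have hi' : i ≤ p.natDegree := Nat.lt_succ_iff.1 (Finset.mem_range.1 hi)
  have hc : Commute (Loc.t S ^ p.natDegree) (Loc.const S (p.coeff i)) :=
    ((Loc.t_mem_center S).comm _).pow_left _
  rw [map_mul, map_pow, hC, hX, ← mul_assoc, hc.eq, mul_assoc, hpow i hi']

lemma isUnit_substInv (q : revSub S) : IsUnit (substInv S q) := by
  obtain ⟨q, p, hp, rfl⟩ := q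
  have h1 : IsUnit (Loc.t S ^ p.natDegree) :=
    (OreLocalization.numerator_isUnit (⟨X, h.X_mem⟩ : S)).pow _
  have h2 : IsUnit (Loc.num S p) := OreLocalization.numerator_isUnit (⟨p, hp⟩ : S)
  rw [← substInv_reverse] at h2
  obtain ⟨v, hv⟩ := h1
  rw [← hv] at h2
  exact (Units.isUnit_units_mul v _).1 h2

/-- The canonical homomorphism `A[t⁻¹]_T → A[t]_S`, `t⁻¹ ↦ 1/t`.  The ring `A[t⁻¹]_T` is `A[t]_T`
with the variable renamed, so that this is also the homomorphism `A[t]_T ≅ A[t⁻¹]_T → A[t]_S`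
given by `t ↦ 1/t`. -/
def locMap : Loc (revSub S) →+* Loc S :=
  OreLocalization.universalHom (substInv S)
    (IsUnit.liftRight ((substInv S).toMonoidHom.comp (revSub S).subtype) (isUnit_substInv S))
    (fun _ => rfl)

end Substitution

/-! ### The automorphisms `t - f` and `(1 - f t)⁻¹` -/

section Automorphisms

variable (ι : A →+* B)

/-- `t - f` on `P ⊗_A B`, for a central element `t` of `B`. -/
def tauEnd {t : B} (ht : t ∈ Set.center B) {P : PMod A} (f : P ⟶ P) :
    (extend ι).obj P ⟶ (extend ι).obj P :=
  scal t ht _ - (extend ι).map f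

/-- `1 - f t` on `P ⊗_A B`, for a central element `t` of `B`. -/
def zetaEnd {t : B} (ht : t ∈ Set.center B) {P : PMod A} (f : P ⟶ P) :
    (extend ι).obj P ⟶ (extend ι).obj P :=
  𝟙 _ - (extend ι).map f ≫ scal t ht _

lemma isIso_of_isUnit {P : PMod B} (f : P ⟶ P) (h : IsUnit (lin f : Module.End Bᵐᵒᵖ P.obj)) :
    IsIso f := by
  obtain ⟨v, hv⟩ := h
  have h1 : lin f ∘ₗ (↑v⁻¹ : Module.End Bᵐᵒᵖ P.obj) = LinearMap.id := by
    rw [← hv]; exact v.mul_inv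
  have h2 : (↑v⁻¹ : Module.End Bᵐᵒᵖ P.obj) ∘ₗ lin f = LinearMap.id := by
    rw [← hv]; exact v.inv_mul
  exact ⟨ofLin (↑v⁻¹ : Module.End Bᵐᵒᵖ P.obj), lin_ext h2, lin_ext h1⟩

lemma scalEnd_pow_apply {b : B} (hb : b ∈ Set.center B) {P : PMod B} (n : ℕ) (x : P.obj) :
    (scalEnd b hb P ^ n) x = op (b ^ n) • x := by
  induction n generalizing x with
  | zero => simp
  | succ n ih =>
    rw [pow_succ', Module.End.mul_apply, ih]
    change op b • op (b ^ n) • x = _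
    rw [smul_smul, ← op_mul, pow_succ]

lemma scalEnd_comm {b : B} (hb : b ∈ Set.center B) {P : PMod B} (g : Module.End Bᵐᵒᵖ P.obj) :
    Commute (scalEnd b hb P) g :=
  LinearMap.ext fun x => (map_smul g (op b) x).symm

lemma isUnit_of_smul {P : PMod B} {u : B} (hu : IsUnit u) (f : Module.End Bᵐᵒᵖ P.obj)
    (hf : ∀ x, f x = op u • x) : IsUnit f := by
  rw [Module.End.isUnit_iff]
  obtain ⟨v, rfl⟩ := hu
  have h1 : ∀ x : P.obj, op (↑v : B) • op (↑v⁻¹ : B) • x = x := fun x => by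
    rw [smul_smul, ← op_mul, v.inv_mul, op_one, one_smul]
  have h2 : ∀ x : P.obj, op (↑v⁻¹ : B) • op (↑v : B) • x = x := fun x => by
    rw [smul_smul, ← op_mul, v.mul_inv, op_one, one_smul]
  constructor
  · intro x y hxy
    rw [hf, hf] at hxy
    rw [← h2 x, hxy, h2]
  · intro x
    exact ⟨op (↑v⁻¹ : B) • x, by rw [hf, h1]⟩

/-- `f ⊗ B` as an endomorphism. -/
def bcEnd {P : PMod A} (f : P ⟶ P) : Module.End Bᵐᵒᵖ (bcObj ι P).obj := lin (bcHom ι f)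

/-- The element `m ⊗ b` of `P ⊗_A B`. -/
def bcElem {P : PMod A} (s : Bᵐᵒᵖ) (m : P.obj) : (bcObj ι P).obj := bcMk (RingHom.op ι) s m

lemma bcEnd_elem {P : PMod A} (f : P ⟶ P) (s : Bᵐᵒᵖ) (m : P.obj) :
    bcEnd ι f (bcElem ι s m) = bcElem ι s (lin f m) := bcMap_mk _ _ _ _

lemma bcEnd_pow_elem {P : PMod A} (f : P ⟶ P) (n : ℕ) (s : Bᵐᵒᵖ) (m : P.obj) :
    (bcEnd ι f ^ n) (bcElem ι s m) =
      bcElem ι s (((lin f : Module.End Aᵐᵒᵖ P.obj) ^ n) m) := by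
  induction n with
  | zero => rfl
  | succ n ih =>
    rw [pow_succ', Module.End.mul_apply, ih, pow_succ', bcEnd_elem]
    rfl

lemma smul_bcElem {P : PMod A} (a : A) (m : P.obj) :
    op (ι a) • bcElem ι (1 : Bᵐᵒᵖ) m = bcElem ι (1 : Bᵐᵒᵖ) (op a • m) := by
  refine Eq.trans ?_ (bcMk_rel (RingHom.op ι) 1 (op a) m)
  refine (smul_bcMk _ _ _ _).trans ?_
  rw [mul_one, one_mul]
  rfl

lemma bcObj_end_ext {P : PMod A} {f g : Module.End Bᵐᵒᵖ (bcObj ι P).obj}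
    (h : ∀ m, f (bcElem ι 1 m) = g (bcElem ι 1 m)) : f = g :=
  bc_ext (RingHom.op ι) (M := P.obj) (V := BC (RingHom.op ι) P.obj) (f := f) (g := g) h

lemma sum_bcEnd_eq_zero {P : PMod A} (f : P ⟶ P) (p : A[X])
    (hι : ∀ i, ι (p.coeff i) ∈ Set.center B) (hp : ∀ x, polyAct p f x = 0) :
    ∑ i ∈ Finset.range (p.natDegree + 1), scalEnd _ (hι i) (bcObj ι P) * bcEnd ι f ^ i = 0 := by
  refine bcObj_end_ext ι fun m => ?_
  have h := congrArg (bcElem ι (1 : Bᵐᵒᵖ)) (hp m)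
  rw [polyAct, Polynomial.sum_over_range _ (by intro n; simp)] at h
  have h' := ((bcMk_sum_right (RingHom.op ι) 1 _ _).symm.trans h).trans (bcMk_zero_right _ _)
  refine (LinearMap.sum_apply _ _ _).trans (Eq.trans (Finset.sum_congr rfl fun i _ => ?_) h')
  exact (congrArg (op (ι (p.coeff i)) • ·) (bcEnd_pow_elem ι f i 1 m)).trans (smul_bcElem ι _ _)

lemma tau_isUnit {t : B} (ht : t ∈ Set.center B) {P : PMod A} (f : P ⟶ P) (p : A[X])
    (hι : ∀ i, ι (p.coeff i) ∈ Set.center B) (hp : ∀ x, polyAct p f x = 0)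
    (hu : IsUnit (∑ i ∈ Finset.range (p.natDegree + 1), ι (p.coeff i) * t ^ i)) :
    IsUnit (scalEnd t ht (bcObj ι P) - bcEnd ι f) := by
  refine isUnit_sub_of_sum (scalEnd_comm ht _) (fun i => scalEnd _ (hι i) (bcObj ι P))
    (fun i => scalEnd_comm _ _) _ (sum_bcEnd_eq_zero ι f p hι hp) (isUnit_of_smul hu _ fun x => ?_)
  rw [LinearMap.sum_apply, Finset.op_sum, Finset.sum_smul]
  refine Finset.sum_congr rfl fun i _ => ?_
  rw [Module.End.mul_apply, scalEnd_pow_apply]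
  change op (ι (p.coeff i)) • op (t ^ i) • x = _
  rw [smul_smul, ← op_mul, ((hι i).comm (t ^ i)).eq]

lemma zeta_isUnit {t : B} (ht : t ∈ Set.center B) {P : PMod A} (f : P ⟶ P) (p : A[X])
    (hι : ∀ i, ι (p.coeff i) ∈ Set.center B) (hp : ∀ x, polyAct p f x = 0)
    (hu : IsUnit (∑ i ∈ Finset.range (p.natDegree + 1),
      ι (p.coeff i) * t ^ (p.natDegree - i))) :
    IsUnit (1 - scalEnd t ht (bcObj ι P) * bcEnd ι f) := by
  refine isUnit_sub_of_sum (Commute.one_left _)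
    (fun i => scalEnd _ (hι i) (bcObj ι P) * scalEnd t ht (bcObj ι P) ^ (p.natDegree - i))
    (fun i => (scalEnd_comm _ _).mul_left ((scalEnd_comm _ _).pow_left _))
    (Finset.range (p.natDegree + 1)) ?_ (isUnit_of_smul hu _ fun x => ?_)
  · have h := congrArg (scalEnd t ht (bcObj ι P) ^ p.natDegree * ·) (sum_bcEnd_eq_zero ι f p hι hp)
    rw [mul_zero, Finset.mul_sum] at h
    refine Eq.trans (Finset.sum_congr rfl fun i hi => ?_) h
    have hi' : i ≤ p.natDegree := Nat.lt_succ_iff.1 (Finset.mem_range.1 hi)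
    rw [(scalEnd_comm ht (bcEnd ι f)).mul_pow, mul_assoc,
      ← mul_assoc (scalEnd t ht (bcObj ι P) ^ (p.natDegree - i)), ← pow_add,
      Nat.sub_add_cancel hi', ← mul_assoc, ← mul_assoc,
      ((scalEnd_comm (hι i) _).pow_right _).eq]
  · rw [LinearMap.sum_apply, Finset.op_sum, Finset.sum_smul]
    refine Finset.sum_congr rfl fun i _ => ?_
    rw [one_pow, mul_one, Module.End.mul_apply, scalEnd_pow_apply]
    change op (ι (p.coeff i)) • op (t ^ (p.natDegree - i)) • x = _
    rw [smul_smul, ← op_mul, ((hι i).comm (t ^ (p.natDegree - i))).eq]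

lemma isIso_conj {C : Type*} [Category C] {X Y : C} (e : X ≅ Y) (f : X ⟶ X) (g : Y ⟶ Y)
    (h : g = e.inv ≫ f ≫ e.hom) [IsIso f] : IsIso g := by
  rw [h]; infer_instance

/-- The comparison `P ⊗_A B ≅ (extend φ).obj P`. -/
def cmpIso (φ : A →+* B) (P : PMod A) : bcObj φ P ≅ (extend φ).obj P := extIso φ P

lemma extend_map (φ : A →+* B) {P Q : PMod A} (f : P ⟶ Q) :
    (extend φ).map f = (cmpIso φ P).inv ≫ bcHom φ f ≫ (cmpIso φ Q).hom := rfl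

lemma scal_conj {P Q : PMod B} (e : P ≅ Q) {b : B} (hb : b ∈ Set.center B) :
    scal b hb Q = e.inv ≫ scal b hb P ≫ e.hom := by
  rw [scal_naturality, e.inv_hom_id_assoc]

lemma isIso_tauEnd {t : B} (ht : t ∈ Set.center B) {P : PMod A} (f : P ⟶ P) (p : A[X])
    (hι : ∀ i, ι (p.coeff i) ∈ Set.center B) (hp : ∀ x, polyAct p f x = 0)
    (hu : IsUnit (∑ i ∈ Finset.range (p.natDegree + 1), ι (p.coeff i) * t ^ i)) :
    IsIso (tauEnd ι ht f) := by
  have h : IsIso (scal t ht (bcObj ι P) - bcHom ι f) :=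
    isIso_of_isUnit _ (tau_isUnit ι ht f p hι hp hu)
  refine isIso_conj (cmpIso ι P) (scal t ht (bcObj ι P) - bcHom ι f) _ ?_
  rw [Preadditive.sub_comp, Preadditive.comp_sub, tauEnd, extend_map]
  exact congrArg (· - _) (scal_conj (cmpIso ι P) ht)

lemma isIso_zetaEnd {t : B} (ht : t ∈ Set.center B) {P : PMod A} (f : P ⟶ P) (p : A[X])
    (hι : ∀ i, ι (p.coeff i) ∈ Set.center B) (hp : ∀ x, polyAct p f x = 0)
    (hu : IsUnit (∑ i ∈ Finset.range (p.natDegree + 1),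
      ι (p.coeff i) * t ^ (p.natDegree - i))) :
    IsIso (zetaEnd ι ht f) := by
  have h : IsIso (𝟙 (bcObj ι P) - bcHom ι f ≫ scal t ht (bcObj ι P)) :=
    isIso_of_isUnit _ (zeta_isUnit ι ht f p hι hp hu)
  refine isIso_conj (cmpIso ι P) (𝟙 _ - bcHom ι f ≫ scal t ht (bcObj ι P)) _ ?_
  rw [Preadditive.sub_comp, Preadditive.comp_sub, zetaEnd, extend_map, Category.id_comp,
    Iso.inv_hom_id, Category.assoc, Category.assoc, Category.assoc, scal_naturality]

lemma tauEnd_naturality {t : B} (ht : t ∈ Set.center B) {P Q : PMod A} {f : P ⟶ P} {f' : Q ⟶ Q}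
    (g : P ⟶ Q) (h : f ≫ g = g ≫ f') :
    tauEnd ι ht f ≫ (extend ι).map g = (extend ι).map g ≫ tauEnd ι ht f' := by
  rw [tauEnd, tauEnd, Preadditive.sub_comp, Preadditive.comp_sub, scal_naturality,
    ← Functor.map_comp, ← Functor.map_comp, h]

lemma zetaEnd_naturality {t : B} (ht : t ∈ Set.center B) {P Q : PMod A} {f : P ⟶ P}
    {f' : Q ⟶ Q} (g : P ⟶ Q) (h : f ≫ g = g ≫ f') :
    zetaEnd ι ht f ≫ (extend ι).map g = (extend ι).map g ≫ zetaEnd ι ht f' := by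
  rw [zetaEnd, zetaEnd, Preadditive.sub_comp, Preadditive.comp_sub, Category.assoc,
    scal_naturality, ← Category.assoc, ← Category.assoc, ← Functor.map_comp, ← Functor.map_comp, h,
    Category.id_comp, Category.comp_id]

end Automorphisms

section TauZeta

variable (S : Submonoid A[X]) [h : MonicCentric S]

/-- The exact functor `End_A^S ⥤ Aut_{A[t]_S}`, `(P, f) ↦ (P[t]_S, t - f)`. -/
def tauFunctor : EndS S ⥤ AutCat (PMod (Loc S)) where
  obj X := ⟨⟨(extend (Loc.const S)).obj X.obj.obj,
      tauEnd (Loc.const S) (Loc.t_mem_center S) X.obj.φ⟩, by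
    obtain ⟨p, hp, hpf⟩ := X.property
    refine isIso_tauEnd _ _ _ p
      (fun i => Loc.const_mem_center S (coeff_mem_center (h.centric p hp) i)) hpf ?_
    rw [← Loc.num_eq]
    exact OreLocalization.numerator_isUnit (⟨p, hp⟩ : S)⟩
  map g := ObjectProperty.homMk ⟨(extend (Loc.const S)).map g.hom.hom,
    tauEnd_naturality _ _ _ g.hom.comm⟩
  map_id X := ObjectProperty.hom_ext _ (EndCat.hom_ext ((extend (Loc.const S)).map_id _))
  map_comp f g := ObjectProperty.hom_ext _
    (EndCat.hom_ext ((extend (Loc.const S)).map_comp f.hom.hom g.hom.hom))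

lemma isIso_zetaEnd_loc (X : EndS S) :
    IsIso (zetaEnd (Loc.const (revSub S)) (Loc.t_mem_center (revSub S)) X.obj.φ) := by
  obtain ⟨p, hp, hpf⟩ := X.property
  refine isIso_zetaEnd _ _ _ p
    (fun i => Loc.const_mem_center _ (coeff_mem_center (h.centric p hp) i)) hpf ?_
  rw [← Loc.num_reverse_eq]
  exact OreLocalization.numerator_isUnit (⟨p.reverse, p, hp, rfl⟩ : revSub S)

/-- The exact functor `End_A^S ⥤ Aut_{A[t]_T}`, `(P, f) ↦ (P[t]_T, (1 - f t)⁻¹)`. -/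
def zetaFunctor : EndS S ⥤ AutCat (PMod (Loc (revSub S))) where
  obj X := ⟨⟨(extend (Loc.const (revSub S))).obj X.obj.obj,
      have := isIso_zetaEnd_loc S X
      inv (zetaEnd (Loc.const (revSub S)) (Loc.t_mem_center (revSub S)) X.obj.φ)⟩, by
    have := isIso_zetaEnd_loc S X
    exact inferInstanceAs (IsIso (inv (zetaEnd _ _ _)))⟩
  map {X Y} g := ObjectProperty.homMk ⟨(extend (Loc.const (revSub S))).map g.hom.hom, by
    have := isIso_zetaEnd_loc S X
    have := isIso_zetaEnd_loc S Y
    exact (IsIso.inv_comp_eq _).2 (by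
      rw [← Category.assoc, IsIso.eq_comp_inv]
      exact (zetaEnd_naturality _ _ _ g.hom.comm).symm)⟩
  map_id X := ObjectProperty.hom_ext _
    (EndCat.hom_ext ((extend (Loc.const (revSub S))).map_id _))
  map_comp f g := ObjectProperty.hom_ext _
    (EndCat.hom_ext ((extend (Loc.const (revSub S))).map_comp f.hom.hom g.hom.hom))

lemma autCat_ext {C : Type*} [Category C] {X Y : AutCat C} (h : X.obj.obj = Y.obj.obj)
    (hZ : Limits.IsZero Y.obj.obj) : X = Y :=
  ObjectProperty.FullSubcategory.ext (EndCat.obj_ext h hZ)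

lemma tauFunctor_exact : IsExactFunctor (tauFunctor S) where
  map_pt := autCat_ext (extend_exact (Loc.const S)).map_pt CofCat.isZero_pt
  map_cofSeq f g h := (extend_exact (Loc.const S)).map_cofSeq f.hom.hom g.hom.hom h

lemma zetaFunctor_exact : IsExactFunctor (zetaFunctor S) where
  map_pt := autCat_ext (extend_exact (Loc.const (revSub S))).map_pt CofCat.isZero_pt
  map_cofSeq f g h := (extend_exact (Loc.const (revSub S))).map_cofSeq f.hom.hom g.hom.hom h

lemma tauFunctor_forget :
    tauFunctor S ⋙ AutCat.forget _ = EndS.forget S ⋙ extend (Loc.const S) := rfl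

lemma zetaFunctor_forget :
    zetaFunctor S ⋙ AutCat.forget _ = EndS.forget S ⋙ extend (Loc.const (revSub S)) := rfl

end TauZeta

/-! ### The prism decomposition: maps out of `Δⁿ × Δ¹` -/

section Prism

/-- The topological standard simplex `Δⁿ`. -/
abbrev TopΔ (n : ℕ) : Type := stdSimplex ℝ (Fin (n + 1))

/-- The tail sums of barycentric coordinates. -/
def tail {n : ℕ} (w : TopΔ n) (j : ℕ) : ℝ := ∑ i : Fin (n + 1), if j ≤ i.val then w i else 0

lemma tail_zero {n : ℕ} (w : TopΔ n) : tail w 0 = 1 := by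
  simp [tail]

lemma tail_of_lt {n : ℕ} (w : TopΔ n) {j : ℕ} (h : n < j) : tail w j = 0 := by
  refine Finset.sum_eq_zero fun i _ => if_neg ?_
  have := i.isLt
  omega

lemma tail_succ {n : ℕ} (w : TopΔ n) (i : Fin (n + 1)) :
    tail w i.val = w i + tail w (i.val + 1) := by
  have h : w i = ∑ k : Fin (n + 1), if k = i then w k else 0 := by simp
  rw [h, tail, tail, ← Finset.sum_add_distrib]
  refine Finset.sum_congr rfl fun k _ => ?_
  by_cases hk : k = i
  · subst hk; simp
  · have : k.val ≠ i.val := fun h => hk (Fin.ext h)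
    rw [if_neg hk, zero_add]
    refine if_congr ?_ rfl rfl
    omega

lemma tail_anti {n : ℕ} (w : TopΔ n) {j k : ℕ} (h : j ≤ k) : tail w k ≤ tail w j := by
  refine Finset.sum_le_sum fun i _ => ?_
  have := stdSimplex.zero_le w i
  split_ifs <;> first | omega | linarith

lemma tail_ext {n : ℕ} {w w' : TopΔ n} (h : ∀ j, tail w j = tail w' j) : w = w' := by
  ext i
  have h1 := tail_succ w i
  have h2 := tail_succ w' i
  rw [h, h] at h1
  linarith

lemma sum_map {m n : ℕ} (f : Fin (m + 1) → Fin (n + 1)) (w : TopΔ m) (p : Fin (n + 1) → Prop)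
    [DecidablePred p] :
    (∑ i, if p i then stdSimplex.map f w i else 0) = ∑ i, if p (f i) then w i else 0 := by
  classical
  have h : ∀ i, stdSimplex.map f w i = ∑ k, if f k = i then w k else 0 := fun i => by
    rw [stdSimplex.map_coe, FunOnFinite.linearMap_apply_apply, Finset.sum_filter]
  simp only [h]
  have : ∀ i, (if p i then ∑ k, (if f k = i then w k else 0) else 0) =
      ∑ k, if p i ∧ f k = i then w k else 0 := fun i => by
    by_cases hp : p i <;> simp [hp]
  simp only [this]
  rw [Finset.sum_comm]
  refine Finset.sum_congr rfl fun k _ => ?_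
  rw [Finset.sum_eq_single (f k)]
  · simp
  · intro b _ hb
    rw [if_neg (fun h => hb h.2.symm)]
  · simp

lemma tail_map {m n : ℕ} (f : Fin (m + 1) → Fin (n + 1)) (w : TopΔ m) (j j' : ℕ)
    (h : ∀ i, j ≤ (f i).val ↔ j' ≤ i.val) : tail (stdSimplex.map f w) j = tail w j' := by
  rw [tail, tail, sum_map f w (fun i => j ≤ i.val)]
  exact Finset.sum_congr rfl fun i _ => if_congr (h i) rfl rfl

/-- The degeneracy `[n + 1] → [n]` that hits `k` twice. -/
def sigmaHom {n : ℕ} (k : ℕ) (hk : k ≤ n) : Fin (n + 1 + 1) →o Fin (n + 1) where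
  toFun i := ⟨if i.val ≤ k then i.val else i.val - 1, by have := i.isLt; split_ifs <;> omega⟩
  monotone' i j h := by
    have : i.val ≤ j.val := h
    simp only [Fin.mk_le_mk]
    split_ifs <;> omega

/-- The map `[n + 1] → [1]` with value `0` exactly on `{0, …, k}`. -/
def rhoHom (n k : ℕ) : Fin (n + 1 + 1) →o Fin (1 + 1) where
  toFun i := if i.val ≤ k then 0 else 1
  monotone' i j h := by
    have : i.val ≤ j.val := h
    dsimp only
    split_ifs
    · exact le_rfl
    · exact Fin.zero_le _
    · omega
    · exact le_rfl

lemma tail_sigma_le {n k : ℕ} (hk : k ≤ n) (w : TopΔ (n + 1)) {j : ℕ} (hj : j ≤ k) :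
    tail (stdSimplex.map (sigmaHom k hk) w) j = tail w j :=
  tail_map _ _ _ _ fun i => by
    change j ≤ (if i.val ≤ k then i.val else i.val - 1) ↔ _
    split_ifs <;> omega

lemma tail_sigma_lt {n k : ℕ} (hk : k ≤ n) (w : TopΔ (n + 1)) {j : ℕ} (hj : k < j) :
    tail (stdSimplex.map (sigmaHom k hk) w) j = tail w (j + 1) :=
  tail_map _ _ _ _ fun i => by
    change j ≤ (if i.val ≤ k then i.val else i.val - 1) ↔ _
    split_ifs <;> omega

lemma tail_rho {n k : ℕ} (w : TopΔ (n + 1)) :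
    tail (stdSimplex.map (rhoHom n k) w) 1 = tail w (k + 1) :=
  tail_map _ _ _ _ fun i => by
    change 1 ≤ (if i.val ≤ k then (0 : Fin 2) else 1).val ↔ _
    split_ifs <;> simp <;> omega

lemma tail_one_ext {s s' : TopΔ 1} (h : tail s 1 = tail s' 1) : s = s' :=
  tail_ext fun j => by
    match j with
    | 0 => rw [tail_zero, tail_zero]
    | 1 => exact h
    | j + 2 => rw [tail_of_lt _ (by omega), tail_of_lt _ (by omega)]

/-- A point of a simplex from its tail sums. -/
lemma exists_of_tail {n : ℕ} (W : ℕ → ℝ) (hW : ∀ j, W (j + 1) ≤ W j) (h0 : W 0 = 1)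
    (hn : W (n + 1) = 0) : ∃ w : TopΔ n, ∀ j ≤ n + 1, tail w j = W j := by
  let w : TopΔ n := ⟨fun i => W i.val - W (i.val + 1), fun i => sub_nonneg.2 (hW _), by
    rw [Fin.sum_univ_eq_sum_range (fun i => W i - W (i + 1)), Finset.sum_range_sub', h0, hn,
      sub_zero]⟩
  refine ⟨w, fun j hj => ?_⟩
  induction hj using Nat.decreasingInduction with
  | self => rw [tail_of_lt _ (by omega), hn]
  | of_succ k hk ih =>
    have h := tail_succ w ⟨k, hk⟩
    rw [show ((⟨k, hk⟩ : Fin (n + 1)).val) = k from rfl] at h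
    rw [h, ih]
    change W k - W (k + 1) + W (k + 1) = W k
    ring

lemma prism_surj {n : ℕ} (u : TopΔ n) (s : TopΔ 1) : ∃ (k : ℕ) (hk : k ≤ n) (w : TopΔ (n + 1)),
    stdSimplex.map (sigmaHom k hk) w = u ∧ stdSimplex.map (rhoHom n k) w = s := by
  classical
  have hs0 : tail s 1 ≤ 1 := by rw [← tail_zero s]; exact tail_anti s (by omega)
  have hs1 : 0 ≤ tail s 1 := by
    rw [← tail_of_lt s (show 1 < 2 by omega)]; exact tail_anti s (by omega)
  have hex : ∃ k, tail u (k + 1) ≤ tail s 1 := ⟨n, by rw [tail_of_lt u (by omega)]; exact hs1⟩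
  let k := Nat.find hex
  have hk1 : tail u (k + 1) ≤ tail s 1 := Nat.find_spec hex
  have hk0 : tail s 1 ≤ tail u k := by
    rcases Nat.eq_zero_or_pos k with h | h
    · rw [h, tail_zero]; exact hs0
    · have := Nat.find_min hex (m := k - 1) (by change k - 1 < k; omega)
      rw [Nat.sub_add_cancel h] at this
      exact le_of_lt (not_le.1 this)
  have hk : k ≤ n := Nat.find_min' hex (by rw [tail_of_lt u (by omega)]; exact hs1)
  obtain ⟨w, hw⟩ := exists_of_tail (n := n + 1)
    (fun j => if j ≤ k then tail u j else if j = k + 1 then tail s 1 else tail u (j - 1))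
    (fun j => by
      rcases lt_trichotomy j k with h | h | h
      · rw [if_pos (show j + 1 ≤ k by omega), if_pos h.le]; exact tail_anti u (by omega)
      · subst h; rw [if_neg (by omega), if_pos rfl, if_pos le_rfl]; exact hk0
      · rw [if_neg (by omega), if_neg (by omega), if_neg (by omega)]
        split_ifs with h'
        · subst h'; exact hk1
        · exact tail_anti u (by omega))
    (by rw [if_pos (Nat.zero_le _), tail_zero])
    (by rw [if_neg (by omega), if_neg (by omega), tail_of_lt u (by omega)])
  refine ⟨k, hk, w, tail_ext fun j => ?_, tail_one_ext ?_⟩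
  · rcases Nat.lt_or_ge n j with hj | hj
    · rw [tail_of_lt _ hj, tail_of_lt _ hj]
    rcases Nat.lt_or_ge k j with h | h
    · rw [tail_sigma_lt hk w h, hw _ (by omega), if_neg (by omega), if_neg (by omega)]
      rfl
    · rw [tail_sigma_le hk w h, hw _ (by omega), if_pos h]
  · rw [tail_rho, hw _ (by omega), if_neg (by omega), if_pos rfl]

lemma prism_inj_aux {n k l : ℕ} (hk : k ≤ n) (hl : l ≤ n) (hkl : k ≤ l) (w w' : TopΔ (n + 1))
    (h1 : stdSimplex.map (sigmaHom k hk) w = stdSimplex.map (sigmaHom l hl) w')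
    (h2 : stdSimplex.map (rhoHom n k) w = stdSimplex.map (rhoHom n l) w') :
    w = w' ∧ ∀ i : Fin (n + 1 + 1), k < i.val → i.val ≤ l → w i = 0 := by
  have hs : tail w (k + 1) = tail w' (l + 1) := by rw [← tail_rho, h2, tail_rho]
  have hU : ∀ j, tail (stdSimplex.map (sigmaHom k hk) w) j =
    tail (stdSimplex.map (sigmaHom l hl) w') j := fun j => by rw [h1]
  have hlow : ∀ j ≤ k, tail w j = tail w' j := fun j hj => by
    rw [← tail_sigma_le hk w hj, hU, tail_sigma_le hl w' (by omega)]
  have hhigh : ∀ j, l < j → tail w (j + 1) = tail w' (j + 1) := fun j hj => by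
    rw [← tail_sigma_lt hk w (by omega), hU, tail_sigma_lt hl w' hj]
  have hmid : ∀ j, k < j → j ≤ l → tail w (j + 1) = tail w' j := fun j hj hj' => by
    rw [← tail_sigma_lt hk w (by omega), hU, tail_sigma_le hl w' hj']
  have hc : ∀ j, k < j → j ≤ l + 1 → tail w j = tail w (k + 1) := fun j hj hj' => by
    apply le_antisymm (tail_anti w (by omega))
    rcases Nat.eq_or_lt_of_le (show k + 1 ≤ j by omega) with h | h
    · rw [h]
    · rw [hs, show j = (j - 1) + 1 by omega, hmid (j - 1) (by omega) (by omega)]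
      exact tail_anti w' (by omega)
  have hc' : ∀ j, k < j → j ≤ l + 1 → tail w' j = tail w (k + 1) := fun j hj hj' => by
    rcases Nat.eq_or_lt_of_le hj' with h | h
    · rw [h, hs]
    · rw [← hmid j hj (by omega), hc _ (by omega) (by omega)]
  refine ⟨tail_ext fun j => ?_, fun i hi hi' => ?_⟩
  · rcases Nat.lt_or_ge k j with h | h
    · rcases Nat.lt_or_ge (l + 1) j with h' | h'
      · rw [show j = (j - 1) + 1 by omega, hhigh _ (by omega)]
      · rw [hc j h h', hc' j h h']
    · exact hlow j h
  · have := tail_succ w i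
    rw [hc i.val hi (by omega), hc (i.val + 1) (by omega) (by omega)] at this
    linarith

variable {n : ℕ} {Z : Type*} [TopologicalSpace Z]

/-- The face spanned by the support of a point. -/
lemma exists_face {m : ℕ} (w : TopΔ m) : ∃ (c : ℕ) (d : Fin (c + 1) →o Fin (m + 1)) (w₀ : TopΔ c),
    stdSimplex.map d w₀ = w ∧ ∀ i, w (d i) ≠ 0 := by
  classical
  let F : Finset (Fin (m + 1)) := Finset.univ.filter fun i => w i ≠ 0
  have hF : F.Nonempty := by
    by_contra h
    rw [Finset.not_nonempty_iff_eq_empty, Finset.filter_eq_empty_iff] at h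
    have h1 := stdSimplex.sum_eq_one w
    rw [Finset.sum_eq_zero (fun i hi => not_not.1 (h hi))] at h1
    exact zero_ne_one h1
  obtain ⟨c, hc⟩ : ∃ c, F.card = c + 1 := ⟨F.card - 1, by have := hF.card_pos; omega⟩
  let d := F.orderEmbOfFin hc
  have hd : ∀ i, w (d i) ≠ 0 := fun i => (Finset.mem_filter.1 (F.orderEmbOfFin_mem hc i)).2
  have hsum : ∀ g : Fin (m + 1) → ℝ, (∀ i, w i = 0 → g i = 0) →
      ∑ k, g (d k) = ∑ i, g i := fun g hg => by
    rw [← Finset.sum_subset (Finset.subset_univ F) (fun i _ hi => hg i (by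
      by_contra h; exact hi (Finset.mem_filter.2 ⟨Finset.mem_univ _, h⟩)))]
    refine (Finset.sum_map Finset.univ d.toEmbedding g).symm.trans ?_
    congr 1
    ext i
    simp only [Finset.mem_map, Finset.mem_univ, true_and]
    rw [← Finset.mem_coe, ← Finset.range_orderEmbOfFin F hc]
    rfl
  let w₀ : TopΔ c := ⟨fun k => w (d k), fun k => stdSimplex.zero_le w _, by
    rw [hsum w (fun _ h => h)]; exact stdSimplex.sum_eq_one w⟩
  refine ⟨c, d.toOrderHom, w₀, ?_, hd⟩
  ext i
  rw [stdSimplex.map_coe, FunOnFinite.linearMap_apply_apply, Finset.sum_filter]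
  change (∑ k, if d k = i then w (d k) else 0) = w i
  rw [hsum (fun k => if k = i then w k else 0) (fun k hk => by simp [hk])]
  simp

/-- Every chain of `[n] × [1]` lies in a maximal one. -/
lemma exists_max_chain {m : ℕ} (q : Fin (m + 1) →o Fin (n + 1)) (r : Fin (m + 1) →o Fin (1 + 1)) :
    ∃ (k : ℕ) (hk : k ≤ n) (θ : Fin (m + 1) →o Fin (n + 1 + 1)),
      (sigmaHom k hk).comp θ = q ∧ (rhoHom n k).comp θ = r := by
  classical
  have h01 : ∀ i, (r i).val = 0 ∨ (r i).val = 1 := fun i => by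
    have := (r i).isLt
    omega
  obtain ⟨k, hk, h0, h1⟩ : ∃ k ≤ n, (∀ i, (r i).val = 0 → (q i).val ≤ k) ∧
      (∀ i, (r i).val = 1 → k ≤ (q i).val) := by
    by_cases hr : ∃ j, ∃ h : j < m + 1, (r ⟨j, h⟩).val = 1
    · obtain ⟨hlt, hi₀⟩ := Nat.find_spec hr
      refine ⟨(q ⟨Nat.find hr, hlt⟩).val, Nat.lt_succ_iff.1 (q _).isLt, fun i hi => ?_,
        fun i hi => ?_⟩
      · refine q.monotone (le_of_not_ge fun h => ?_)
        have : (r ⟨Nat.find hr, hlt⟩).val ≤ (r i).val := r.monotone h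
        omega
      · exact q.monotone (Nat.find_min' hr ⟨i.isLt, hi⟩)
    · exact ⟨n, le_rfl, fun i _ => Nat.lt_succ_iff.1 (q i).isLt,
        fun i hi => absurd ⟨i.val, i.isLt, hi⟩ hr⟩
  refine ⟨k, hk, ⟨fun i => ⟨(q i).val + (r i).val, by
    have := (q i).isLt; have := (r i).isLt; omega⟩, fun i j hij => ?_⟩, ?_, ?_⟩
  · have h2 : (q i).val ≤ (q j).val := q.monotone hij
    have h3 : (r i).val ≤ (r j).val := r.monotone hij
    exact Fin.mk_le_mk.2 (by omega)
  · ext i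
    change (if (q i).val + (r i).val ≤ k then (q i).val + (r i).val
      else (q i).val + (r i).val - 1) = (q i).val
    rcases h01 i with h | h
    · have := h0 i h
      rw [if_pos (by omega)]; omega
    · have := h1 i h
      rw [if_neg (by omega)]; omega
  · ext i
    change (if (q i).val + (r i).val ≤ k then (0 : Fin 2) else 1).val = (r i).val
    rcases h01 i with h | h
    · have := h0 i h
      rw [if_pos (by omega), h]; rfl
    · have := h1 i h
      rw [if_neg (by omega), h]; rfl

/-- A family of continuous maps, one for each chain of `[n] × [1]`, compatible with
reparametrization. -/
structure PrismData (n : ℕ) (Z : Type*) [TopologicalSpace Z] where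
  /-- the map on the chain `(q, r)` -/
  V : ∀ m : ℕ, (Fin (m + 1) →o Fin (n + 1)) → (Fin (m + 1) →o Fin (1 + 1)) → C(TopΔ m, Z)
  compat : ∀ (m m' : ℕ) (θ : Fin (m' + 1) →o Fin (m + 1)) (q : Fin (m + 1) →o Fin (n + 1))
    (r : Fin (m + 1) →o Fin (1 + 1)) (w : TopΔ m'),
    V m' (q.comp θ) (r.comp θ) w = V m q r (stdSimplex.map θ w)

namespace PrismData

variable (D : PrismData n Z)

lemma congr_support {m : ℕ} {q q' : Fin (m + 1) →o Fin (n + 1)}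
    {r r' : Fin (m + 1) →o Fin (1 + 1)} {w : TopΔ m}
    (h : ∀ i, w i ≠ 0 → q i = q' i ∧ r i = r' i) : D.V m q r w = D.V m q' r' w := by
  obtain ⟨c, d, w₀, hw, hd⟩ := exists_face w
  have h1 : q.comp d = q'.comp d := OrderHom.ext _ _ (funext fun i => (h _ (hd i)).1)
  have h2 : r.comp d = r'.comp d := OrderHom.ext _ _ (funext fun i => (h _ (hd i)).2)
  rw [← hw, ← D.compat, ← D.compat, h1, h2]

lemma max_eq {k l : ℕ} (hk : k ≤ n) (hl : l ≤ n) (w w' : TopΔ (n + 1)) (hkl : k ≤ l)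
    (h1 : stdSimplex.map (sigmaHom k hk) w = stdSimplex.map (sigmaHom l hl) w')
    (h2 : stdSimplex.map (rhoHom n k) w = stdSimplex.map (rhoHom n l) w') :
    D.V (n + 1) (sigmaHom k hk) (rhoHom n k) w =
      D.V (n + 1) (sigmaHom l hl) (rhoHom n l) w' := by
  obtain ⟨rfl, h0⟩ := prism_inj_aux hk hl hkl w w' h1 h2
  refine D.congr_support fun i hi => ?_
  have hi' : ¬ (k < i.val ∧ i.val ≤ l) := fun h => hi (h0 i h.1 h.2)
  constructor
  · ext
    change (if i.val ≤ k then i.val else i.val - 1) = if i.val ≤ l then i.val else i.val - 1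
    split_ifs <;> omega
  · change (if i.val ≤ k then (0 : Fin 2) else 1) = if i.val ≤ l then (0 : Fin 2) else 1
    split_ifs <;> first | rfl | omega

/-- The projection of the disjoint union of the maximal simplices onto `Δⁿ × Δ¹`. -/
def proj (n : ℕ) (x : Σ _ : Fin (n + 1), TopΔ (n + 1)) : TopΔ n × TopΔ 1 :=
  (stdSimplex.map (sigmaHom x.1.val (Nat.lt_succ_iff.1 x.1.isLt)) x.2,
    stdSimplex.map (rhoHom n x.1.val) x.2)

lemma proj_continuous (n : ℕ) : Continuous (proj n) := by
  refine continuous_sigma fun k => ?_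
  have h1 := stdSimplex.continuous_map (S := ℝ)
    (sigmaHom (n := n) k.val (Nat.lt_succ_iff.1 k.isLt))
  have h2 := stdSimplex.continuous_map (S := ℝ) (rhoHom n k.val)
  exact h1.prodMk h2

lemma proj_surjective (n : ℕ) : Function.Surjective (proj n) := fun x => by
  obtain ⟨k, hk, w, h1, h2⟩ := prism_surj x.1 x.2
  exact ⟨⟨⟨k, Nat.lt_succ_of_le hk⟩, w⟩, Prod.ext h1 h2⟩

lemma proj_quotient (n : ℕ) : Topology.IsQuotientMap (proj n) :=
  Topology.IsQuotientMap.of_surjective_continuous (proj_surjective n) (proj_continuous n)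

/-- The map on the disjoint union of the maximal simplices. -/
def sigmaMap (x : Σ _ : Fin (n + 1), TopΔ (n + 1)) : Z :=
  D.V (n + 1) (sigmaHom x.1.val (Nat.lt_succ_iff.1 x.1.isLt)) (rhoHom n x.1.val) x.2

lemma sigmaMap_fac (x y : Σ _ : Fin (n + 1), TopΔ (n + 1)) (h : proj n x = proj n y) :
    D.sigmaMap x = D.sigmaMap y := by
  obtain ⟨k, w⟩ := x
  obtain ⟨l, w'⟩ := y
  have h1 := congrArg Prod.fst h
  have h2 := congrArg Prod.snd h
  rcases le_total k.val l.val with hkl | hkl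
  · exact D.max_eq _ _ _ _ hkl h1 h2
  · exact (D.max_eq _ _ _ _ hkl h1.symm h2.symm).symm

/-- Compatible continuous maps on the chains of `[n] × [1]` glue to a continuous map on
`Δⁿ × Δ¹`. -/
def glue : C(TopΔ n × TopΔ 1, Z) where
  toFun x := D.sigmaMap ((proj_quotient n).surjective x).choose
  continuous_toFun := by
    refine (proj_quotient n).continuous_iff.2 ?_
    have h : Continuous D.sigmaMap := continuous_sigma fun k =>
      (D.V (n + 1) (sigmaHom k.val (Nat.lt_succ_iff.1 k.isLt)) (rhoHom n k.val)).continuous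
    refine h.congr fun x => ?_
    exact D.sigmaMap_fac _ _ ((proj_quotient n).surjective (proj n x)).choose_spec.symm

lemma glue_proj (x : Σ _ : Fin (n + 1), TopΔ (n + 1)) : D.glue (proj n x) = D.sigmaMap x :=
  D.sigmaMap_fac _ _ ((proj_quotient n).surjective (proj n x)).choose_spec

lemma glue_apply {m : ℕ} (q : Fin (m + 1) →o Fin (n + 1)) (r : Fin (m + 1) →o Fin (1 + 1))
    (w : TopΔ m) : D.glue (stdSimplex.map q w, stdSimplex.map r w) = D.V m q r w := by
  obtain ⟨k, hk, θ, rfl, rfl⟩ := exists_max_chain q r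
  rw [D.compat]
  refine Eq.trans ?_ (D.glue_proj ⟨⟨k, Nat.lt_succ_of_le hk⟩, stdSimplex.map θ w⟩)
  congr 1
  exact Prod.ext (stdSimplex.map_comp_apply θ (sigmaHom k hk) w).symm
    (stdSimplex.map_comp_apply θ (rhoHom n k) w).symm

/-- Every point of `Δⁿ × Δ¹` lies on a chain. -/
lemma exists_chain (x : TopΔ n × TopΔ 1) : ∃ (m : ℕ) (q : Fin (m + 1) →o Fin (n + 1))
    (r : Fin (m + 1) →o Fin (1 + 1)) (w : TopΔ m),
    x = (stdSimplex.map q w, stdSimplex.map r w) := by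
  obtain ⟨k, hk, w, h1, h2⟩ := prism_surj x.1 x.2
  exact ⟨n + 1, sigmaHom k hk, rhoHom n k, w, Prod.ext h1.symm h2.symm⟩

end PrismData

end Prism

/-! ### The `S.` construction -/

section SDot

/-- The index category of the `n`-simplices of the diagonal of the nerve of `iS.C`:  the first
factor is the nerve direction, the second factor is the category of arrows of `[n]`. -/
abbrev SIndex (n : ℕ) : Type := Fin (n + 1) × Arrow (Fin (n + 1))

/-- The functor `SIndex m ⥤ SIndex n` induced by a monotone map `[m] → [n]`. -/
def SIndex.map {m n : ℕ} (θ : Fin (m + 1) →o Fin (n + 1)) : SIndex m ⥤ SIndex n :=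
  θ.monotone.functor.prod θ.monotone.functor.mapArrow

variable {C : Type (u + 1)} [Category.{u} C] [CofCat C]

/-- A functor `G` on `[n] × Ar[n]` is a sequence of `n` composable isomorphisms of objects of
`SₙC`. -/
structure IsSDiagram {n : ℕ} (G : SIndex n ⥤ C) : Prop where
  pt : ∀ k i : Fin (n + 1), G.obj (k, Arrow.mk (𝟙 i)) = CofCat.pt
  cofSeq : ∀ (k : Fin (n + 1)) {i j l : Fin (n + 1)} (a : i ⟶ j) (b : j ⟶ l),
    CofCat.IsCofSeq
      (G.map ((𝟙 k, Arrow.homMk (𝟙 i) b) : (k, Arrow.mk a) ⟶ (k, Arrow.mk (a ≫ b))))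
      (G.map ((𝟙 k, Arrow.homMk a (𝟙 l)) : (k, Arrow.mk (a ≫ b)) ⟶ (k, Arrow.mk b)))
  iso : ∀ {k k' : Fin (n + 1)} (h : k ⟶ k') (a : Arrow (Fin (n + 1))),
    IsIso (G.map ((h, 𝟙 a) : (k, a) ⟶ (k', a)))

lemma IsSDiagram.precomp {m n : ℕ} (θ : Fin (m + 1) →o Fin (n + 1)) {G : SIndex n ⥤ C}
    (hG : IsSDiagram G) : IsSDiagram (SIndex.map θ ⋙ G) where
  pt k i := hG.pt (θ k) (θ i)
  cofSeq k _ _ _ a b := hG.cofSeq (θ k) (θ.monotone.functor.map a) (θ.monotone.functor.map b)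
  iso h a := hG.iso (θ.monotone.functor.map h) (θ.monotone.functor.mapArrow.obj a)

lemma IsSDiagram.postcomp {D : Type (u + 1)} [Category.{u} D] [CofCat D] {F : C ⥤ D}
    (hF : IsExactFunctor F) {n : ℕ} {G : SIndex n ⥤ C} (hG : IsSDiagram G) :
    IsSDiagram (G ⋙ F) where
  pt k i := (congrArg F.obj (hG.pt k i)).trans hF.map_pt
  cofSeq k _ _ _ a b := hF.map_cofSeq _ _ (hG.cofSeq k a b)
  iso h a := by
    have := hG.iso h a
    exact inferInstanceAs (IsIso (F.map (G.map _)))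

variable (C) in
/-- The diagonal of the bisimplicial nerve of the simplicial category `iS.C` of Waldhausen, where
`i` denotes the subcategories of isomorphisms. -/
def sDiag : SSet.{u + 1} where
  obj n := { G : SIndex n.unop.len ⥤ C // IsSDiagram G }
  map θ := TypeCat.ofHom fun G => ⟨SIndex.map θ.unop.toOrderHom ⋙ G.1, G.2.precomp _⟩

/-- Functoriality in exact functors. -/
def sDiagMap {D : Type (u + 1)} [Category.{u} D] [CofCat D] (F : C ⥤ D) (hF : IsExactFunctor F) :
    sDiag C ⟶ sDiag D where
  app n := TypeCat.ofHom fun G => ⟨G.1 ⋙ F, G.2.postcomp hF⟩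

end SDot

/-! ### Points of the geometric realization -/

section Realization

universe v

open Simplicial

/-- The geometric realization. -/
abbrev Rlz (X : SSet.{v}) : TopCat.{v} := SSet.toTop.obj X

/-- The simplicial operator of a monotone map. -/
abbrev sact (X : SSet.{v}) {m n : ℕ} (θ : Fin (m + 1) →o Fin (n + 1)) (x : X.obj (.op ⦋n⦌)) :
    X.obj (.op ⦋m⦌) := X.map (SimplexCategory.mkHom θ).op x

/-- The characteristic map `Δⁿ → |X|` of an `n`-simplex of `X`. -/
def rpt {X : SSet.{v}} {n : ℕ} (x : X.obj (.op ⦋n⦌)) : C(TopΔ n, Rlz X) :=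
  TopCat.toSSetObjEquiv (Rlz X) (.op ⦋n⦌) ((sSetTopAdj.unit.app X).app _ x)

lemma rpt_map {X : SSet.{v}} {m n : ℕ} (θ : Fin (m + 1) →o Fin (n + 1)) (x : X.obj (.op ⦋n⦌))
    (w : TopΔ m) : rpt (sact X θ x) w = rpt x (stdSimplex.map θ w) := by
  have h := ConcreteCategory.congr_hom
    ((sSetTopAdj.unit.app X).naturality (SimplexCategory.mkHom θ).op) x
  refine Eq.trans ?_ (TopCat.toSSetObjEquiv_naturality_apply (SimplexCategory.mkHom θ)
    ((sSetTopAdj.unit.app X).app _ x) w)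
  exact congrArg (fun y => TopCat.toSSetObjEquiv (Rlz X) (.op ⦋m⦌) y w) h

lemma rpt_nat {X Y : SSet.{v}} (f : X ⟶ Y) {n : ℕ} (x : X.obj (.op ⦋n⦌)) (w : TopΔ n) :
    SSet.toTop.map f (rpt x w) = rpt (f.app _ x) w := by
  have h := ConcreteCategory.congr_hom (NatTrans.congr_app (sSetTopAdj.unit.naturality f)
    (.op ⦋n⦌)) x
  exact (congrArg (fun y => TopCat.toSSetObjEquiv (Rlz Y) (.op ⦋n⦌) y w) h).symm

/-- Compatible continuous maps on the simplices of `X`, as a map to the singular complex. -/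
def realizeNat {X : SSet.{v}} {Z : Type v} [TopologicalSpace Z]
    (g : ∀ n : ℕ, X.obj (.op ⦋n⦌) → C(TopΔ n, Z))
    (hg : ∀ (m n : ℕ) (θ : Fin (m + 1) →o Fin (n + 1)) (x : X.obj (.op ⦋n⦌)) (w : TopΔ m),
      g m (sact X θ x) w = g n x (stdSimplex.map θ w)) : X ⟶ TopCat.toSSet.obj (TopCat.of Z) where
  app n := TypeCat.ofHom fun x => (TopCat.toSSetObjEquiv (TopCat.of Z) n).symm (g n.unop.len x)
  naturality n m θ := by
    ext x
    refine Eq.trans ?_ (TopCat.toSSetObjEquiv_symm_naturality θ.unop _).symm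
    exact congrArg (TopCat.toSSetObjEquiv (TopCat.of Z) m).symm
      (ContinuousMap.ext fun w => hg m.unop.len n.unop.len θ.unop.toOrderHom x w)

/-- Compatible continuous maps on the simplices of `X` induce a continuous map on `|X|`. -/
def realizeLift {X : SSet.{v}} {Z : Type v} [TopologicalSpace Z]
    (g : ∀ n : ℕ, X.obj (.op ⦋n⦌) → C(TopΔ n, Z))
    (hg : ∀ (m n : ℕ) (θ : Fin (m + 1) →o Fin (n + 1)) (x : X.obj (.op ⦋n⦌)) (w : TopΔ m),
      g m (sact X θ x) w = g n x (stdSimplex.map θ w)) : C(Rlz X, Z) :=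
  ((sSetTopAdj.homEquiv X (TopCat.of Z)).symm (realizeNat g hg)).hom

lemma realizeLift_rpt {X : SSet.{v}} {Z : Type v} [TopologicalSpace Z]
    (g : ∀ n : ℕ, X.obj (.op ⦋n⦌) → C(TopΔ n, Z))
    (hg : ∀ (m n : ℕ) (θ : Fin (m + 1) →o Fin (n + 1)) (x : X.obj (.op ⦋n⦌)) (w : TopΔ m),
      g m (sact X θ x) w = g n x (stdSimplex.map θ w)) {n : ℕ} (x : X.obj (.op ⦋n⦌))
    (w : TopΔ n) : realizeLift g hg (rpt x w) = g n x w := by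
  have h := (sSetTopAdj.homEquiv X (TopCat.of Z)).apply_symm_apply (realizeNat g hg)
  rw [Adjunction.homEquiv_unit] at h
  have h' := ConcreteCategory.congr_hom (NatTrans.congr_app h (.op ⦋n⦌)) x
  have h'' := congrArg (fun y => TopCat.toSSetObjEquiv (TopCat.of Z) (.op ⦋n⦌) y w) h'
  refine Eq.trans ?_ (h''.trans ?_)
  · rfl
  · exact DFunLike.congr_fun (Equiv.apply_symm_apply _ _) w

lemma real_ext {X : SSet.{v}} {Z : Type v} [TopologicalSpace Z] {f f' : C(Rlz X, Z)}
    (h : ∀ (n : ℕ) (x : X.obj (.op ⦋n⦌)) (w : TopΔ n), f (rpt x w) = f' (rpt x w)) : f = f' := by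
  have : TopCat.ofHom f = (TopCat.ofHom f' : Rlz X ⟶ TopCat.of Z) := by
    apply (sSetTopAdj.homEquiv X (TopCat.of Z)).injective
    rw [Adjunction.homEquiv_unit, Adjunction.homEquiv_unit]
    ext n x
    apply (TopCat.toSSetObjEquiv (TopCat.of Z) n).injective
    ext w
    exact h n.unop.len x w
  exact congrArg (fun g => g.hom) this

end Realization

/-! ### Simplicial homotopies and their realizations -/

section Cylinders

universe v

open Simplicial

/-- A simplicial homotopy, that is a map `X × Δ[1] ⟶ Y`:  the `n`-simplices of `Δ[1]` are the
monotone maps `[n] → [1]`. -/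
structure Cylinder (X Y : SSet.{v}) where
  /-- the map on `n`-simplices -/
  h : ∀ n : ℕ, X.obj (.op ⦋n⦌) → (Fin (n + 1) →o Fin (1 + 1)) → Y.obj (.op ⦋n⦌)
  nat : ∀ (m n : ℕ) (θ : Fin (m + 1) →o Fin (n + 1)) (x : X.obj (.op ⦋n⦌))
    (r : Fin (n + 1) →o Fin (1 + 1)), h m (sact X θ x) (r.comp θ) = sact Y θ (h n x r)

namespace Cylinder

variable {X Y : SSet.{v}} (H : Cylinder X Y)

lemma sact_comp (X : SSet.{v}) {k m n : ℕ} (θ : Fin (m + 1) →o Fin (n + 1))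
    (η : Fin (k + 1) →o Fin (m + 1)) (x : X.obj (.op ⦋n⦌)) :
    sact X (θ.comp η) x = sact X η (sact X θ x) :=
  ConcreteCategory.congr_hom
    (X.map_comp (SimplexCategory.mkHom θ).op (SimplexCategory.mkHom η).op) x

lemma sact_id (X : SSet.{v}) {n : ℕ} (x : X.obj (.op ⦋n⦌)) : sact X OrderHom.id x = x :=
  ConcreteCategory.congr_hom (X.map_id (.op ⦋n⦌)) x

/-- The realization of a simplicial homotopy on the prism `Δⁿ × Δ¹` over a simplex. -/
def prism {n : ℕ} (x : X.obj (.op ⦋n⦌)) : PrismData n (Rlz Y) where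
  V m q r := rpt (H.h m (sact X q x) r)
  compat m m' θ q r w := by rw [sact_comp, H.nat, rpt_map]

lemma prism_map {m n : ℕ} (θ : Fin (m + 1) →o Fin (n + 1)) (x : X.obj (.op ⦋n⦌)) (w : TopΔ m)
    (s : TopΔ 1) : (H.prism (sact X θ x)).glue (w, s) =
      (H.prism x).glue (stdSimplex.map θ w, s) := by
  obtain ⟨k, q, r, w₀, h⟩ := PrismData.exists_chain (w, s)
  obtain ⟨rfl, rfl⟩ := Prod.ext_iff.1 h
  dsimp only
  have h1 : stdSimplex.map θ (stdSimplex.map q w₀) = stdSimplex.map (θ.comp q) w₀ :=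
    stdSimplex.map_comp_apply q θ w₀
  rw [h1, PrismData.glue_apply, PrismData.glue_apply]
  change rpt (H.h k (sact X q (sact X θ x)) r) w₀ = rpt (H.h k (sact X (θ.comp q) x) r) w₀
  rw [sact_comp]

/-- The realization of a simplicial homotopy over a simplex, as a family of paths. -/
def simplexPath (n : ℕ) (x : X.obj (.op ⦋n⦌)) : C(TopΔ n, C(unitInterval, Rlz Y)) :=
  ((H.prism x).glue.comp ((ContinuousMap.id (TopΔ n)).prodMap
    (stdSimplexHomeomorphUnitInterval.symm : C(unitInterval, stdSimplex ℝ (Fin 2))))).curry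

lemma simplexPath_apply (n : ℕ) (x : X.obj (.op ⦋n⦌)) (w : TopΔ n) (s : unitInterval) :
    H.simplexPath n x w s = (H.prism x).glue (w, stdSimplexHomeomorphUnitInterval.symm s) := rfl

/-- The homotopy `|X| × [0, 1] → |Y|` given by a simplicial homotopy. -/
def realize : C(Rlz X, C(unitInterval, Rlz Y)) :=
  realizeLift H.simplexPath fun _ _ θ x w => ContinuousMap.ext fun _ => H.prism_map θ x w _

lemma realize_rpt {n : ℕ} (x : X.obj (.op ⦋n⦌)) (w : TopΔ n) (s : unitInterval) :
    H.realize (rpt x w) s = (H.prism x).glue (w, stdSimplexHomeomorphUnitInterval.symm s) := by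
  rw [realize, realizeLift_rpt]
  rfl

lemma map_const {n : ℕ} (i : Fin (1 + 1)) (w : TopΔ n) :
    (stdSimplex.map (OrderHom.const (Fin (n + 1)) i) w : TopΔ 1) =
      ⟨_, single_mem_stdSimplex ℝ i⟩ := by
  ext j
  rw [stdSimplex.map_coe, FunOnFinite.linearMap_apply_apply, Finset.sum_filter]
  change (∑ a, if i = j then w a else 0) = Pi.single (M := fun _ => ℝ) i 1 j
  by_cases hij : i = j
  · subst hij
    simp
  · rw [Pi.single_apply, if_neg (Ne.symm hij)]
    simp [hij]

lemma realize_rpt_const {n : ℕ} (x : X.obj (.op ⦋n⦌)) (w : TopΔ n) (i : Fin (1 + 1))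
    (s : unitInterval) (hs : stdSimplexHomeomorphUnitInterval ⟨_, single_mem_stdSimplex ℝ i⟩ = s) :
    H.realize (rpt x w) s = rpt (H.h n x (OrderHom.const _ i)) w := by
  rw [realize_rpt, ← hs, Homeomorph.symm_apply_apply, ← map_const i w]
  have h1 : w = stdSimplex.map OrderHom.id w := (stdSimplex.map_id_apply w).symm
  conv_lhs => enter [2, 1]; rw [h1]
  rw [PrismData.glue_apply]
  change rpt (H.h n (sact X OrderHom.id x) _) w = _
  rw [sact_id]

lemma realize_zero {f : X ⟶ Y} (hf : ∀ (n : ℕ) (x : X.obj (.op ⦋n⦌)),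
    H.h n x (OrderHom.const _ 0) = f.app _ x) (y : Rlz X) :
    H.realize y 0 = SSet.toTop.map f y := by
  have : (ContinuousMap.mk (fun y => H.realize y 0) (by fun_prop) : C(Rlz X, Rlz Y)) =
      (SSet.toTop.map f).hom := real_ext fun n x w => by
    refine (H.realize_rpt_const x w 0 0 stdSimplexHomeomorphUnitInterval_zero).trans ?_
    rw [hf]
    exact (rpt_nat f x w).symm
  exact DFunLike.congr_fun this y

lemma realize_one {f : X ⟶ Y} (hf : ∀ (n : ℕ) (x : X.obj (.op ⦋n⦌)),
    H.h n x (OrderHom.const _ 1) = f.app _ x) (y : Rlz X) :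
    H.realize y 1 = SSet.toTop.map f y := by
  have : (ContinuousMap.mk (fun y => H.realize y 1) (by fun_prop) : C(Rlz X, Rlz Y)) =
      (SSet.toTop.map f).hom := real_ext fun n x w => by
    refine (H.realize_rpt_const x w 1 1 stdSimplexHomeomorphUnitInterval_one).trans ?_
    rw [hf]
    exact (rpt_nat f x w).symm
  exact DFunLike.congr_fun this y

lemma realize_base (x : X.obj (.op ⦋0⦌)) (y : Y.obj (.op ⦋0⦌)) (hxy : ∀ (n : ℕ)
    (r : Fin (n + 1) →o Fin (1 + 1)), H.h n (sact X (OrderHom.const _ 0) x) r =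
      sact Y (OrderHom.const _ 0) y) (w : TopΔ 0) (s : unitInterval) :
    H.realize (rpt x w) s = rpt y w := by
  rw [realize_rpt]
  obtain ⟨k, q, r, w₀, h⟩ := PrismData.exists_chain (w, stdSimplexHomeomorphUnitInterval.symm s)
  rw [h, PrismData.glue_apply]
  have hq : q = OrderHom.const _ 0 := OrderHom.ext _ _ (_root_.funext fun i => Subsingleton.elim (α := Fin 1) _ _)
  change rpt (H.h k (sact X q x) r) w₀ = _
  rw [hq, hxy, rpt_map]
  exact congrArg _ (Subsingleton.elim (α := stdSimplex ℝ (Fin 1)) _ _)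

end Cylinder

end Cylinders

/-! ### The coassembly homotopy -/

section Coassembly

open Simplicial

variable {C : Type (u + 1)} [Category.{u} C]

lemma AutCat.comm {X Y : AutCat C} (f : X ⟶ Y) :
    X.obj.φ ≫ f.hom.hom = f.hom.hom ≫ Y.obj.φ := f.hom.comm

/-- The functor `(k, a) ↦ P` given by a functor `G(k, a) = (P, f)` to `Aut(C)` and a map
`r : [n] → [1]`.  A morphism is sent to the underlying morphism of its image under `G`, preceded
by `f` if `r` jumps from `0` to `1`. -/
def twist {n : ℕ} (G : SIndex n ⥤ AutCat C) (r : Fin (n + 1) →o Fin (1 + 1)) : SIndex n ⥤ C where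
  obj x := (G.obj x).obj.obj
  map {x y} a := (if r x.1 = r y.1 then 𝟙 _ else (G.obj x).obj.φ) ≫ (G.map a).hom.hom
  map_id x := by
    rw [if_pos rfl, G.map_id, Category.id_comp]
    rfl
  map_comp {x y z} a b := by
    have h1 : r x.1 ≤ r y.1 := r.monotone (leOfHom a.1)
    have h2 : r y.1 ≤ r z.1 := r.monotone (leOfHom b.1)
    have h3 : (G.map (a ≫ b)).hom.hom = (G.map a).hom.hom ≫ (G.map b).hom.hom := by
      rw [G.map_comp]; rfl
    rw [h3]
    by_cases h4 : r x.1 = r y.1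
    · rw [if_pos h4, h4, Category.id_comp]
      split_ifs
      · simp
      · rw [← Category.assoc, AutCat.comm, Category.assoc]
    · have h5 : r y.1 = r z.1 := by
        have := (r x.1).isLt
        have := (r z.1).isLt
        omega
      rw [if_neg h4, if_pos h5, if_neg (by rw [← h5]; exact h4)]
      simp

lemma twist_map_eq {n : ℕ} (G : SIndex n ⥤ AutCat C) (r : Fin (n + 1) →o Fin (1 + 1))
    {x y : SIndex n} (a : x ⟶ y) (h : r x.1 = r y.1) :
    (twist G r).map a = (G.map a).hom.hom := by
  change (if r x.1 = r y.1 then 𝟙 _ else (G.obj x).obj.φ) ≫ (G.map a).hom.hom = _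
  rw [if_pos h, Category.id_comp]

lemma twist_const (i : Fin (1 + 1)) {n : ℕ} (G : SIndex n ⥤ AutCat C) :
    twist G (OrderHom.const _ i) = G ⋙ AutCat.forget C :=
  CategoryTheory.Functor.ext (fun _ => rfl) fun x y a => by
    refine Eq.trans (b := (G.map a).hom.hom) (twist_map_eq _ _ _ rfl) ?_
    exact ((Category.id_comp _).trans (Category.comp_id ((AutCat.forget C).map (G.map a)))).symm

lemma diagram_ext_zero {n : ℕ} {G G' : SIndex n ⥤ C} (h : ∀ x, G.obj x = G'.obj x)
    (h0 : ∀ x, Limits.IsZero (G'.obj x)) : G = G' :=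
  CategoryTheory.Functor.ext h fun x y a => by
    have : Limits.IsZero (G.obj x) := by rw [h]; exact h0 x
    exact this.eq_of_src _ _

variable [CofCat C]

lemma cofSeq_congr {X Y Z : C} {f f' : X ⟶ Y} {g g' : Y ⟶ Z} (hf : f = f') (hg : g = g')
    (h : CofCat.IsCofSeq f' g') : CofCat.IsCofSeq f g := by
  rwa [hf, hg]

lemma twist_isSDiagram {n : ℕ} {G : SIndex n ⥤ AutCat C} (hG : IsSDiagram G)
    (r : Fin (n + 1) →o Fin (1 + 1)) : IsSDiagram (twist G r) where
  pt k i := congrArg (AutCat.forget C).obj (hG.pt k i)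
  cofSeq k _ _ _ a b := by
    exact cofSeq_congr (twist_map_eq G r _ rfl) (twist_map_eq G r _ rfl) (hG.cofSeq k a b)
  iso {k k'} h a := by
    have := hG.iso h a
    have h1 : IsIso (G.map ((h, 𝟙 a) : (k, a) ⟶ (k', a))).hom.hom :=
      inferInstanceAs (IsIso ((AutCat.forget C).map (G.map _)))
    have h2 : IsIso (G.obj (k, a)).obj.φ := (G.obj (k, a)).property
    refine @IsIso.comp_isIso _ _ _ _ _ _ _ ?_ h1
    split_ifs
    · exact inferInstanceAs (IsIso (𝟙 _))
    · exact h2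

variable (C) in
/-- The simplicial homotopy from the forgetful map `iS.Aut(C) → iS.C` to itself that is given on
`(P, f)` by the isomorphism `f : P ⟶ P`. -/
def autCylinder : Cylinder (sDiag (AutCat C)) (sDiag C) where
  h _ G r := ⟨twist G.1 r, twist_isSDiagram G.2 r⟩
  nat _ _ _ _ _ := rfl

lemma autCylinder_const (i : Fin (1 + 1)) (n : ℕ) (G : (sDiag (AutCat C)).obj (.op ⦋n⦌)) :
    (autCylinder C).h n G (OrderHom.const _ i) =
      (sDiagMap (AutCat.forget C) AutCat.forget_exact).app _ G :=
  Subtype.ext (twist_const i G.1)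

/-- The diagram that is constant at the zero object. -/
def zeroDiagram (n : ℕ) : SIndex n ⥤ C := (Functor.const _).obj CofCat.pt

lemma zeroDiagram_isSDiagram (n : ℕ) : IsSDiagram (zeroDiagram (C := C) n) where
  pt _ _ := rfl
  cofSeq _ _ _ _ _ _ := CofCat.cofSeq_pt
  iso _ _ := inferInstanceAs (IsIso (𝟙 _))

variable (C) in
/-- The base vertex of `iS.C`. -/
def sBase : (sDiag C).obj (.op ⦋0⦌) := ⟨zeroDiagram 0, zeroDiagram_isSDiagram 0⟩

lemma sDiagMap_base {D : Type (u + 1)} [Category.{u} D] [CofCat D] (F : C ⥤ D)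
    (hF : IsExactFunctor F) : (sDiagMap F hF).app _ (sBase C) = sBase D :=
  Subtype.ext (diagram_ext_zero (fun _ => hF.map_pt) fun _ => CofCat.isZero_pt)

lemma autCylinder_base (n : ℕ) (r : Fin (n + 1) →o Fin (1 + 1)) :
    (autCylinder C).h n (sact _ (OrderHom.const _ 0) (sBase (AutCat C))) r =
      sact _ (OrderHom.const _ 0) (sBase C) :=
  Subtype.ext (diagram_ext_zero (fun _ => rfl) fun _ => CofCat.isZero_pt)

end Coassembly

/-! ### Loop spaces, free loop spaces, homotopy fibers -/

section Spaces

variable {X Y Z : Type*} [TopologicalSpace X] [TopologicalSpace Y] [TopologicalSpace Z]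

/-- The based loop space. -/
abbrev LoopSp (x : X) : Type _ := Path x x

/-- The free loop space. -/
def FreeLoop (X : Type*) [TopologicalSpace X] : Type _ := {γ : C(unitInterval, X) // γ 0 = γ 1}

instance : TopologicalSpace (FreeLoop X) :=
  inferInstanceAs (TopologicalSpace {γ : C(unitInterval, X) // γ 0 = γ 1})

/-- The map of loop spaces induced by a based map. -/
def loopMap (f : C(X, Y)) {x : X} {y : Y} (h : f x = y) : C(LoopSp x, LoopSp y) where
  toFun γ := ⟨f.comp γ.toContinuousMap, by simp [h], by simp [h]⟩
  continuous_toFun := Path.continuous_uncurry_iff.1 (by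
    change Continuous fun p : LoopSp x × unitInterval => f (p.1 p.2)
    fun_prop)

lemma loopMap_refl (f : C(X, Y)) {x : X} {y : Y} (h : f x = y) :
    loopMap f h (Path.refl x) = Path.refl y := by
  ext t
  exact h

/-- The homotopy fiber of `f : X → Z` over `z`:  pairs of a point `x` and a path from `z` to
`f x`. -/
def HoFiber (f : C(X, Z)) (z : Z) : Type _ :=
  {p : X × C(unitInterval, Z) // p.2 0 = z ∧ p.2 1 = f p.1}

instance (f : C(X, Z)) (z : Z) : TopologicalSpace (HoFiber f z) :=
  inferInstanceAs (TopologicalSpace {p : X × C(unitInterval, Z) // p.2 0 = z ∧ p.2 1 = f p.1})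

/-- The base point of the homotopy fiber of a based map. -/
def HoFiber.base (f : C(X, Z)) {x : X} {z : Z} (h : f x = z) : HoFiber f z :=
  ⟨(x, ContinuousMap.const _ z), rfl, h.symm⟩

/-- Consider a commutative square
`X → LY`
`↓     ↓`
`Z → Y`
with top `σ`, left `f`, bottom `g`, where `LY → Y` is the evaluation at `0`.  It induces a map from
the homotopy fiber of `f` to the homotopy fiber `ΩY` of `LY → Y`: a point `x` with a path `γ` from
`z` to `f x` is sent to the loop `σ x`, transported along the path `g γ` to the base point of
`Y`. -/
def restrictToFiber (f : C(X, Z)) (g : C(Z, Y)) (σ : C(X, FreeLoop Y))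
    (hσ : ∀ x, (σ x).1 0 = g (f x)) {z : Z} {y : Y} (hy : g z = y) :
    C(HoFiber f z, LoopSp y) where
  toFun p :=
    let a : Path y (g (f p.1.1)) :=
      ⟨g.comp p.1.2, (congrArg g p.2.1).trans hy, congrArg g p.2.2⟩
    let l : Path (g (f p.1.1)) (g (f p.1.1)) :=
      ⟨(σ p.1.1).1, hσ _, (σ p.1.1).2.symm.trans (hσ _)⟩
    (a.trans l).trans a.symm
  continuous_toFun := by
    refine Path.continuous_uncurry_iff.1 ?_
    have ha : Continuous fun q : HoFiber f z × unitInterval => g (q.1.1.2 q.2) := by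
      have : Continuous fun q : HoFiber f z × unitInterval => q.1.1.2 :=
        continuous_snd.comp (continuous_subtype_val.comp continuous_fst)
      fun_prop
    have hl : Continuous fun q : HoFiber f z × unitInterval => (σ q.1.1.1).1 q.2 := by
      have h1 : Continuous fun q : HoFiber f z × unitInterval => q.1.1.1 :=
        continuous_fst.comp (continuous_subtype_val.comp continuous_fst)
      have h2 : Continuous fun q : HoFiber f z × unitInterval => (σ q.1.1.1).1 :=
        continuous_subtype_val.comp (σ.continuous.comp h1)
      fun_prop
    exact Path.trans_continuous_family _ (Path.trans_continuous_family _ ha _ hl) _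
      (Path.symm_continuous_family _ ha)

/-- The sum of two maps to a loop space. -/
def loopAdd {y : Y} (f g : C(X, LoopSp y)) : C(X, LoopSp y) where
  toFun x := (f x).trans (g x)
  continuous_toFun := by fun_prop

/-- The negative of a map to a loop space. -/
def loopNeg {y : Y} (f : C(X, LoopSp y)) : C(X, LoopSp y) where
  toFun x := (f x).symm
  continuous_toFun := Path.continuous_symm.comp f.continuous

end Spaces

/-! ### Algebraic K-theory and the coassembly map -/

section KTheory

variable (C : Type (u + 1)) [Category.{u} C] [CofCat C]

/-- The delooping `|iS.C|` of the `K`-theory space. -/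
abbrev DeloopK : Type (u + 1) := Rlz (sDiag C)

/-- The base point of `|iS.C|`. -/
def DeloopK.base : DeloopK C := rpt (sBase C) default

/-- The `K`-theory space `K(C) = Ω|iS.C|`. -/
abbrev KSp : Type (u + 1) := LoopSp (DeloopK.base C)

/-- The base point of the `K`-theory space, the constant loop. -/
abbrev KSp.base : KSp C := Path.refl (DeloopK.base C)

variable {C} {D : Type (u + 1)} [Category.{u} D] [CofCat D]

/-- The map of deloopings induced by an exact functor. -/
def DeloopK.map (F : C ⥤ D) (hF : IsExactFunctor F) : C(DeloopK C, DeloopK D) :=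
  (SSet.toTop.map (sDiagMap F hF)).hom

lemma DeloopK.map_base (F : C ⥤ D) (hF : IsExactFunctor F) :
    DeloopK.map F hF (DeloopK.base C) = DeloopK.base D :=
  (rpt_nat (sDiagMap F hF) (sBase C) default).trans (by rw [sDiagMap_base]; rfl)

/-- The map `K(C) → K(D)` induced by an exact functor. -/
def KSp.map (F : C ⥤ D) (hF : IsExactFunctor F) : C(KSp C, KSp D) :=
  loopMap (DeloopK.map F hF) (DeloopK.map_base F hF)

lemma KSp.map_base (F : C ⥤ D) (hF : IsExactFunctor F) :
    KSp.map F hF (KSp.base C) = KSp.base D := loopMap_refl _ _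

/-- The map `ΩK(C) → ΩK(D)` induced by an exact functor. -/
def KSp.loop (F : C ⥤ D) (hF : IsExactFunctor F) :
    C(LoopSp (KSp.base C), LoopSp (KSp.base D)) :=
  loopMap (KSp.map F hF) (KSp.map_base F hF)

variable (C) in
/-- The coassembly map `c : K(Aut(C)) → L K(C)`: the value at `s ∈ [0, 1]` of the loop `c(ω)` is
the image of `ω` under the time `s` map of the realization of the simplicial homotopy given by
the automorphisms. -/
def coassembly : C(KSp (AutCat C), FreeLoop (KSp C)) where
  toFun ω :=
    ⟨⟨fun s => ⟨⟨fun r => (autCylinder C).realize (ω r) s, by fun_prop⟩,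
        by
          simp only [Path.source]
          exact Cylinder.realize_base _ _ _ autCylinder_base _ _,
        by
          simp only [Path.target]
          exact Cylinder.realize_base _ _ _ autCylinder_base _ _⟩,
      Path.continuous_uncurry_iff.1 (by
        change Continuous fun q : unitInterval × unitInterval =>
          (autCylinder C).realize (ω q.2) q.1
        fun_prop)⟩,
      Path.ext (_root_.funext fun r =>
        ((autCylinder C).realize_zero (autCylinder_const 0) (ω r)).trans
          ((autCylinder C).realize_one (autCylinder_const 1) (ω r)).symm)⟩
  continuous_toFun := by
    refine Continuous.subtype_mk (ContinuousMap.continuous_of_continuous_uncurry _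
      (Path.continuous_uncurry_iff.1 ?_)) _
    change Continuous fun q : (KSp (AutCat C) × unitInterval) × unitInterval =>
      (autCylinder C).realize (q.1.1 q.2) q.1.2
    fun_prop

lemma coassembly_zero (ω : KSp (AutCat C)) :
    (coassembly C ω).1 0 = KSp.map (AutCat.forget C) AutCat.forget_exact ω :=
  Path.ext (_root_.funext fun r => (autCylinder C).realize_zero (autCylinder_const 0) (ω r))

lemma KSp.map_comp {E : Type (u + 1)} [Category.{u} E] [CofCat E] (F : C ⥤ D)
    (hF : IsExactFunctor F) (G : D ⥤ E) (hG : IsExactFunctor G) (ω : KSp C) :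
    KSp.map G hG (KSp.map F hF ω) = KSp.map (F ⋙ G) (hF.comp hG) ω := by
  ext r
  have h : sDiagMap (F ⋙ G) (hF.comp hG) = sDiagMap F hF ≫ sDiagMap G hG := rfl
  change SSet.toTop.map _ (SSet.toTop.map _ (ω r)) = SSet.toTop.map _ (ω r)
  rw [h, SSet.toTop.map_comp]
  rfl

lemma KSp.map_square {D' E : Type (u + 1)} [Category.{u} D'] [CofCat D'] [Category.{u} E]
    [CofCat E] {F : C ⥤ D} (hF : IsExactFunctor F) {G : D ⥤ E} (hG : IsExactFunctor G)
    {F' : C ⥤ D'} (hF' : IsExactFunctor F') {G' : D' ⥤ E} (hG' : IsExactFunctor G')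
    (h : F ⋙ G = F' ⋙ G') (ω : KSp C) :
    KSp.map G hG (KSp.map F hF ω) = KSp.map G' hG' (KSp.map F' hF' ω) := by
  rw [KSp.map_comp, KSp.map_comp]
  congr 1
  simp only [h]

end KTheory

/-! ### The characteristic polynomial and zeta maps -/

section Main

variable (S : Submonoid A[X]) [MonicCentric S]

/-- `τ(t) : K(End_A^S) → L K(A[t]_S)`, induced by `(P, f) ↦ (P[t]_S, t - f)` and coassembly. -/
def tau : C(KSp (EndS S), FreeLoop (KSp (PMod (Loc S)))) :=
  (coassembly (PMod (Loc S))).comp (KSp.map (tauFunctor S) (tauFunctor_exact S))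

/-- `ζ(t) : K(End_A^S) → L K(A[t]_T)`, induced by `(P, f) ↦ (P[t]_T, (1 - f t)⁻¹)` and
coassembly. -/
def zeta : C(KSp (EndS S), FreeLoop (KSp (PMod (Loc (revSub S))))) :=
  (coassembly (PMod (Loc (revSub S)))).comp (KSp.map (zetaFunctor S) (zetaFunctor_exact S))

/-- The forgetful map `K(End_A^S) → K(A)`. -/
def forgetMap : C(KSp (EndS S), KSp (PMod A)) := KSp.map (EndS.forget S) (EndS.forget_exact S)

/-- `K̃(End_A^S)`, the homotopy fiber of `K(End_A^S) → K(A)`. -/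
abbrev KRed : Type (u + 1) := HoFiber (forgetMap S) (KSp.base (PMod A))

/-- The base point of `K̃(End_A^S)`. -/
def KRed.base : KRed S := HoFiber.base (forgetMap S) (x := KSp.base (EndS S)) (KSp.map_base _ _)

/-- `ΩK(B)`. -/
abbrev LoopK (B : Type u) [Ring B] : Type (u + 1) := LoopSp (KSp.base (PMod B))

lemma tau_zero (ω : KSp (EndS S)) : (tau S ω).1 0 =
    KSp.map (extend (Loc.const S)) (extend_exact _) (forgetMap S ω) := by
  have h1 := coassembly_zero (KSp.map (tauFunctor S) (tauFunctor_exact S) ω)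
  have h2 := KSp.map_square (tauFunctor_exact S) AutCat.forget_exact (EndS.forget_exact S)
    (extend_exact (Loc.const S)) (tauFunctor_forget S) ω
  exact h1.trans h2

lemma zeta_zero (ω : KSp (EndS S)) : (zeta S ω).1 0 =
    KSp.map (extend (Loc.const (revSub S))) (extend_exact _) (forgetMap S ω) := by
  have h1 := coassembly_zero (KSp.map (zetaFunctor S) (zetaFunctor_exact S) ω)
  have h2 := KSp.map_square (zetaFunctor_exact S) AutCat.forget_exact (EndS.forget_exact S)
    (extend_exact (Loc.const (revSub S))) (zetaFunctor_forget S) ω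
  exact h1.trans h2

/-- `τ̃(t) : K̃(End_A^S) → ΩK(A[t]_S)`, the restriction of `τ(t)`. -/
def tauRed : C(KRed S, LoopK (Loc S)) :=
  restrictToFiber (forgetMap S) (KSp.map (extend (Loc.const S)) (extend_exact _)) (tau S)
    (tau_zero S) (KSp.map_base _ _)

/-- `ζ̃(t) : K̃(End_A^S) → ΩK(A[t]_T)`, the restriction of `ζ(t)`. -/
def zetaRed : C(KRed S, LoopK (Loc (revSub S))) :=
  restrictToFiber (forgetMap S) (KSp.map (extend (Loc.const (revSub S))) (extend_exact _)) (zeta S)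
    (zeta_zero S) (KSp.map_base _ _)

/-- The map `ΩK(A[t⁻¹]_T) → ΩK(A[t]_S)` induced by `A[t⁻¹]_T → A[t]_S`. -/
def locLoopK : C(LoopK (Loc (revSub S)), LoopK (Loc S)) :=
  KSp.loop (extend (locMap S)) (extend_exact (locMap S))

/-- `ζ̃(t⁻¹) : K̃(End_A^S) → ΩK(A[t]_S)`. -/
def zetaInvRed : C(KRed S, LoopK (Loc S)) := (locLoopK S).comp (zetaRed S)

end Main

end KTau
end

/-!
The two loops are conjugates, by the path in `K(A)` that belongs to a point `(x, γ)` of the homotopy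
fiber, of the loops in `K(A[t]_S)` given by the automorphisms `t - f` of `P ⊗_A A[t]_S` and
`(1 - f t⁻¹)⁻¹` of `(P ⊗_A A[t⁻¹]_T) ⊗ A[t]_S`.  If `θ` denotes the natural isomorphism between these
two functors, then `(t - f) θ (1 - f t⁻¹)⁻¹ = t θ` (`tauNat_zetaNat`).  So the product of the two
loops is the conjugate by `γ` of the loop given by multiplication by `t`.  This automorphism does not
depend on `f`: it exists on all of `P(A)`, so that its loop can be contracted along `γ`.

Three ingredients make this precise.

* Homotopies have to be manipulated continuously in `(x, γ)`.  Continuous families of paths in a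
  space, parametrized by a pointed space and constant over the base point, form a groupoid up to
  homotopy (`PtMap`, `PathFam`).  A family of squares gives a commutative square in it
  (`PathFam.cls_square`).  The theorem becomes an identity in this groupoid.
* A natural isomorphism `α : F ≅ F'` of exact functors gives a homotopy between the induced maps of
  `K`-theory spaces (`natFam`).  Composition of natural isomorphisms corresponds to concatenation of
  homotopies (`natFam_comp`): a `2`-simplex of natural isomorphisms gives a map on
  `X × Δ[1] × Δ[1]`, realized by applying the realization of simplicial homotopies twice
  (`Cylinder.realizeSq`).  Coassembly is the case of the tautological automorphism
  (`coassembly_map`).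
* For natural isomorphisms `α : G ≅ G'` of functors on `P(A)`, the square `(s, u) ↦ α_u(γ(s))` shows
  that the homotopy given by `α` carries the image of `γ` under `G` to its image under `G'`
  (`redPath_natFam`).  This is applied to `θ` and to the multiplication by `t`.
-/

noncomputable section
namespace KTau

/-! ### Families of paths up to homotopy -/

section PathFamilies

open unitInterval

variable {Z Y : Type*} [TopologicalSpace Z] [TopologicalSpace Y]

/-- The objects of the groupoid of families of paths in `Y` parametrized by the pointed space
`(Z, z₀)`: the based maps from `Z` to `(Y, y₀)`. -/
structure PtMap (z₀ : Z) (y₀ : Y) where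
  /-- the underlying map -/
  map : C(Z, Y)
  map_base : map z₀ = y₀

/-- A continuous family of paths from `a z` to `b z`, constant over the base point.  This is a
based homotopy from `a` to `b`. -/
structure PathFam {z₀ : Z} {y₀ : Y} (a b : PtMap z₀ y₀) where
  /-- the path over a point -/
  path : ∀ z, Path (a.map z) (b.map z)
  continuous : Continuous fun p : Z × I => path p.1 p.2
  base : ∀ s, path z₀ s = y₀

namespace PathFam

variable {z₀ : Z} {y₀ : Y} {a b c d : PtMap z₀ y₀}

/-- The constant paths. -/
def refl (a : PtMap z₀ y₀) : PathFam a a where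
  path _ := Path.refl _
  continuous := a.map.continuous.comp continuous_fst
  base _ := a.map_base

/-- Pointwise concatenation. -/
def trans (p : PathFam a b) (q : PathFam b c) : PathFam a c where
  path z := (p.path z).trans (q.path z)
  continuous := Path.trans_continuous_family _ p.continuous _ q.continuous
  base s := by
    rw [Path.trans_apply]
    split_ifs
    · exact p.base _
    · exact q.base _

/-- Pointwise reversal. -/
def symm (p : PathFam a b) : PathFam b a where
  path z := (p.path z).symm
  continuous := Path.symm_continuous_family _ p.continuous
  base _ := p.base _

/-- Homotopy of families of paths, relative to the end points and to the base point of `Z`.  A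
homotopy is encoded as a family of paths over `Z × [0, 1]`. -/
def Rel (p q : PathFam a b) : Prop :=
  ∃ H : ∀ w : Z × I, Path (a.map w.1) (b.map w.1), Continuous (fun v : (Z × I) × I => H v.1 v.2) ∧
    (∀ z, H (z, 0) = p.path z) ∧ (∀ z, H (z, 1) = q.path z) ∧ ∀ u s, H (z₀, u) s = y₀

/-- Homotopic paths in a parameter space `K` give homotopic families: this is the source of
all homotopies between families. -/
lemma rel_of_homotopic {K : Type*} [TopologicalSpace K] (Φ : C(Z × K, Y))
    (hΦ : ∀ k, Φ (z₀, k) = y₀) {k l : K} {α β : Path k l} (h : α.Homotopic β) {p q : PathFam a b}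
    (hp : ∀ z s, p.path z s = Φ (z, α s)) (hq : ∀ z s, q.path z s = Φ (z, β s)) : Rel p q := by
  obtain ⟨F⟩ := h
  have hk : ∀ z, Φ (z, k) = a.map z := fun z => by
    rw [← (p.path z).source, hp, α.source]
  have hl : ∀ z, Φ (z, l) = b.map z := fun z => by
    rw [← (p.path z).target, hp, α.target]
  refine ⟨fun w => ⟨⟨fun s => Φ (w.1, F (w.2, s)), by fun_prop⟩, ?_, ?_⟩, ?_, fun z => ?_,
    fun z => ?_, fun u s => hΦ _⟩
  · exact (congrArg (fun x => Φ (w.1, x)) (F.source _)).trans (hk _)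
  · exact (congrArg (fun x => Φ (w.1, x)) (F.target _)).trans (hl _)
  · change Continuous fun v : (Z × I) × I => Φ (v.1.1, F (v.1.2, v.2))
    fun_prop
  · ext s
    exact (congrArg (fun x => Φ (z, x)) (F.apply_zero s)).trans (hp z s).symm
  · ext s
    exact (congrArg (fun x => Φ (z, x)) (F.apply_one s)).trans (hq z s).symm

instance : ContractibleSpace I :=
  (convex_Icc (0 : ℝ) 1).contractibleSpace ⟨0, by simp⟩

/-- The identity of the interval as a path. -/
def idPath : Path (0 : I) 1 := ⟨ContinuousMap.id _, rfl, rfl⟩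

/-- Two reparametrizations of a family are homotopic. -/
lemma rel_reparam {a' b' : PtMap z₀ y₀} (r : PathFam a' b') {k l : I} (α β : Path k l)
    {p q : PathFam a b}
    (hp : ∀ z s, p.path z s = r.path z (α s)) (hq : ∀ z s, q.path z s = r.path z (β s)) :
    Rel p q :=
  rel_of_homotopic ⟨_, r.continuous⟩ r.base (SimplyConnectedSpace.paths_homotopic α β) hp hq

lemma Rel.refl (p : PathFam a b) : Rel p p :=
  rel_reparam p idPath idPath (fun _ _ => rfl) fun _ _ => rfl

lemma Rel.symm {p q : PathFam a b} (h : Rel p q) : Rel q p := by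
  obtain ⟨H, hc, h0, h1, hb⟩ := h
  refine ⟨fun w => H (w.1, σ w.2), ?_, fun z => ?_, fun z => ?_, fun u s => hb _ _⟩
  · exact hc.comp (f := fun v : (Z × I) × I => (((v.1.1, σ v.1.2), v.2) : (Z × I) × I))
      (by fun_prop)
  · have h : H (z, σ 0) = H (z, 1) := by rw [unitInterval.symm_zero]
    exact h.trans (h1 z)
  · have h : H (z, σ 1) = H (z, 0) := by rw [unitInterval.symm_one]
    exact h.trans (h0 z)

lemma Rel.trans {p q r : PathFam a b} (h : Rel p q) (h' : Rel q r) : Rel p r := by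
  obtain ⟨H, hc, h0, h1, hb⟩ := h
  obtain ⟨H', hc', h0', h1', hb'⟩ := h'
  -- the homotopies are concatenated as families of paths in the direction of the homotopies
  let K : ∀ w : Z × I, Path (p.path w.1 w.2) (q.path w.1 w.2) := fun w =>
    ⟨⟨fun u => H (w.1, u) w.2, hc.comp (f := fun u : I => (((w.1, u), w.2) : (Z × I) × I))
      (by fun_prop)⟩, DFunLike.congr_fun (h0 w.1) w.2,
      DFunLike.congr_fun (h1 w.1) w.2⟩
  let K' : ∀ w : Z × I, Path (q.path w.1 w.2) (r.path w.1 w.2) := fun w =>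
    ⟨⟨fun u => H' (w.1, u) w.2, hc'.comp (f := fun u : I => (((w.1, u), w.2) : (Z × I) × I))
      (by fun_prop)⟩, DFunLike.congr_fun (h0' w.1) w.2,
      DFunLike.congr_fun (h1' w.1) w.2⟩
  have hK : Continuous fun v : (Z × I) × I => K v.1 v.2 :=
    hc.comp (f := fun v : (Z × I) × I => (((v.1.1, v.2), v.1.2) : (Z × I) × I)) (by fun_prop)
  have hK' : Continuous fun v : (Z × I) × I => K' v.1 v.2 :=
    hc'.comp (f := fun v : (Z × I) × I => (((v.1.1, v.2), v.1.2) : (Z × I) × I)) (by fun_prop)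
  have hKK : Continuous fun v : (Z × I) × I => ((K v.1).trans (K' v.1)) v.2 :=
    Path.trans_continuous_family K hK K' hK'
  refine ⟨fun w => ⟨⟨fun s => (K (w.1, s)).trans (K' (w.1, s)) w.2,
    hKK.comp (f := fun s : I => (((w.1, s), w.2) : (Z × I) × I)) (by fun_prop)⟩, ?_, ?_⟩,
    ?_, fun z => ?_, fun z => ?_, fun u s => ?_⟩
  · refine (Path.trans_apply _ _ _).trans ?_
    split_ifs
    · exact (H _).source
    · exact (H' _).source
  · refine (Path.trans_apply _ _ _).trans ?_
    split_ifs
    · exact (H _).target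
    · exact (H' _).target
  · exact hKK.comp (f := fun v : (Z × I) × I => (((v.1.1, v.2), v.1.2) : (Z × I) × I))
      (by fun_prop)
  · ext s
    exact ((K (z, s)).trans (K' (z, s))).source
  · ext s
    exact ((K (z, s)).trans (K' (z, s))).target
  · refine (Path.trans_apply _ _ _).trans ?_
    split_ifs
    · exact hb _ _
    · exact hb' _ _

lemma Rel.comp {p p' : PathFam a b} {q q' : PathFam b c} (h : Rel p p') (h' : Rel q q') :
    Rel (p.trans q) (p'.trans q') := by
  obtain ⟨H, hc, h0, h1, hb⟩ := h
  obtain ⟨H', hc', h0', h1', hb'⟩ := h'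
  refine ⟨fun w => (H w).trans (H' w), Path.trans_continuous_family _ hc _ hc', fun z => ?_,
    fun z => ?_, fun u s => ?_⟩
  · exact congrArg₂ Path.trans (h0 z) (h0' z)
  · exact congrArg₂ Path.trans (h1 z) (h1' z)
  · rw [Path.trans_apply]
    split_ifs
    · exact hb _ _
    · exact hb' _ _

lemma Rel.reverse {p p' : PathFam a b} (h : Rel p p') : Rel p.symm p'.symm := by
  obtain ⟨H, hc, h0, h1, hb⟩ := h
  refine ⟨fun w => (H w).symm, Path.symm_continuous_family _ hc, fun z => ?_, fun z => ?_,
    fun u s => hb _ _⟩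
  · exact congrArg Path.symm (h0 z)
  · exact congrArg Path.symm (h1 z)

lemma refl_trans_rel (p : PathFam a b) : Rel ((refl a).trans p) p :=
  rel_reparam p ((Path.refl 0).trans idPath) idPath (fun z s => by
    refine (Path.trans_apply _ _ _).trans ?_
    rw [Path.trans_apply]
    split_ifs
    · exact (p.path z).source.symm
    · rfl) fun _ _ => rfl

lemma trans_refl_rel (p : PathFam a b) : Rel (p.trans (refl b)) p :=
  rel_reparam p (idPath.trans (Path.refl 1)) idPath (fun z s => by
    refine (Path.trans_apply _ _ _).trans ?_
    rw [Path.trans_apply]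
    split_ifs
    · rfl
    · exact (p.path z).target.symm) fun _ _ => rfl

lemma trans_symm_rel (p : PathFam a b) : Rel (p.trans p.symm) (refl a) :=
  rel_reparam p (idPath.trans idPath.symm) (Path.refl 0) (fun z s => by
    refine (Path.trans_apply _ _ _).trans ?_
    rw [Path.trans_apply]
    split_ifs <;> rfl) fun z _ => (p.path z).source.symm

lemma symm_trans_rel (p : PathFam a b) : Rel (p.symm.trans p) (refl b) :=
  rel_reparam p (idPath.symm.trans idPath) (Path.refl 1) (fun z s => by
    refine (Path.trans_apply _ _ _).trans ?_
    rw [Path.trans_apply]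
    split_ifs <;> rfl) fun z _ => (p.path z).target.symm

lemma trans_assoc_rel (p : PathFam a b) (q : PathFam b c) (r : PathFam c d) :
    Rel ((p.trans q).trans r) (p.trans (q.trans r)) :=
  rel_reparam (p.trans (q.trans r))
    ⟨⟨fun t => ⟨Path.Homotopy.transAssocReparamAux t, Path.Homotopy.transAssocReparamAux_mem_I t⟩,
      by fun_prop⟩, Subtype.ext Path.Homotopy.transAssocReparamAux_zero,
      Subtype.ext Path.Homotopy.transAssocReparamAux_one⟩ idPath
    (fun z s => DFunLike.congr_fun (Path.Homotopy.trans_assoc_reparam (p.path z) (q.path z)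
      (r.path z)) s) fun _ _ => rfl

/-- Homotopy of families of paths as an equivalence relation. -/
instance setoid (a b : PtMap z₀ y₀) : Setoid (PathFam a b) :=
  ⟨Rel, Rel.refl, Rel.symm, Rel.trans⟩

end PathFam

/-- The groupoid of based maps `Z → Y` and homotopy classes of based homotopies. -/
instance {z₀ : Z} {y₀ : Y} : Groupoid (PtMap z₀ y₀) where
  Hom a b := Quotient (PathFam.setoid a b)
  id a := ⟦PathFam.refl a⟧
  comp p q := Quotient.map₂ PathFam.trans (fun _ _ h _ _ h' => PathFam.Rel.comp h h') p q
  inv p := Quotient.map PathFam.symm (fun _ _ h => PathFam.Rel.reverse h) p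
  id_comp p := Quotient.inductionOn p fun p => Quotient.sound (PathFam.refl_trans_rel p)
  comp_id p := Quotient.inductionOn p fun p => Quotient.sound (PathFam.trans_refl_rel p)
  assoc p q r := Quotient.inductionOn₃ p q r fun p q r =>
    Quotient.sound (PathFam.trans_assoc_rel p q r)
  inv_comp p := Quotient.inductionOn p fun p => Quotient.sound (PathFam.symm_trans_rel p)
  comp_inv p := Quotient.inductionOn p fun p => Quotient.sound (PathFam.trans_symm_rel p)

namespace PathFam

variable {z₀ : Z} {y₀ : Y} {a b c d : PtMap z₀ y₀}

/-- The homotopy class of a family of paths. -/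
def cls (p : PathFam a b) : a ⟶ b := Quotient.mk (PathFam.setoid a b) p

lemma cls_trans (p : PathFam a b) (q : PathFam b c) : (p.trans q).cls = p.cls ≫ q.cls := rfl

lemma cls_refl (a : PtMap z₀ y₀) : (refl a).cls = 𝟙 a := rfl

lemma ext_cls {p q : PathFam a b} (h : ∀ z s, p.path z s = q.path z s) : p.cls = q.cls :=
  Quotient.sound (rel_reparam q idPath idPath h fun _ _ => rfl)

lemma rel_of_cls {p q : PathFam a b} (h : p.cls = q.cls) : Rel p q := Quotient.exact h

/-- A family of squares is a commutative square of families of paths. -/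
lemma cls_square (Φ : C(Z × (I × I), Y)) (hΦ : ∀ k, Φ (z₀, k) = y₀) (p : PathFam a b)
    (q : PathFam b d) (p' : PathFam a c) (q' : PathFam c d)
    (hp : ∀ z s, p.path z s = Φ (z, (s, 0))) (hq : ∀ z s, q.path z s = Φ (z, (1, s)))
    (hp' : ∀ z s, p'.path z s = Φ (z, (0, s))) (hq' : ∀ z s, q'.path z s = Φ (z, (s, 1))) :
    p.cls ≫ q.cls = p'.cls ≫ q'.cls := by
  refine Quotient.sound (rel_of_homotopic Φ hΦ (SimplyConnectedSpace.paths_homotopic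
    ((idPath.prod (Path.refl 0)).trans ((Path.refl 1).prod idPath))
    (((Path.refl 0).prod idPath).trans (idPath.prod (Path.refl 1)))) (fun z s => ?_) fun z s => ?_)
  · refine (Path.trans_apply _ _ _).trans ?_
    rw [Path.trans_apply]
    split_ifs
    · exact hp _ _
    · exact hq _ _
  · refine (Path.trans_apply _ _ _).trans ?_
    rw [Path.trans_apply]
    split_ifs
    · exact hp' _ _
    · exact hq' _ _

/-- A family of loops at the base point, as a map to the loop space. -/
def toLoop {a : PtMap z₀ y₀} (ha : ∀ z, a.map z = y₀) (p : PathFam a a) : C(Z, LoopSp y₀) where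
  toFun z := (p.path z).cast (ha z).symm (ha z).symm
  continuous_toFun := Path.continuous_uncurry_iff.1 p.continuous

/-- Families of loops in the same class give based homotopic maps to the loop space. -/
lemma homotopicRel_of_cls_eq {a : PtMap z₀ y₀} (ha : ∀ z, a.map z = y₀) {p q : PathFam a a}
    (h : p.cls = q.cls) : (p.toLoop ha).HomotopicRel (q.toLoop ha) {z₀} := by
  obtain ⟨H, hc, h0, h1, hb⟩ := rel_of_cls h
  refine ⟨⟨⟨⟨fun v => (H (v.2, v.1)).cast (ha _).symm (ha _).symm, ?_⟩, fun z => ?_, fun z => ?_⟩,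
    ?_⟩⟩
  · refine Path.continuous_uncurry_iff.1 ?_
    exact hc.comp (f := fun v : (I × Z) × I => (((v.1.2, v.1.1), v.2) : (Z × I) × I))
      (by fun_prop)
  · ext s
    exact DFunLike.congr_fun (h0 z) s
  · ext s
    exact DFunLike.congr_fun (h1 z) s
  · rintro t z rfl
    ext s
    exact (hb t s).trans (p.base s).symm

end PathFam

end PathFamilies

/-! ### Operations on simplicial homotopies -/

section CylinderOperations

universe v

open Simplicial

namespace Cylinder

variable {W X Y : SSet.{v}}

lemma ext_h {H H' : Cylinder X Y} (h : ∀ n x r, H.h n x r = H'.h n x r) : H = H' := by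
  obtain ⟨k, _⟩ := H
  obtain ⟨k', _⟩ := H'
  obtain rfl : k = k' :=
    _root_.funext fun n => _root_.funext fun x => _root_.funext fun r => h n x r
  rfl

/-- A simplicial homotopy followed by a simplicial map. -/
def post (H : Cylinder X Y) (g : Y ⟶ W) : Cylinder X W where
  h n x r := g.app _ (H.h n x r)
  nat m n θ x r := by
    rw [H.nat]
    exact ConcreteCategory.congr_hom (g.naturality (SimplexCategory.mkHom θ).op) _

/-- A simplicial homotopy preceded by a simplicial map. -/
def pre (f : W ⟶ X) (H : Cylinder X Y) : Cylinder W Y where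
  h n x r := H.h n (f.app _ x) r
  nat m n θ x r := by
    rw [← H.nat]
    exact congrArg (fun y => H.h m y _)
      (ConcreteCategory.congr_hom (f.naturality (SimplexCategory.mkHom θ).op) _)

/-- Every point of `|X| × [0, 1]` over a simplex lies on a chain of the prism, and there the
realization of a homotopy is given by its value on one simplex. -/
lemma exists_realize_eq {n : ℕ} (x : X.obj (.op ⦋n⦌)) (w : TopΔ n) (s : unitInterval) :
    ∃ (m : ℕ) (q : Fin (m + 1) →o Fin (n + 1)) (r : Fin (m + 1) →o Fin (1 + 1)) (w₀ : TopΔ m),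
      w = stdSimplex.map q w₀ ∧ ∀ (Y : SSet.{v}) (H : Cylinder X Y),
        H.realize (rpt x w) s = rpt (H.h m (sact X q x) r) w₀ := by
  obtain ⟨m, q, r, w₀, h⟩ := PrismData.exists_chain (w, stdSimplexHomeomorphUnitInterval.symm s)
  refine ⟨m, q, r, w₀, congrArg Prod.fst h, fun Y H => ?_⟩
  rw [realize_rpt, h, PrismData.glue_apply]
  rfl

lemma realize_post (H : Cylinder X Y) (g : Y ⟶ W) (y : Rlz X) (s : unitInterval) :
    SSet.toTop.map g (H.realize y s) = (H.post g).realize y s := by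
  have : (ContinuousMap.mk (fun y => SSet.toTop.map g (H.realize y s)) (by fun_prop) :
      C(Rlz X, Rlz W)) = ⟨fun y => (H.post g).realize y s, by fun_prop⟩ :=
    real_ext fun n x w => by
      obtain ⟨m, q, r, w₀, -, h⟩ := exists_realize_eq x w s
      refine (congrArg (SSet.toTop.map g) (h _ H)).trans ((rpt_nat _ _ _).trans ?_)
      exact (h _ (H.post g)).symm
  exact DFunLike.congr_fun this y

lemma realize_pre (f : W ⟶ X) (H : Cylinder X Y) (y : Rlz W) (s : unitInterval) :
    H.realize (SSet.toTop.map f y) s = (H.pre f).realize y s := by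
  have : (ContinuousMap.mk (fun y => H.realize (SSet.toTop.map f y) s) (by fun_prop) :
      C(Rlz W, Rlz Y)) = ⟨fun y => (H.pre f).realize y s, by fun_prop⟩ :=
    real_ext fun n x w => by
      change H.realize (SSet.toTop.map f (rpt x w)) s = (H.pre f).realize (rpt x w) s
      rw [rpt_nat, realize_rpt, realize_rpt]
      obtain ⟨m, q, r, w₀, h⟩ :=
        PrismData.exists_chain (w, stdSimplexHomeomorphUnitInterval.symm s)
      rw [h, PrismData.glue_apply, PrismData.glue_apply]
      exact congrArg (fun z => rpt (H.h m z r) w₀)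
        (ConcreteCategory.congr_hom (f.naturality (SimplexCategory.mkHom q).op) x).symm
  exact DFunLike.congr_fun this y

/-- A constant simplicial homotopy has constant realization. -/
lemma realize_of_const (H : Cylinder X Y) (f : X ⟶ Y) (hf : ∀ n x r, H.h n x r = f.app _ x)
    (y : Rlz X) (s : unitInterval) : H.realize y s = SSet.toTop.map f y := by
  have : (ContinuousMap.mk (fun y => H.realize y s) (by fun_prop) : C(Rlz X, Rlz Y)) =
      (SSet.toTop.map f).hom := real_ext fun n x w => by
    obtain ⟨m, q, r, w₀, hw, h⟩ := exists_realize_eq x w s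
    refine (h _ H).trans (Eq.trans ?_ (rpt_nat f x w).symm)
    rw [hf, hw, ← rpt_map]
    exact congrArg (fun z => rpt z w₀)
      (ConcreteCategory.congr_hom (f.naturality (SimplexCategory.mkHom q).op) x)
  exact DFunLike.congr_fun this y

end Cylinder

/-- The product `X × Δ[1]`. -/
def cylObj (X : SSet.{v}) : SSet.{v} where
  obj n := X.obj n × (Fin (n.unop.len + 1) →o Fin (1 + 1))
  map θ := TypeCat.ofHom fun p => (X.map θ p.1, p.2.comp θ.unop.toOrderHom)
  map_id n := by
    ext p
    · simp
    · rfl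
  map_comp f g := by
    ext p
    · simp
    · rfl

/-- The tautological simplicial homotopy.  Its realization is a map
`|X| × [0, 1] → |X × Δ[1]|`; applying it before the realization of a homotopy on `X × Δ[1]` gives
maps on `|X| × [0, 1] × [0, 1]`. -/
def univCyl (X : SSet.{v}) : Cylinder X (cylObj X) where
  h _ x r := (x, r)
  nat _ _ _ _ _ := rfl

/-- The inclusion of an end of the cylinder. -/
def cylEnd (X : SSet.{v}) (i : Fin (1 + 1)) : X ⟶ cylObj X where
  app _ := TypeCat.ofHom fun x => (x, OrderHom.const _ i)
  naturality _ _ _ := rfl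

namespace Cylinder

variable {X Y : SSet.{v}}

/-- The map on `X × Δ[1]` at an end of a homotopy on it. -/
def endMap (H : Cylinder X Y) (i : Fin (1 + 1)) : X ⟶ Y where
  app n := TypeCat.ofHom fun x => H.h n.unop.len x (OrderHom.const _ i)
  naturality n m θ := by
    ext x
    exact H.nat m.unop.len n.unop.len θ.unop.toOrderHom x (OrderHom.const _ i)

lemma realize_endMap_zero (H : Cylinder X Y) (y : Rlz X) :
    H.realize y 0 = SSet.toTop.map (H.endMap 0) y := H.realize_zero (fun _ _ => rfl) y

lemma realize_endMap_one (H : Cylinder X Y) (y : Rlz X) :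
    H.realize y 1 = SSet.toTop.map (H.endMap 1) y := H.realize_one (fun _ _ => rfl) y

/-- The realization of a homotopy of homotopies. -/
def realizeSq (H : Cylinder (cylObj X) Y) : C(Rlz X × (unitInterval × unitInterval), Rlz Y) where
  toFun p := H.realize ((univCyl X).realize p.1 p.2.1) p.2.2

lemma realizeSq_zero_left (H : Cylinder (cylObj X) Y) (y : Rlz X) (s : unitInterval) :
    H.realizeSq (y, (0, s)) = (H.pre (cylEnd X 0)).realize y s := by
  rw [← realize_pre]
  exact congrArg (fun z => H.realize z s) ((univCyl X).realize_zero (fun _ _ => rfl) y)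

lemma realizeSq_one_left (H : Cylinder (cylObj X) Y) (y : Rlz X) (s : unitInterval) :
    H.realizeSq (y, (1, s)) = (H.pre (cylEnd X 1)).realize y s := by
  rw [← realize_pre]
  exact congrArg (fun z => H.realize z s) ((univCyl X).realize_one (fun _ _ => rfl) y)

lemma realizeSq_zero_right (H : Cylinder (cylObj X) Y) (y : Rlz X) (s : unitInterval) :
    H.realizeSq (y, (s, 0)) = ((univCyl X).post (H.endMap 0)).realize y s := by
  rw [← realize_post]
  exact H.realize_endMap_zero _

lemma realizeSq_one_right (H : Cylinder (cylObj X) Y) (y : Rlz X) (s : unitInterval) :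
    H.realizeSq (y, (s, 1)) = ((univCyl X).post (H.endMap 1)).realize y s := by
  rw [← realize_post]
  exact H.realize_endMap_one _

lemma realizeSq_base (H : Cylinder (cylObj X) Y) (x : X.obj (.op ⦋0⦌)) (y : Y.obj (.op ⦋0⦌))
    (hxy : ∀ (n : ℕ) (r r' : Fin (n + 1) →o Fin (1 + 1)),
      H.h n (sact X (OrderHom.const _ 0) x, r) r' = sact Y (OrderHom.const _ 0) y) (w : TopΔ 0)
    (k : unitInterval × unitInterval) : H.realizeSq (rpt x w, k) = rpt y w := by
  have h0 : ∀ (n : ℕ) (q : Fin (n + 1) →o Fin (0 + 1)), q = OrderHom.const _ 0 := fun n q =>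
    OrderHom.ext _ _ (_root_.funext fun i => Subsingleton.elim (α := Fin 1) _ _)
  obtain ⟨m, q, r, w₀, -, h⟩ := exists_realize_eq x w k.1
  refine (congrArg (fun z => H.realize z k.2) (h _ (univCyl X))).trans ?_
  obtain ⟨m', q', r', w₁, -, h'⟩ := exists_realize_eq ((univCyl X).h m (sact X q x) r) w₀ k.2
  refine (h' _ H).trans ?_
  have h1 : sact (cylObj X) q' ((univCyl X).h m (sact X q x) r) =
      (sact X (OrderHom.const _ 0) x, r.comp q') := by
    rw [← h0 _ (q.comp q'), sact_comp]
    rfl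
  rw [h1, hxy, rpt_map]
  exact congrArg _ (Subsingleton.elim (α := stdSimplex ℝ (Fin 1)) _ _)

end Cylinder

end CylinderOperations

/-! ### Simplicial homotopies from natural isomorphisms -/

section NaturalIsomorphisms

open Simplicial

variable {C D E : Type (u + 1)} [Category.{u} C] [Category.{u} D] [Category.{u} E]

/-- The diagram `(k, a) ↦ Ψ(κ k)(G(k, a))` given by a diagram `G`, functors `Ψ(i)` that are
indexed by a preorder, and a chain `κ` of that preorder. -/
def chainDiagram {K : Type} [Preorder K] (Ψ : K ⥤ (C ⥤ D)) {n : ℕ} (G : SIndex n ⥤ C)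
    (κ : Fin (n + 1) →o K) : SIndex n ⥤ D where
  obj x := (Ψ.obj (κ x.1)).obj (G.obj x)
  map {x y} a := (Ψ.map (homOfLE (κ.monotone (leOfHom a.1)))).app (G.obj x) ≫
    (Ψ.obj (κ y.1)).map (G.map a)
  map_id x := by
    have : homOfLE (κ.monotone (leOfHom (𝟙 x : x ⟶ x).1)) = 𝟙 (κ x.1) := rfl
    rw [this]
    simp
  map_comp {x y z} a b := by
    have : homOfLE (κ.monotone (leOfHom (a ≫ b).1)) =
      homOfLE (κ.monotone (leOfHom a.1)) ≫ homOfLE (κ.monotone (leOfHom b.1)) := rfl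
    rw [this]
    simp only [Functor.map_comp, NatTrans.comp_app, Category.assoc, NatTrans.naturality_assoc]

/-- The chain `κ` only enters the first factor of `[n] × Ar[n]`: over a fixed element `k`, the
diagram is the image of `G` under the functor `Ψ(κ k)`. -/
lemma chainDiagram_map_id_left {K : Type} [Preorder K] (Ψ : K ⥤ (C ⥤ D)) {n : ℕ} (G : SIndex n ⥤ C)
    (κ : Fin (n + 1) →o K) (k : Fin (n + 1)) {a b : Arrow (Fin (n + 1))} (f : a ⟶ b) :
    (chainDiagram Ψ G κ).map ((𝟙 k, f) : (k, a) ⟶ (k, b)) =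
      (Ψ.obj (κ k)).map (G.map ((𝟙 k, f) : (k, a) ⟶ (k, b))) := by
  have : homOfLE (κ.monotone (leOfHom (𝟙 k))) = 𝟙 (κ k) := rfl
  change (Ψ.map (homOfLE (κ.monotone (leOfHom (𝟙 k))))).app _ ≫ _ = _
  rw [this, CategoryTheory.Functor.map_id, NatTrans.id_app]
  exact Category.id_comp _

lemma chainDiagram_const {K : Type} [Preorder K] (Ψ : K ⥤ (C ⥤ D)) {n : ℕ} (G : SIndex n ⥤ C)
    (i : K) : chainDiagram Ψ G (OrderHom.const _ i) = G ⋙ Ψ.obj i :=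
  CategoryTheory.Functor.ext (fun _ => rfl) fun x y a => by
    refine Eq.trans (congrArg (fun t : Ψ.obj i ⟶ Ψ.obj i => t.app (G.obj x) ≫
      (Ψ.obj i).map (G.map a)) (Ψ.map_id i)) ?_
    exact (Category.comp_id _).symm.trans (Category.assoc _ _ _)

lemma chainDiagram_mk₁_id (F : C ⥤ D) {n : ℕ} (G : SIndex n ⥤ C)
    (κ : Fin (n + 1) →o Fin (1 + 1)) :
    chainDiagram (ComposableArrows.mk₁ (𝟙 F)) G κ = G ⋙ F := by
  have e : ComposableArrows.mk₁ (𝟙 F) = (Functor.const _).obj F :=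
    ComposableArrows.ext₁ rfl rfl ((Category.id_comp _).trans (Category.comp_id _)).symm
  rw [e]
  refine CategoryTheory.Functor.ext (fun _ => rfl) fun x y a => ?_
  exact (Category.comp_id _).symm.trans (Category.assoc _ _ _)

variable [CofCat C] [CofCat D] [CofCat E]

/-- A diagram of exact functors and natural isomorphisms. -/
structure IsExactChain {K : Type} [Preorder K] (Ψ : K ⥤ (C ⥤ D)) : Prop where
  exact : ∀ k, IsExactFunctor (Ψ.obj k)
  iso : ∀ {k l : K} (h : k ⟶ l), IsIso (Ψ.map h)

lemma chainDiagram_isSDiagram {K : Type} [Preorder K] {Ψ : K ⥤ (C ⥤ D)} (hΨ : IsExactChain Ψ)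
    {n : ℕ} {G : SIndex n ⥤ C} (hG : IsSDiagram G) (κ : Fin (n + 1) →o K) :
    IsSDiagram (chainDiagram Ψ G κ) where
  pt k i := (congrArg (Ψ.obj (κ k)).obj (hG.pt k i)).trans (hΨ.exact _).map_pt
  cofSeq k _ _ _ a b :=
    cofSeq_congr (chainDiagram_map_id_left Ψ G κ k _) (chainDiagram_map_id_left Ψ G κ k _)
      ((hΨ.exact _).map_cofSeq _ _ (hG.cofSeq k a b))
  iso {k k'} h a := by
    have := hG.iso h a
    have := hΨ.iso (homOfLE (κ.monotone (leOfHom h)))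
    exact inferInstanceAs (IsIso ((Ψ.map (homOfLE (κ.monotone (leOfHom h)))).app _ ≫
      (Ψ.obj (κ k')).map (G.map ((h, 𝟙 a) : (k, a) ⟶ (k', a)))))

lemma chainDiagram_base {K : Type} [Preorder K] {Ψ : K ⥤ (C ⥤ D)} (hΨ : IsExactChain Ψ)
    {m n : ℕ} (θ : Fin (n + 1) →o Fin (m + 1)) (κ : Fin (n + 1) →o K) :
    chainDiagram Ψ (SIndex.map θ ⋙ zeroDiagram (C := C) m) κ =
      SIndex.map θ ⋙ zeroDiagram (C := D) m :=
  diagram_ext_zero (fun _ => (hΨ.exact _).map_pt) fun _ => CofCat.isZero_pt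

/-- The simplicial homotopy given by two functors and a natural isomorphism, in the form of a
functor from `{0 < 1}`. -/
def chainCyl {Ψ : Fin (1 + 1) ⥤ (C ⥤ D)} (hΨ : IsExactChain Ψ) :
    Cylinder (sDiag C) (sDiag D) where
  h _ G r := ⟨chainDiagram Ψ G.1 r, chainDiagram_isSDiagram hΨ G.2 r⟩
  nat _ _ _ _ _ := rfl

/-- The simplicial homotopy of homotopies given by a diagram of natural isomorphisms and a
square `f` in its shape. -/
def chainSq {K : Type} [Preorder K] {Ψ : K ⥤ (C ⥤ D)} (hΨ : IsExactChain Ψ)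
    (f : Fin (1 + 1) × Fin (1 + 1) →o K) : Cylinder (cylObj (sDiag C)) (sDiag D) where
  h _ G r := ⟨chainDiagram Ψ G.1.1 (f.comp (G.2.prod r)), chainDiagram_isSDiagram hΨ G.1.2 _⟩
  nat _ _ _ _ _ := rfl

end NaturalIsomorphisms

section Loops

open Simplicial

variable {C D E : Type (u + 1)} [Category.{u} C] [Category.{u} D] [Category.{u} E]
  [CofCat C] [CofCat D] [CofCat E]

lemma chainCyl_base {Ψ : Fin (1 + 1) ⥤ (C ⥤ D)} (hΨ : IsExactChain Ψ) (n : ℕ)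
    (r : Fin (n + 1) →o Fin (1 + 1)) :
    (chainCyl hΨ).h n (sact _ (OrderHom.const _ 0) (sBase C)) r =
      sact _ (OrderHom.const _ 0) (sBase D) :=
  Subtype.ext (chainDiagram_base hΨ _ r)

lemma chainSq_base {K : Type} [Preorder K] {Ψ : K ⥤ (C ⥤ D)} (hΨ : IsExactChain Ψ)
    (f : Fin (1 + 1) × Fin (1 + 1) →o K) (n : ℕ) (r r' : Fin (n + 1) →o Fin (1 + 1)) :
    (chainSq hΨ f).h n (sact _ (OrderHom.const _ 0) (sBase C), r) r' =
      sact _ (OrderHom.const _ 0) (sBase D) :=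
  Subtype.ext (chainDiagram_base hΨ _ _)

/-- The map `K(C) × [0, 1] → K(D)` given by a natural isomorphism of exact functors. -/
def chainLoop {Ψ : Fin (1 + 1) ⥤ (C ⥤ D)} (hΨ : IsExactChain Ψ) :
    C(KSp C × unitInterval, KSp D) where
  toFun p := ⟨⟨fun r => (chainCyl hΨ).realize (p.1 r) p.2, by fun_prop⟩,
    by
      simp only [Path.source]
      exact Cylinder.realize_base _ _ _ (chainCyl_base hΨ) _ _,
    by
      simp only [Path.target]
      exact Cylinder.realize_base _ _ _ (chainCyl_base hΨ) _ _⟩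
  continuous_toFun := Path.continuous_uncurry_iff.1 (by
    change Continuous fun q : (KSp C × unitInterval) × unitInterval =>
      (chainCyl hΨ).realize (q.1.1 q.2) q.1.2
    fun_prop)

lemma chainLoop_base {Ψ : Fin (1 + 1) ⥤ (C ⥤ D)} (hΨ : IsExactChain Ψ) (s : unitInterval) :
    chainLoop hΨ (KSp.base C, s) = KSp.base D :=
  Path.ext (_root_.funext fun _ => Cylinder.realize_base _ _ _ (chainCyl_base hΨ) _ _)

lemma chainLoop_zero {Ψ : Fin (1 + 1) ⥤ (C ⥤ D)} (hΨ : IsExactChain Ψ) (ω : KSp C) :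
    chainLoop hΨ (ω, 0) = KSp.map (Ψ.obj 0) (hΨ.exact 0) ω :=
  Path.ext (_root_.funext fun r => (chainCyl hΨ).realize_zero (f := sDiagMap (Ψ.obj 0) (hΨ.exact 0))
    (fun _ G => Subtype.ext (chainDiagram_const Ψ G.1 0)) (ω r))

lemma chainLoop_one {Ψ : Fin (1 + 1) ⥤ (C ⥤ D)} (hΨ : IsExactChain Ψ) (ω : KSp C) :
    chainLoop hΨ (ω, 1) = KSp.map (Ψ.obj 1) (hΨ.exact 1) ω :=
  Path.ext (_root_.funext fun r => (chainCyl hΨ).realize_one (f := sDiagMap (Ψ.obj 1) (hΨ.exact 1))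
    (fun _ G => Subtype.ext (chainDiagram_const Ψ G.1 1)) (ω r))

/-- The map `K(C) × [0, 1] × [0, 1] → K(D)` given by a square of natural isomorphisms. -/
def chainSqLoop {K : Type} [Preorder K] {Ψ : K ⥤ (C ⥤ D)} (hΨ : IsExactChain Ψ)
    (f : Fin (1 + 1) × Fin (1 + 1) →o K) : C(KSp C × (unitInterval × unitInterval), KSp D) where
  toFun p := ⟨⟨fun r => (chainSq hΨ f).realizeSq (p.1 r, p.2), by fun_prop⟩,
    by
      simp only [Path.source]
      exact Cylinder.realizeSq_base _ _ _ (chainSq_base hΨ f) _ _,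
    by
      simp only [Path.target]
      exact Cylinder.realizeSq_base _ _ _ (chainSq_base hΨ f) _ _⟩
  continuous_toFun := Path.continuous_uncurry_iff.1 (by
    change Continuous fun q : (KSp C × (unitInterval × unitInterval)) × unitInterval =>
      (chainSq hΨ f).realizeSq (q.1.1 q.2, q.1.2)
    fun_prop)

lemma chainSqLoop_base {K : Type} [Preorder K] {Ψ : K ⥤ (C ⥤ D)} (hΨ : IsExactChain Ψ)
    (f : Fin (1 + 1) × Fin (1 + 1) →o K) (k : unitInterval × unitInterval) :
    chainSqLoop hΨ f (KSp.base C, k) = KSp.base D :=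
  Path.ext (_root_.funext fun _ => Cylinder.realizeSq_base _ _ _ (chainSq_base hΨ f) _ _)

variable {K : Type} [Preorder K] {Ψ : K ⥤ (C ⥤ D)} (hΨ : IsExactChain Ψ)
  (f : Fin (1 + 1) × Fin (1 + 1) →o K) {Ψ' : Fin (1 + 1) ⥤ (C ⥤ D)} (hΨ' : IsExactChain Ψ')

/-- The horizontal sides of a square. -/
def squareRow (i : Fin (1 + 1)) : Fin (1 + 1) →o K := f.comp (OrderHom.id.prod (OrderHom.const _ i))

/-- The vertical sides of a square. -/
def squareCol (i : Fin (1 + 1)) : Fin (1 + 1) →o K := f.comp ((OrderHom.const _ i).prod OrderHom.id)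

lemma chainSqLoop_zero_right (e : (squareRow f 0).monotone.functor ⋙ Ψ = Ψ') (ω : KSp C)
    (s : unitInterval) : chainSqLoop hΨ f (ω, (s, 0)) = chainLoop hΨ' (ω, s) := by
  subst e
  exact Path.ext (_root_.funext fun r => (chainSq hΨ f).realizeSq_zero_right (ω r) s)

lemma chainSqLoop_one_right (e : (squareRow f 1).monotone.functor ⋙ Ψ = Ψ') (ω : KSp C)
    (s : unitInterval) : chainSqLoop hΨ f (ω, (s, 1)) = chainLoop hΨ' (ω, s) := by
  subst e
  exact Path.ext (_root_.funext fun r => (chainSq hΨ f).realizeSq_one_right (ω r) s)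

lemma chainSqLoop_zero_left (e : (squareCol f 0).monotone.functor ⋙ Ψ = Ψ') (ω : KSp C)
    (s : unitInterval) : chainSqLoop hΨ f (ω, (0, s)) = chainLoop hΨ' (ω, s) := by
  subst e
  exact Path.ext (_root_.funext fun r => (chainSq hΨ f).realizeSq_zero_left (ω r) s)

lemma chainSqLoop_one_left (e : (squareCol f 1).monotone.functor ⋙ Ψ = Ψ') (ω : KSp C)
    (s : unitInterval) : chainSqLoop hΨ f (ω, (1, s)) = chainLoop hΨ' (ω, s) := by
  subst e
  exact Path.ext (_root_.funext fun r => (chainSq hΨ f).realizeSq_one_left (ω r) s)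

end Loops

section NatFamilies

variable {C D E : Type (u + 1)} [Category.{u} C] [Category.{u} D] [Category.{u} E]
  [CofCat C] [CofCat D] [CofCat E]

lemma isExactChain_mk₁ {F F' : C ⥤ D} (hF : IsExactFunctor F) (hF' : IsExactFunctor F')
    (α : F ⟶ F') [IsIso α] : IsExactChain (ComposableArrows.mk₁ α) where
  exact k := by
    match k with
    | 0 => exact hF
    | 1 => exact hF'
  iso {k l} h := by
    match k, l, h with
    | 0, 0, h => exact inferInstanceAs (IsIso (𝟙 F))
    | 0, 1, h => exact inferInstanceAs (IsIso α)
    | 1, 1, h => exact inferInstanceAs (IsIso (𝟙 F'))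
    | 1, 0, h => exact absurd (leOfHom h) (by decide)

lemma isExactChain_mk₂ {F F' F'' : C ⥤ D} (hF : IsExactFunctor F) (hF' : IsExactFunctor F')
    (hF'' : IsExactFunctor F'') (α : F ⟶ F') (β : F' ⟶ F'') [IsIso α] [IsIso β] :
    IsExactChain (ComposableArrows.mk₂ α β) where
  exact k := by
    match k with
    | 0 => exact hF
    | 1 => exact hF'
    | 2 => exact hF''
  iso {k l} h := by
    match k, l, h with
    | 0, 0, h => exact inferInstanceAs (IsIso (𝟙 F))
    | 0, 1, h => exact inferInstanceAs (IsIso α)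
    | 0, 2, h => exact inferInstanceAs (IsIso (α ≫ β))
    | 1, 1, h => exact inferInstanceAs (IsIso (𝟙 F'))
    | 1, 2, h => exact inferInstanceAs (IsIso β)
    | 2, 2, h => exact inferInstanceAs (IsIso (𝟙 F''))
    | 1, 0, h => exact absurd (leOfHom h) (by decide)
    | 2, 0, h => exact absurd (leOfHom h) (by decide)
    | 2, 1, h => exact absurd (leOfHom h) (by decide)

/-- The map `K(C) × [0, 1] → K(D)` given by a natural isomorphism of exact functors. -/
abbrev natLoop {F F' : C ⥤ D} (hF : IsExactFunctor F) (hF' : IsExactFunctor F')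
    (α : F ⟶ F') [IsIso α] : C(KSp C × unitInterval, KSp D) :=
  chainLoop (isExactChain_mk₁ hF hF' α)

lemma natLoop_id {F : C ⥤ D} (hF : IsExactFunctor F) (ω : KSp C) (s : unitInterval) :
    natLoop hF hF (𝟙 F) (ω, s) = KSp.map F hF ω :=
  Path.ext (_root_.funext fun r =>
    (chainCyl (isExactChain_mk₁ hF hF (𝟙 F))).realize_of_const (sDiagMap F hF)
      (fun _ G κ => Subtype.ext (chainDiagram_mk₁_id F G.1 κ)) (ω r) s)

variable {Z : Type*} [TopologicalSpace Z] {z₀ : Z}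

/-- The composition of a based map to `K(C)` with the map `K(C) → K(D)`. -/
def PtMap.push (ω : PtMap z₀ (KSp.base C)) (F : C ⥤ D) (hF : IsExactFunctor F) :
    PtMap z₀ (KSp.base D) where
  map := (KSp.map F hF).comp ω.map
  map_base := (congrArg (KSp.map F hF) ω.map_base).trans (KSp.map_base F hF)

/-- The homotopy of maps to `K(D)` given by a natural isomorphism of exact functors. -/
def natFam (ω : PtMap z₀ (KSp.base C)) {F F' : C ⥤ D} (hF : IsExactFunctor F)
    (hF' : IsExactFunctor F') (α : F ⟶ F') [IsIso α] : PathFam (ω.push F hF) (ω.push F' hF') where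
  path z := ⟨⟨fun s => natLoop hF hF' α (ω.map z, s), by fun_prop⟩,
    chainLoop_zero (isExactChain_mk₁ hF hF' α) _, chainLoop_one (isExactChain_mk₁ hF hF' α) _⟩
  continuous := by
    change Continuous fun p : Z × unitInterval => natLoop hF hF' α (ω.map p.1, p.2)
    fun_prop
  base s := (congrArg (fun x => natLoop hF hF' α (x, s)) ω.map_base).trans (chainLoop_base _ s)

/-- The square in `{0 < 1 < 2}` with one degenerate side. -/
def triangle : Fin (1 + 1) × Fin (1 + 1) →o Fin (2 + 1) where
  toFun p := if p.2 = 1 then 2 else p.1.castSucc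
  monotone' := by decide

section Triangle

variable {M : Type*} [Category* M] {A A' A'' : M} (α : A ⟶ A') (β : A' ⟶ A'')

lemma triangle_row_zero :
    (squareRow triangle 0).monotone.functor ⋙ ComposableArrows.mk₂ α β = ComposableArrows.mk₁ α :=
  ComposableArrows.ext₁ rfl rfl ((Category.id_comp _).trans (Category.comp_id _)).symm

lemma triangle_row_one : (squareRow triangle 1).monotone.functor ⋙ ComposableArrows.mk₂ α β =
    ComposableArrows.mk₁ (𝟙 A'') :=
  ComposableArrows.ext₁ rfl rfl ((Category.id_comp _).trans (Category.comp_id _)).symm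

lemma triangle_col_zero : (squareCol triangle 0).monotone.functor ⋙ ComposableArrows.mk₂ α β =
    ComposableArrows.mk₁ (α ≫ β) :=
  ComposableArrows.ext₁ rfl rfl ((Category.id_comp _).trans (Category.comp_id _)).symm

lemma triangle_col_one :
    (squareCol triangle 1).monotone.functor ⋙ ComposableArrows.mk₂ α β = ComposableArrows.mk₁ β :=
  ComposableArrows.ext₁ rfl rfl ((Category.id_comp _).trans (Category.comp_id _)).symm

end Triangle

/-- Composition of natural isomorphisms corresponds to concatenation of homotopies. -/
lemma natFam_comp (ω : PtMap z₀ (KSp.base C)) {F F' F'' : C ⥤ D} (hF : IsExactFunctor F)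
    (hF' : IsExactFunctor F') (hF'' : IsExactFunctor F'') (α : F ⟶ F') (β : F' ⟶ F'') [IsIso α]
    [IsIso β] : (natFam ω hF hF' α).cls ≫ (natFam ω hF' hF'' β).cls =
      (natFam ω hF hF'' (α ≫ β)).cls := by
  have h := isExactChain_mk₂ hF hF' hF'' α β
  have h1 : (natFam ω hF'' hF'' (𝟙 F'')).cls = 𝟙 _ :=
    PathFam.ext_cls (q := PathFam.refl _) fun z s => natLoop_id hF'' _ s
  rw [← Category.comp_id (natFam ω hF hF'' (α ≫ β)).cls, ← h1]
  refine PathFam.cls_square ((chainSqLoop h triangle).comp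
    (ω.map.prodMap (ContinuousMap.id _))) (fun k => ?_) _ _ _ _ (fun z s => ?_) (fun z s => ?_)
    (fun z s => ?_) fun z s => ?_
  · exact (congrArg (fun x => chainSqLoop h triangle (x, k)) ω.map_base).trans
      (chainSqLoop_base h _ k)
  · exact (chainSqLoop_zero_right h triangle (isExactChain_mk₁ hF hF' α) (triangle_row_zero α β)
      (ω.map z) s).symm
  · exact (chainSqLoop_one_left h triangle (isExactChain_mk₁ hF' hF'' β) (triangle_col_one α β)
      (ω.map z) s).symm
  · exact (chainSqLoop_zero_left h triangle (isExactChain_mk₁ hF hF'' (α ≫ β))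
      (triangle_col_zero α β) (ω.map z) s).symm
  · exact (chainSqLoop_one_right h triangle (isExactChain_mk₁ hF'' hF'' (𝟙 F''))
      (triangle_row_one α β) (ω.map z) s).symm

end NatFamilies

/-! ### Naturality and comparison with coassembly -/

section Comparison

variable {C D E : Type (u + 1)} [Category.{u} C] [Category.{u} D] [Category.{u} E]

lemma chainDiagram_whiskerLeft (N : E ⥤ C) {F F' : C ⥤ D} (α : F ⟶ F') {n : ℕ} (G : SIndex n ⥤ E)
    (κ : Fin (n + 1) →o Fin (1 + 1)) :
    chainDiagram (ComposableArrows.mk₁ α) (G ⋙ N) κ =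
      chainDiagram (ComposableArrows.mk₁ (Functor.whiskerLeft N α)) G κ := by
  have e : ComposableArrows.mk₁ (Functor.whiskerLeft N α) =
      ComposableArrows.mk₁ α ⋙ (Functor.whiskeringLeft E C D).obj N :=
    ComposableArrows.ext₁ rfl rfl ((Category.id_comp _).trans (Category.comp_id _)).symm
  rw [e]
  rfl

lemma chainDiagram_whiskerRight {F F' : C ⥤ D} (α : F ⟶ F') (N : D ⥤ E) {n : ℕ} (G : SIndex n ⥤ C)
    (κ : Fin (n + 1) →o Fin (1 + 1)) :
    chainDiagram (ComposableArrows.mk₁ α) G κ ⋙ N =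
      chainDiagram (ComposableArrows.mk₁ (Functor.whiskerRight α N)) G κ := by
  have e : ComposableArrows.mk₁ (Functor.whiskerRight α N) =
      ComposableArrows.mk₁ α ⋙ (Functor.whiskeringRight C D E).obj N :=
    ComposableArrows.ext₁ rfl rfl ((Category.id_comp _).trans (Category.comp_id _)).symm
  rw [e]
  refine CategoryTheory.Functor.ext (fun _ => rfl) fun x y a => ?_
  refine (N.map_comp _ _).trans ?_
  exact ((Category.id_comp _).trans (Category.comp_id _)).symm

/-- The tautological natural automorphism of `P` for a functor `X ↦ (P, f)` to `Aut(D)`. -/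
def autNat (N : C ⥤ AutCat D) : N ⋙ AutCat.forget D ⟶ N ⋙ AutCat.forget D where
  app X := (N.obj X).obj.φ
  naturality _ _ f := (AutCat.comm (N.map f)).symm

instance (N : C ⥤ AutCat D) : IsIso (autNat N) :=
  have : ∀ X, IsIso ((autNat N).app X) := fun X => (N.obj X).property
  NatIso.isIso_of_isIso_app _

lemma twist_eq_chainDiagram (N : C ⥤ AutCat D) {n : ℕ} (G : SIndex n ⥤ C)
    (κ : Fin (n + 1) →o Fin (1 + 1)) :
    twist (G ⋙ N) κ = chainDiagram (ComposableArrows.mk₁ (autNat N)) G κ := by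
  -- both diagrams come from functors on `{0 < 1} × C`
  let Ψ : Fin (1 + 1) ⥤ (C ⥤ D) :=
    { obj _ := N ⋙ AutCat.forget D
      map {i j} _ := if i = j then 𝟙 _ else autNat N
      map_id _ := if_pos rfl
      map_comp {i j k} a b := by
        have h1 : i ≤ j := leOfHom a
        have h2 : j ≤ k := leOfHom b
        by_cases hij : i = j
        · subst hij
          rw [if_pos rfl, Category.id_comp]
        · have hjk : j = k := by omega
          subst hjk
          rw [if_neg hij, if_pos rfl, Category.comp_id] }
  have e : ComposableArrows.mk₁ (autNat N) = Ψ :=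
    ComposableArrows.ext₁ rfl rfl ((Category.id_comp _).trans (Category.comp_id _)).symm
  rw [e]
  refine CategoryTheory.Functor.ext (fun _ => rfl) fun x y a => ?_
  refine Eq.trans ?_ ((Category.id_comp _).trans (Category.comp_id _)).symm
  change (if κ x.1 = κ y.1 then 𝟙 _ else (N.obj (G.obj x)).obj.φ) ≫ (N.map (G.map a)).hom.hom =
    NatTrans.app (if κ x.1 = κ y.1 then 𝟙 (N ⋙ AutCat.forget D) else autNat N) (G.obj x) ≫
      (N.map (G.map a)).hom.hom
  split_ifs <;> rfl

variable [CofCat C] [CofCat D] [CofCat E]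

lemma natLoop_map {N : E ⥤ C} (hN : IsExactFunctor N) {F F' : C ⥤ D} (hF : IsExactFunctor F)
    (hF' : IsExactFunctor F') (α : F ⟶ F') [IsIso α] (ω : KSp E) (s : unitInterval) :
    natLoop hF hF' α (KSp.map N hN ω, s) =
      natLoop (hN.comp hF) (hN.comp hF') (Functor.whiskerLeft N α) (ω, s) := by
  have e : (chainCyl (isExactChain_mk₁ hF hF' α)).pre (sDiagMap N hN) =
      chainCyl (isExactChain_mk₁ (hN.comp hF) (hN.comp hF') (Functor.whiskerLeft N α)) :=
    Cylinder.ext_h fun _ G κ => Subtype.ext (chainDiagram_whiskerLeft N α G.1 κ)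
  ext r
  refine (Cylinder.realize_pre (sDiagMap N hN) _ (ω r) s).trans ?_
  rw [e]
  rfl

lemma map_natLoop {F F' : C ⥤ D} (hF : IsExactFunctor F) (hF' : IsExactFunctor F') (α : F ⟶ F')
    [IsIso α] {N : D ⥤ E} (hN : IsExactFunctor N) (ω : KSp C) (s : unitInterval) :
    KSp.map N hN (natLoop hF hF' α (ω, s)) =
      natLoop (hF.comp hN) (hF'.comp hN) (Functor.whiskerRight α N) (ω, s) := by
  have e : (chainCyl (isExactChain_mk₁ hF hF' α)).post (sDiagMap N hN) =
      chainCyl (isExactChain_mk₁ (hF.comp hN) (hF'.comp hN) (Functor.whiskerRight α N)) :=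
    Cylinder.ext_h fun _ G κ => Subtype.ext (chainDiagram_whiskerRight α N G.1 κ)
  ext r
  refine (Cylinder.realize_post _ (sDiagMap N hN) (ω r) s).trans ?_
  rw [e]
  rfl

/-- Coassembly is the homotopy given by the tautological automorphism. -/
lemma coassembly_map {N : C ⥤ AutCat D} (hN : IsExactFunctor N) (ω : KSp C) (s : unitInterval) :
    (coassembly D (KSp.map N hN ω)).1 s =
      natLoop (hN.comp AutCat.forget_exact) (hN.comp AutCat.forget_exact) (autNat N) (ω, s) := by
  have e : (autCylinder D).pre (sDiagMap N hN) =
      chainCyl (isExactChain_mk₁ (hN.comp AutCat.forget_exact) (hN.comp AutCat.forget_exact)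
        (autNat N)) :=
    Cylinder.ext_h fun _ G κ => Subtype.ext (twist_eq_chainDiagram N G.1 κ)
  ext r
  refine (Cylinder.realize_pre (sDiagMap N hN) _ (ω r) s).trans ?_
  rw [e]
  rfl

end Comparison

/-! ### Transitivity of extension of scalars -/

section BaseChangeComp

variable {R S T : Type u} [Ring R] [Ring S] [Ring T] (φ : R →+* S) (ψ : S →+* T) (χ : R →+* T)
  (M : Type u) [AddCommGroup M] [Module R M]

/-- The additive map `m ↦ 1 ⊗ m`. -/
def bcUnit : M →+ BC φ M where
  toFun m := bcMk φ 1 m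
  map_zero' := bcMk_zero_right φ 1
  map_add' := bcMk_add_right φ 1

variable {M} in
lemma bcUnit_smul (r : R) (m : M) : bcUnit φ M (r • m) = φ r • bcUnit φ M m := by
  change bcMk φ 1 (r • m) = φ r • bcMk φ 1 m
  rw [← bcMk_rel, smul_bcMk, one_mul, mul_one]

variable (h : ∀ r, χ r = ψ (φ r))

/-- The map `T ⊗_R M → T ⊗_S (S ⊗_R M)`. -/
def bcToComp : BC χ M →ₗ[T] BC ψ (BC φ M) :=
  bcLift χ ((bcUnit ψ (BC φ M)).comp (bcUnit φ M)) fun r m => by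
    rw [AddMonoidHom.comp_apply, bcUnit_smul, bcUnit_smul, h]
    rfl

/-- The additive map `S ⊗_R M → T ⊗_R M`, `s ⊗ m ↦ ψ(s) ⊗ m`. -/
def bcInner : BC φ M →+ BC χ M :=
  -- `T ⊗_R M` is regarded as an `S`-module
  let _ : Module S (BC χ M) := Module.compHom _ ψ
  (bcLift φ (bcUnit χ M) fun r m => by
    rw [bcUnit_smul, h]
    rfl).toAddMonoidHom

lemma bcInner_smul (s : S) (x : BC φ M) :
    bcInner φ ψ χ M h (s • x) = ψ s • bcInner φ ψ χ M h x :=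
  let _ : Module S (BC χ M) := Module.compHom _ ψ
  (bcLift φ (bcUnit χ M) fun r m => by
    rw [bcUnit_smul, h]
    rfl).map_smul s x

lemma bcInner_mk (m : M) : bcInner φ ψ χ M h (bcMk φ 1 m) = bcMk χ 1 m :=
  let _ : Module S (BC χ M) := Module.compHom _ ψ
  (bcLift_mk φ (bcUnit χ M) (fun r m => by
    rw [bcUnit_smul, h]
    rfl) 1 m).trans (one_smul S (bcUnit χ M m))

/-- The map `T ⊗_S (S ⊗_R M) → T ⊗_R M`. -/
def bcOfComp : BC ψ (BC φ M) →ₗ[T] BC χ M :=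
  bcLift ψ (bcInner φ ψ χ M h) (bcInner_smul φ ψ χ M h)

lemma bcToComp_mk (m : M) :
    bcToComp φ ψ χ M h (bcMk χ 1 m) = bcMk ψ 1 (bcMk φ 1 m) :=
  (bcLift_mk _ _ _ _ _).trans (one_smul _ _)

lemma bcOfComp_mk (m : M) :
    bcOfComp φ ψ χ M h (bcMk ψ 1 (bcMk φ 1 m)) = bcMk χ 1 m :=
  (bcLift_mk _ _ _ _ _).trans ((one_smul _ _).trans (bcInner_mk φ ψ χ M h m))

lemma bcOfComp_toComp : bcOfComp φ ψ χ M h ∘ₗ bcToComp φ ψ χ M h = LinearMap.id :=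
  bc_ext χ fun m => by
    rw [LinearMap.comp_apply, bcToComp_mk, bcOfComp_mk]
    rfl

variable {M} in
/-- A linear map on `T ⊗_S (S ⊗_R M)` is determined by its values on the `1 ⊗ 1 ⊗ m`. -/
lemma bc_ext₂ {V : Type u} [AddCommGroup V] [Module T V] {f g : BC ψ (BC φ M) →ₗ[T] V}
    (h : ∀ m, f (bcMk ψ 1 (bcMk φ 1 m)) = g (bcMk ψ 1 (bcMk φ 1 m))) : f = g := by
  refine bc_ext ψ fun x => ?_
  let _ : Module S V := Module.compHom _ ψ
  let toS (f : BC ψ (BC φ M) →ₗ[T] V) : BC φ M →ₗ[S] V :=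
    { toFun x := f (bcMk ψ 1 x)
      map_add' x y := by rw [bcMk_add_right, map_add]
      map_smul' s x := by
        refine Eq.trans ?_ (f.map_smul (ψ s) (bcMk ψ 1 x))
        rw [smul_bcMk, ← bcMk_rel, one_mul, mul_one] }
  exact LinearMap.congr_fun (bc_ext φ (f := toS f) (g := toS g) h) x

lemma bcToComp_ofComp : bcToComp φ ψ χ M h ∘ₗ bcOfComp φ ψ χ M h = LinearMap.id :=
  bc_ext₂ φ ψ fun m => by
    rw [LinearMap.comp_apply, bcOfComp_mk, bcToComp_mk]
    rfl

variable {M} in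
lemma bcToComp_map {N : Type u} [AddCommGroup N] [Module R N] (f : M →ₗ[R] N) :
    bcToComp φ ψ χ N h ∘ₗ bcMap χ f = bcMap ψ (bcMap φ f) ∘ₗ bcToComp φ ψ χ M h :=
  bc_ext χ fun m => by
    rw [LinearMap.comp_apply, LinearMap.comp_apply, bcMap_mk, bcToComp_mk, bcToComp_mk, bcMap_mk,
      bcMap_mk]

end BaseChangeComp

section ExtendComp

variable {A B B' : Type u} [Ring A] [Ring B] [Ring B'] (φ : A →+* B) (ψ : B →+* B') (χ : A →+* B')
  (h : ∀ a, χ a = ψ (φ a))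

/-- The natural isomorphism `P ⊗_A B' ≅ (P ⊗_A B) ⊗_B B'`. -/
def bcFunctorComp : bcFunctor χ ≅ bcFunctor φ ⋙ bcFunctor ψ :=
  have h' : ∀ a, RingHom.op χ a = RingHom.op ψ (RingHom.op φ a) := fun a => congrArg op (h a.unop)
  NatIso.ofComponents
    (fun P =>
      { hom := ofLin (P := bcObj χ P) (Q := bcObj ψ (bcObj φ P))
          (bcToComp (RingHom.op φ) (RingHom.op ψ) (RingHom.op χ) P.obj h')
        inv := ofLin (P := bcObj ψ (bcObj φ P)) (Q := bcObj χ P)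
          (bcOfComp (RingHom.op φ) (RingHom.op ψ) (RingHom.op χ) P.obj h')
        hom_inv_id := lin_ext (bcOfComp_toComp _ _ _ _ h')
        inv_hom_id := lin_ext (bcToComp_ofComp _ _ _ _ h') })
    fun f => lin_ext (bcToComp_map _ _ _ h' (lin f))

/-- The natural isomorphism `P ⊗_A B' ≅ (P ⊗_A B) ⊗_B B'` for the normalized models. -/
def extendComp : extend χ ≅ extend φ ⋙ extend ψ :=
  (extendIso χ).symm ≪≫ bcFunctorComp φ ψ χ h ≪≫
    Functor.isoWhiskerRight (extendIso φ) (bcFunctor ψ) ≪≫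
    Functor.isoWhiskerLeft (extend φ) (extendIso ψ)

/-- Extension of scalars takes multiplication by `b` to multiplication by `ψ(b)`. -/
lemma extend_map_scal {b : B} (hb : b ∈ Set.center B) (hb' : ψ b ∈ Set.center B') (P : PMod B) :
    (extend ψ).map (scal b hb P) = scal (ψ b) hb' _ := by
  have e : bcHom ψ (scal b hb P) = scal (ψ b) hb' (bcObj ψ P) := by
    refine lin_ext (bc_ext (RingHom.op ψ) (M := P.obj) (V := BC (RingHom.op ψ) P.obj) fun m => ?_)
    refine (bcMap_mk _ _ _ _).trans ?_
    exact bcUnit_smul (RingHom.op ψ) (op b) m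
  rw [extend_map, e]
  exact (scal_conj (cmpIso ψ P) hb').symm

end ExtendComp

section Substitution

variable {A : Type u} [Ring A] (S : Submonoid A[X]) [h : MonicCentric S]

lemma locMap_num (p : A[X]) : locMap S (Loc.num (revSub S) p) = substInv S p :=
  OreLocalization.universalHom_commutes _ _ _

lemma locMap_const (a : A) : Loc.const S a = locMap S (Loc.const (revSub S) a) :=
  ((locMap_num S _).trans (eval₂_C _ _)).symm

lemma locMap_t : locMap S (Loc.t (revSub S)) = tInv S :=
  (locMap_num S _).trans (eval₂_X _ _)

lemma tInv_mem_center : tInv S ∈ Set.center (Loc S) := by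
  rw [Semigroup.mem_center_iff]
  intro x
  have hx : x * Loc.t S = Loc.t S * x := (((Loc.t_mem_center S).comm x).eq).symm
  calc x * tInv S = tInv S * (Loc.t S * x) * tInv S := by
        rw [← mul_assoc (tInv S), tInv_mul_t, one_mul]
    _ = tInv S * x * (Loc.t S * tInv S) := by rw [← hx]; simp only [mul_assoc]
    _ = tInv S * x := by rw [t_mul_tInv, mul_one]

end Substitution

/-! ### The product of `t - f` and `(1 - f t⁻¹)⁻¹` -/

section Automorphisms

variable {A : Type u} [Ring A]

lemma scal_comp {b c d : A} (hb : b ∈ Set.center A) (hc : c ∈ Set.center A)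
    (hd : d ∈ Set.center A) (h : b * c = d) (P : PMod A) :
    scal b hb P ≫ scal c hc P = scal d hd P :=
  lin_ext (by
    ext x
    change op c • op b • x = op d • x
    rw [smul_smul, ← op_mul, h])

lemma scal_one (h1 : (1 : A) ∈ Set.center A) (P : PMod A) : scal 1 h1 P = 𝟙 P :=
  lin_ext (by
    ext x
    exact one_smul Aᵐᵒᵖ x)

variable (S : Submonoid A[X]) [h : MonicCentric S]

lemma scal_t_tInv (P : PMod (Loc S)) :
    scal (Loc.t S) (Loc.t_mem_center S) P ≫ scal (tInv S) (tInv_mem_center S) P = 𝟙 P := by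
  rw [scal_comp _ _ Set.one_mem_center (t_mul_tInv S), scal_one]

lemma scal_tInv_t (P : PMod (Loc S)) :
    scal (tInv S) (tInv_mem_center S) P ≫ scal (Loc.t S) (Loc.t_mem_center S) P = 𝟙 P := by
  rw [scal_comp _ _ Set.one_mem_center (tInv_mul_t S), scal_one]

/-- Extension of scalars from `A` to `A[t⁻¹]_T` and then to `A[t]_S`. -/
abbrev extendInv : PMod A ⥤ PMod (Loc S) := extend (Loc.const (revSub S)) ⋙ extend (locMap S)

lemma extendInv_exact : IsExactFunctor (extendInv S) := (extend_exact _).comp (extend_exact _)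

/-- The natural isomorphism `P ⊗_A A[t]_S ≅ (P ⊗_A A[t⁻¹]_T) ⊗ A[t]_S`. -/
def extendInvIso : extend (Loc.const S) ≅ extendInv S :=
  extendComp (Loc.const (revSub S)) (locMap S) (Loc.const S) (locMap_const S)

/-- Multiplication by `t`, as a natural automorphism of `P ↦ P ⊗_A A[t]_S`. -/
def mulT : extend (Loc.const S) ⟶ extend (Loc.const S) where
  app _ := scal (Loc.t S) (Loc.t_mem_center S) _
  naturality _ _ _ := (scal_naturality _ _ _).symm

instance : IsIso (mulT S) :=
  have : ∀ P, IsIso ((mulT S).app P) := fun _ => ⟨scal (tInv S) (tInv_mem_center S) _,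
    scal_t_tInv S _, scal_tInv_t S _⟩
  NatIso.isIso_of_isIso_app _

/-- The identity `t - f = t (1 - f t⁻¹)`. -/
lemma tauEnd_extendInvIso {P : PMod A} (f : P ⟶ P) :
    tauEnd (Loc.const S) (Loc.t_mem_center S) f ≫ (extendInvIso S).hom.app P =
      (mulT S).app P ≫ (extendInvIso S).hom.app P ≫ (extend (locMap S)).map
        (zetaEnd (Loc.const (revSub S)) (Loc.t_mem_center (revSub S)) f) := by
  have hc : locMap S (Loc.t (revSub S)) ∈ Set.center (Loc S) := by
    rw [locMap_t]; exact tInv_mem_center S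
  have h1 : (extend (locMap S)).map
      (zetaEnd (Loc.const (revSub S)) (Loc.t_mem_center (revSub S)) f) =
      𝟙 ((extendInv S).obj P) -
        (extendInv S).map f ≫ scal (tInv S) (tInv_mem_center S) ((extendInv S).obj P) := by
    rw [zetaEnd, Functor.map_sub, CategoryTheory.Functor.map_id, Functor.map_comp,
      extend_map_scal _ _ hc]
    simp only [locMap_t]
    rfl
  have h2 := (extendInvIso S).hom.naturality f
  have h3 : (mulT S).app P ≫ (extendInvIso S).hom.app P ≫ (extendInv S).map f ≫
      scal (tInv S) (tInv_mem_center S) _ =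
        (extend (Loc.const S)).map f ≫ (extendInvIso S).hom.app P := by
    rw [← Category.assoc ((extendInvIso S).hom.app P), ← h2, ← scal_naturality,
      ← Category.assoc ((mulT S).app P)]
    exact (congrArg (· ≫ _) (scal_t_tInv S ((extend (Loc.const S)).obj P))).trans
      (Category.id_comp _)
  rw [h1, Preadditive.comp_sub, Preadditive.comp_sub, h3, tauEnd, Preadditive.sub_comp,
    Category.comp_id]
  rfl

/-- The functor `(P, f) ↦ P ⊗_A A[t]_S`. -/
abbrev baseFunctor : EndS S ⥤ PMod (Loc S) := EndS.forget S ⋙ extend (Loc.const S)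

/-- The functor `(P, f) ↦ (P ⊗_A A[t⁻¹]_T) ⊗ A[t]_S`. -/
abbrev baseFunctorInv : EndS S ⥤ PMod (Loc S) := EndS.forget S ⋙ extendInv S

lemma baseFunctor_exact : IsExactFunctor (baseFunctor S) :=
  (EndS.forget_exact S).comp (extend_exact _)

lemma baseFunctorInv_exact : IsExactFunctor (baseFunctorInv S) :=
  (EndS.forget_exact S).comp (extendInv_exact S)

/-- The natural automorphism `t - f`. -/
def tauNat : baseFunctor S ⟶ baseFunctor S := autNat (tauFunctor S)

instance : IsIso (tauNat S) := inferInstanceAs (IsIso (autNat (tauFunctor S)))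

/-- The natural automorphism `(1 - f t⁻¹)⁻¹`. -/
def zetaNat : baseFunctorInv S ⟶ baseFunctorInv S :=
  Functor.whiskerRight (autNat (zetaFunctor S)) (extend (locMap S))

instance : IsIso (zetaNat S) :=
  inferInstanceAs (IsIso (Functor.whiskerRight (autNat (zetaFunctor S)) (extend (locMap S))))

/-- The identity `(t - f) (1 - f t⁻¹)⁻¹ = t`: the product of the two automorphisms does not
involve `f`. -/
lemma tauNat_zetaNat : tauNat S ≫ Functor.whiskerLeft (EndS.forget S) (extendInvIso S).hom ≫
    zetaNat S = Functor.whiskerLeft (EndS.forget S) (mulT S) ≫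
      Functor.whiskerLeft (EndS.forget S) (extendInvIso S).hom := by
  ext X : 2
  have := isIso_zetaEnd_loc S X
  change tauEnd (Loc.const S) (Loc.t_mem_center S) X.obj.φ ≫
      (extendInvIso S).hom.app X.obj.obj ≫ (extend (locMap S)).map
        (inv (zetaEnd (Loc.const (revSub S)) (Loc.t_mem_center (revSub S)) X.obj.φ)) =
    (mulT S).app X.obj.obj ≫ (extendInvIso S).hom.app X.obj.obj
  rw [Functor.map_inv, ← Category.assoc, IsIso.comp_inv_eq, tauEnd_extendInvIso, Category.assoc]

end Automorphisms

/-! ### Loops on the homotopy fiber -/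

/-- The identity in a groupoid to which the product of the two families of loops reduces. -/
lemma conj_comp_conj {M : Type*} [Groupoid M] {x y y' : M} {a : x ⟶ y} {θ : y ⟶ y'} {g t : y ⟶ y}
    {k : y' ⟶ y'} (ht : a ≫ t = a) (hg : g ≫ θ ≫ k = t ≫ θ) :
    ((a ≫ g) ≫ Groupoid.inv a) ≫ (((a ≫ θ) ≫ k) ≫ Groupoid.inv (a ≫ θ)) = 𝟙 x := by
  have h1 : ((a ≫ g) ≫ Groupoid.inv a) ≫ (((a ≫ θ) ≫ k) ≫ Groupoid.inv (a ≫ θ)) =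
      a ≫ (g ≫ θ ≫ k) ≫ Groupoid.inv (a ≫ θ) := by
    simp [Groupoid.inv_eq_inv]
  rw [h1, hg, ← Category.assoc, ← Category.assoc, ht, Groupoid.comp_inv]

section Reduced

variable {A : Type u} [Ring A] (S : Submonoid A[X])

/-- The projection `K̃(End_A^S) → K(End_A^S)`. -/
def redProj : PtMap (KRed.base S) (KSp.base (EndS S)) where
  map := ⟨fun z => z.1.1, continuous_fst.comp continuous_subtype_val⟩
  map_base := rfl

variable {D : Type (u + 1)} [Category.{u} D] [CofCat D]

/-- The constant map. -/
def constPt : PtMap (KRed.base S) (KSp.base D) := ⟨ContinuousMap.const _ _, rfl⟩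

/-- The image under `K(G)` of the path in `K(A)` that is part of a point of the homotopy
fiber. -/
def redPath {G : PMod A ⥤ D} (hG : IsExactFunctor G) :
    PathFam (constPt S) ((redProj S).push (EndS.forget S ⋙ G) ((EndS.forget_exact S).comp hG)) where
  path z := ⟨(KSp.map G hG).comp z.1.2, (congrArg (KSp.map G hG) z.2.1).trans (KSp.map_base G hG),
    (congrArg (KSp.map G hG) z.2.2).trans (KSp.map_comp _ _ _ _ _)⟩
  continuous := by
    have : Continuous fun p : KRed S × unitInterval => p.1.1.2 :=
      continuous_snd.comp (continuous_subtype_val.comp continuous_fst)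
    change Continuous fun p : KRed S × unitInterval => KSp.map G hG (p.1.1.2 p.2)
    fun_prop
  base _ := KSp.map_base G hG

/-- A natural isomorphism `α : G ≅ G'` carries the paths given by `G` to those given by `G'`: the
square is `(s, u) ↦ α_u(γ(s))`, where `γ` is the path in `K(A)`. -/
lemma redPath_natFam {G G' : PMod A ⥤ D} (hG : IsExactFunctor G) (hG' : IsExactFunctor G')
    (α : G ⟶ G') [IsIso α] : (redPath S hG).cls ≫
      (natFam (redProj S) ((EndS.forget_exact S).comp hG) ((EndS.forget_exact S).comp hG')
        (Functor.whiskerLeft (EndS.forget S) α)).cls = (redPath S hG').cls := by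
  refine Eq.trans ?_ (Category.id_comp (redPath S hG').cls)
  have hc : Continuous fun p : KRed S × (unitInterval × unitInterval) => p.1.1.2 :=
    continuous_snd.comp (continuous_subtype_val.comp continuous_fst)
  refine PathFam.cls_square ⟨fun p => natLoop hG hG' α (p.1.1.2 p.2.1, p.2.2), by fun_prop⟩
    (fun k => chainLoop_base _ _) _ _ (PathFam.refl _) _ (fun z s => ?_) (fun z s => ?_)
    (fun z s => ?_) fun z s => ?_
  · exact (chainLoop_zero (isExactChain_mk₁ hG hG' α) _).symm
  · refine (natLoop_map (EndS.forget_exact S) hG hG' α z.1.1 s).symm.trans ?_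
    exact congrArg (fun x => natLoop hG hG' α (x, s)) z.2.2.symm
  · refine (chainLoop_base (isExactChain_mk₁ hG hG' α) s).symm.trans ?_
    exact congrArg (fun x => natLoop hG hG' α (x, s)) z.2.1.symm
  · exact (chainLoop_one (isExactChain_mk₁ hG hG' α) _).symm

/-- The loops at the base point given by an automorphism of `(P, f) ↦ G(P)`, transported along
the path of a point of the homotopy fiber. -/
def redFam {G : PMod A ⥤ D} (hG : IsExactFunctor G)
    (α : EndS.forget S ⋙ G ⟶ EndS.forget S ⋙ G) [IsIso α] :
    PathFam (constPt S) (constPt (D := D) S) :=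
  ((redPath S hG).trans (natFam (redProj S) ((EndS.forget_exact S).comp hG)
    ((EndS.forget_exact S).comp hG) α)).trans (redPath S hG).symm

variable [h : MonicCentric S]

lemma tauRed_eq : tauRed S =
    (redFam S (extend_exact (Loc.const S)) (tauNat S)).toLoop fun _ => rfl := by
  ext1 z
  refine Path.ext (_root_.funext fun s => ?_)
  refine (Path.trans_apply _ _ _).trans (Eq.trans ?_ (Path.trans_apply _ _ _).symm)
  split_ifs with h1
  · refine (Path.trans_apply _ _ _).trans (Eq.trans ?_ (Path.trans_apply _ _ _).symm)
    split_ifs with h2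
    · rfl
    · exact coassembly_map (tauFunctor_exact S) _ _
  · rfl

lemma zetaInvRed_eq : zetaInvRed S =
    (redFam S (extendInv_exact S) (zetaNat S)).toLoop fun _ => rfl := by
  ext1 z
  refine Path.ext (_root_.funext fun s => ?_)
  refine (congrArg (KSp.map (extend (locMap S)) (extend_exact _)) (Path.trans_apply _ _ _)).trans
    (Eq.trans ?_ (Path.trans_apply _ _ _).symm)
  split_ifs with h1
  · refine (congrArg (KSp.map (extend (locMap S)) (extend_exact _)) (Path.trans_apply _ _ _)).trans
      (Eq.trans ?_ (Path.trans_apply _ _ _).symm)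
    split_ifs with h2
    · exact KSp.map_comp _ _ _ _ _
    · refine (congrArg (KSp.map (extend (locMap S)) (extend_exact _))
        (coassembly_map (zetaFunctor_exact S) _ _)).trans ?_
      exact map_natLoop _ _ _ (extend_exact (locMap S)) _ _
  · exact KSp.map_comp _ _ _ _ _

/-- In the groupoid of families of paths, the product of the two families of loops is trivial. -/
lemma redFam_tau_zeta : (redFam S (extend_exact (Loc.const S)) (tauNat S)).cls ≫
    (redFam S (extendInv_exact S) (zetaNat S)).cls = 𝟙 (constPt S) := by
  have hF := baseFunctor_exact S
  have hF' := baseFunctorInv_exact S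
  have h1 := redPath_natFam S (extend_exact (Loc.const S)) (extendInv_exact S)
    (extendInvIso S).hom
  have h2 := redPath_natFam S (extend_exact (Loc.const S)) (extend_exact (Loc.const S)) (mulT S)
  -- `(t - f) θ (1 - f t⁻¹)⁻¹ = t θ` for the comparison `θ` of the two extensions of scalars
  have h3 : (natFam (redProj S) hF hF (tauNat S)).cls ≫
      (natFam (redProj S) hF hF' (Functor.whiskerLeft (EndS.forget S) (extendInvIso S).hom)).cls ≫
        (natFam (redProj S) hF' hF' (zetaNat S)).cls =
      (natFam (redProj S) hF hF (Functor.whiskerLeft (EndS.forget S) (mulT S))).cls ≫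
        (natFam (redProj S) hF hF'
          (Functor.whiskerLeft (EndS.forget S) (extendInvIso S).hom)).cls := by
    rw [natFam_comp, natFam_comp, natFam_comp]
    congr 2
    exact tauNat_zetaNat S
  change (((redPath S (extend_exact (Loc.const S))).cls ≫
    (natFam (redProj S) hF hF (tauNat S)).cls) ≫
      Groupoid.inv (redPath S (extend_exact (Loc.const S))).cls) ≫
    (((redPath S (extendInv_exact S)).cls ≫ (natFam (redProj S) hF' hF' (zetaNat S)).cls) ≫
      Groupoid.inv (redPath S (extendInv_exact S)).cls) = 𝟙 _
  rw [← h1]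
  exact conj_comp_conj h2 h3

end Reduced

end KTau
end

/-- The maps `τ̃(t)` and `ζ̃(t⁻¹)` from `K̃(End_A^S)` to `ΩK(A[t]_S)` are additive inverses, and
`τ̃(t)` factors through `ΩK(A[t⁻¹]_T)` as the composite of `-ζ̃(t⁻¹)` with the canonical map
`ΩK(A[t⁻¹]_T) → ΩK(A[t]_S)`, up to homotopies relative to the base point. -/
theorem corollaryB {A : Type u} [Ring A] (S : Submonoid A[X]) [KTau.MonicCentric S] :
    ((KTau.loopAdd (KTau.tauRed S) (KTau.zetaInvRed S)).HomotopicRel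
        (ContinuousMap.const _ (Path.refl _)) {KTau.KRed.base S} ∧
      (KTau.loopAdd (KTau.zetaInvRed S) (KTau.tauRed S)).HomotopicRel
        (ContinuousMap.const _ (Path.refl _)) {KTau.KRed.base S}) ∧
    (KTau.tauRed S).HomotopicRel
      ((KTau.locLoopK S).comp (KTau.loopNeg (KTau.zetaRed S))) {KTau.KRed.base S} := by
  have h1 := KTau.redFam_tau_zeta S
  have h2 : (KTau.redFam S (KTau.extend_exact (KTau.Loc.const S)) (KTau.tauNat S)).cls =
      Groupoid.inv (KTau.redFam S (KTau.extendInv_exact S) (KTau.zetaNat S)).cls := by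
    rw [← Category.comp_id (KTau.redFam S _ (KTau.tauNat S)).cls,
      ← Groupoid.comp_inv (KTau.redFam S _ (KTau.zetaNat S)).cls, ← Category.assoc, h1,
      Category.id_comp]
  have h3 : (KTau.locLoopK S).comp (KTau.loopNeg (KTau.zetaRed S)) =
      KTau.loopNeg (KTau.zetaInvRed S) := rfl
  rw [h3, KTau.tauRed_eq, KTau.zetaInvRed_eq]
  refine ⟨⟨?_, ?_⟩, ?_⟩
  · exact KTau.PathFam.homotopicRel_of_cls_eq (p := (KTau.redFam S _ _).trans (KTau.redFam S _ _))
      (q := KTau.PathFam.refl _) (fun _ => rfl) h1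
  · refine KTau.PathFam.homotopicRel_of_cls_eq
      (p := (KTau.redFam S _ _).trans (KTau.redFam S _ _)) (q := KTau.PathFam.refl _)
      (fun _ => rfl) ?_
    rw [KTau.PathFam.cls_trans, h2, Groupoid.comp_inv, KTau.PathFam.cls_refl]
  · exact KTau.PathFam.homotopicRel_of_cls_eq (p := KTau.redFam S _ _)
      (q := (KTau.redFam S _ _).symm) (fun _ => rfl) h2
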